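/- Fix a smooth arclength-parametrized curve $\gamma_0\colon\mathbb R\to\mathbb R^3$ asymptotic at both ends to a line $p+\mathbb R e$, $|e|=1$, i.e. $\gamma_0(s)-(p+(s+c_\pm)e)\to0$ as $s\to\pm\infty$ for some constants $c_\pm$. Let $\mathit{BAL}$ be the set of smooth arclength-parametrized curves $\gamma\colon\mathbb R\to\mathbb R^3$ with nowhere vanishing curvature $\kappa$ and torsion $\tau$ such that * for some real $\ell=\ell(\gamma)$ (the renormalized length), $\gamma(s\pm\ell/2)-\gamma_0(s)\to 0$ as $s\to\pm\infty$; * $\kappa$ is rapidly decreasing, i.e. $\kappa P\to0$ at $\pm\infty$ for every polynomial $P(s)$, and for every $n\ge 0$ the functions $\kappa^{-1}\partial_s^n\kappa$ and $\partial_s^n\tau$ are asymptotically polynomial-like, where $f$ is called so if $f/P\to0$ at $\pm\infty$ for some nonzero polynomial $P(s)$. A scalar field is a map $\mathit{BAL}\times\mathbb R\to\mathbb R$, a tangent field a map $\mathit{BAL}\times\mathbb R\to\mathbb R^3$ (the value at $(\gamma,s)$ being a vector at $\gamma(s)$). Let $T,N,B$ be the Frenet frame and, for scalar fields $f$, put $\partial_s^{-1}f(\gamma,s)=\frac12\bigl(\int_{-\infty}^s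 f(\gamma,t)\,dt-\int_s^\infty f(\gamma,t)\,dt\bigr)$ and $(\int f)(\gamma,s)=\int_{-\infty}^\infty f(\gamma,t)\,dt$. Let $(\mathcal A_n)_{n\in\mathbb Z}$ be the smallest family of real vector spaces of scalar fields such that $\kappa\in\mathcal A_1$, $\kappa^{-1}\in\mathcal A_{-1}$, $\tau,s,\ell,1\in\mathcal A_0$, $\mathcal A_n\subset\mathcal A_{n-1}$, $\mathcal A_i\mathcal A_j\subset\mathcal A_{i+j}$, $\partial_s\mathcal A_n\subset\mathcal A_n$, and $\partial_s^{-1}f,\int f\in\mathcal A_0$ for all $f\in\mathcal A_2$. Let $$\wp(\mathcal X)=\{\partial_s^{-1}(\kappa g)\,T+gN+hB \;:\; g,h\in\mathcal A_1\}.$$ For a tangent field $X$, a variation of $\gamma\in\mathit{BAL}$ along $X$ is a family $\Gamma_\varepsilon\in\mathit{BAL}$ $(\varepsilon\in\mathbb R)$ with $\Gamma_0=\gamma$ and $\partial_\varepsilon\partial_s^n\Gamma_\varepsilon(s)|_{\varepsilon=0}=\partial_s^nX(\gamma,s)$ for all $n\ge0$ and all $s$, such that for each $n\ge1$ there is a polynomial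 $P_n$ with $|\partial_s^n\Gamma_\varepsilon(s)-\partial_s^n\gamma(s)|\le|\varepsilon|P_n(s)\kappa(\gamma,s)$ for all small $\varepsilon$ and all $s$, and there is a polynomial $Q$ with $\kappa(\gamma,s)\le Q(s)\kappa(\Gamma_\varepsilon,s)$ for all small $\varepsilon$ and all $s$. The variational derivative along $X$ of a field $F$, at $(\gamma,s)$, is $\frac{d}{d\varepsilon}F(\Gamma_\varepsilon,s)|_{\varepsilon=0}$; it is denoted by $\delta_XF$ if $F$ is a scalar field and by $\tilde\nabla_XF$ if $F$ is a tangent field. **Theorem.** $\wp(\mathcal X)$ is a real vector space. For every $X\in\wp(\mathcal X)$, every $\gamma\in\mathit{BAL}$ has a variation along $X$, and the variational derivatives $\delta_Xf$ $(f\in\mathcal A_n,\ n\in\mathbb Z)$ and $\tilde\nabla_XY$ $(Y\in\wp(\mathcal X))$ exist and do not depend on the variation. The space $\wp(\mathcal X)$ is a real Lie algebra with the product $$[X,Y]:=\tilde\nabla_XY-\tilde\nabla_YX .$$ For every $n\in\mathbb Z$, $\mathcal A_n$ is a module over this Lie algebra with the action $X\cdot f=\delta_Xf$: $\delta_X$ maps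 $\mathcal A_n$ linearly into itself, depends linearly on $X$, and $$(\delta_X\delta_Y-\delta_Y\delta_X-\delta_{[X,Y]})f=0\qquad\text{for all }X,Y\in\wp(\mathcal X),\ f\in\mathcal A_n .$$ -/

import Mathlib

open Filter Topology MeasureTheory
open scoped ContDiff

namespace Filament

/-- Euclidean three-space; every tangent space is identified with it by translation. -/
abbrev E3 : Type := EuclideanSpace ℝ (Fin 3)

noncomputable section

/-- The vector product of Euclidean three-space. -/
def cross (u v : E3) : E3 := WithLp.toLp 2 (crossProduct (WithLp.ofLp u) (WithLp.ofLp v))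

/-! ### Curves parametrized by arclength and their Frenet data -/

/-- Infinitely extended smooth curves parametrized by arclength. -/
def IsAPC (γ : ℝ → E3) : Prop := ContDiff ℝ ∞ γ ∧ ∀ s, ‖deriv γ s‖ = 1

/-- Unit tangent. -/
def tang (γ : ℝ → E3) (s : ℝ) : E3 := deriv γ s

/-- Curvature. -/
def curv (γ : ℝ → E3) (s : ℝ) : ℝ := ‖deriv (tang γ) s‖

/-- Principal normal (meaningful where the curvature does not vanish). -/
def norml (γ : ℝ → E3) (s : ℝ) : E3 := (curv γ s)⁻¹ • deriv (tang γ) s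

/-- Binormal. -/
def binorm (γ : ℝ → E3) (s : ℝ) : E3 := cross (tang γ s) (norml γ s)

/-- Torsion: the `B`-component of the derivative of `N`. -/
def tors (γ : ℝ → E3) (s : ℝ) : ℝ := inner ℝ (deriv (norml γ) s) (binorm γ s)

/-! ### Asymptotic conditions and the phase space -/

/-- `f / P → 0` at both ends for some (nonzero) polynomial `P`. -/
def PolyLike (f : ℝ → ℝ) : Prop :=
  ∃ P : Polynomial ℝ, P ≠ 0 ∧ Tendsto (fun s => f s / P.eval s) (atBot ⊔ atTop) (𝓝 0)

/-- `f * P → 0` at both ends for every polynomial `P`. -/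
def RapidDecr (f : ℝ → ℝ) : Prop :=
  ∀ P : Polynomial ℝ, Tendsto (fun s => f s * P.eval s) (atBot ⊔ atTop) (𝓝 0)

/-- The curve `γ` is asymptotic, at both ends, to the line through `p` with direction `e`,
run through in the direction of `e`. -/
def AsymptoticToLine (p e : E3) (γ : ℝ → E3) : Prop :=
  (∃ c : ℝ, Tendsto (fun s => γ s - (p + (s + c) • e)) atTop (𝓝 0)) ∧
  (∃ c : ℝ, Tendsto (fun s => γ s - (p + (s + c) • e)) atBot (𝓝 0))

/-- `γ (s ± ℓ / 2) → γ₀ s` as `s → ± ∞`: the curve `γ` is asymptotic to the reference curve and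
balanced (`ℓ₊ = ℓ₋ = ℓ / 2`), with renormalized length `ℓ`. -/
def IsBalanced (γ₀ γ : ℝ → E3) (l : ℝ) : Prop :=
  Tendsto (fun s => γ (s + l / 2) - γ₀ s) atTop (𝓝 0) ∧
  Tendsto (fun s => γ (s - l / 2) - γ₀ s) atBot (𝓝 0)

/-- Balanced asymptotically linear curves, relative to the reference curve `γ₀`. -/
structure IsBAL (γ₀ γ : ℝ → E3) : Prop where
  apc : IsAPC γ
  curv_ne_zero : ∀ s, curv γ s ≠ 0
  balanced : ∃ l, IsBalanced γ₀ γ l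
  curv_rapid : RapidDecr (curv γ)
  curv_poly : ∀ n : ℕ, PolyLike (fun s => (curv γ s)⁻¹ * iteratedDeriv n (curv γ) s)
  tors_poly : ∀ n : ℕ, PolyLike (iteratedDeriv n (tors γ))

/-- The space of balanced asymptotically linear curves. -/
def BAL (γ₀ : ℝ → E3) : Type := {γ : ℝ → E3 // IsBAL γ₀ γ}

/-- A field along the curves, with values in `V`. -/
abbrev FieldAlong (γ₀ : ℝ → E3) (V : Type) : Type := BAL γ₀ → ℝ → V

/-- Scalar fields. -/
abbrev ScalarField (γ₀ : ℝ → E3) : Type := FieldAlong γ₀ ℝ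

/-- Tangent fields. -/
abbrev TangentField (γ₀ : ℝ → E3) : Type := FieldAlong γ₀ E3

variable {γ₀ : ℝ → E3}

/-- The renormalized length. -/
def renLength (γ : BAL γ₀) : ℝ := γ.2.balanced.choose

/-! ### Scalar fields given by expressions -/

/-- Differentiation along the curve. -/
def dS (f : ScalarField γ₀) : ScalarField γ₀ := fun γ => deriv (f γ)

/-- Anti-differentiation along the curve. -/
def antiS (f : ScalarField γ₀) : ScalarField γ₀ :=
  fun γ s => (1 / 2) * ((∫ t in Set.Iic s, f γ t) - ∫ t in Set.Ioi s, f γ t)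

/-- Definite integration along the curve, as a scalar field constant in `s`. -/
def intS (f : ScalarField γ₀) : ScalarField γ₀ := fun γ _ => ∫ t, f γ t

/-- `κ` as a scalar field. -/
def kap : ScalarField γ₀ := fun γ => curv γ.1

/-- `f` has an expression of degree `n`, built from `κ, κ⁻¹, τ, s, ℓ, 1` by addition, scaling,
multiplication, `∂ₛ`, `∂ₛ⁻¹` and `∫`, the last two being applied only to expressions of
degree `2`. -/
inductive IsExpr : ℤ → ScalarField γ₀ → Prop
  | kappa : IsExpr 1 kap
  | kappaInv : IsExpr (-1) (fun γ s => (kap γ s)⁻¹)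
  | tau : IsExpr 0 (fun γ => tors γ.1)
  | param : IsExpr 0 (fun _ s => s)
  | length : IsExpr 0 (fun γ _ => renLength γ)
  | one : IsExpr 0 (fun _ _ => 1)
  | zero (n : ℤ) : IsExpr n 0
  | add {n : ℤ} {f g : ScalarField γ₀} : IsExpr n f → IsExpr n g → IsExpr n (f + g)
  | smul {n : ℤ} (c : ℝ) {f : ScalarField γ₀} : IsExpr n f → IsExpr n (c • f)
  | lower {n : ℤ} {f : ScalarField γ₀} : IsExpr n f → IsExpr (n - 1) f
  | mul {i j : ℤ} {f g : ScalarField γ₀} : IsExpr i f → IsExpr j g → IsExpr (i + j) (f * g)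
  | deriv {n : ℤ} {f : ScalarField γ₀} : IsExpr n f → IsExpr n (dS f)
  | anti {f : ScalarField γ₀} : IsExpr 2 f → IsExpr 0 (antiS f)
  | int {f : ScalarField γ₀} : IsExpr 2 f → IsExpr 0 (intS f)

/-- The space `𝒜ₙ` of scalar fields having an expression of degree `n`. -/
def Alg (γ₀ : ℝ → E3) (n : ℤ) : Submodule ℝ (ScalarField γ₀) where
  carrier := {f | IsExpr n f}
  add_mem' hf hg := IsExpr.add hf hg
  zero_mem' := IsExpr.zero n
  smul_mem' c _ hf := IsExpr.smul c hf

/-- The tangent field `∂ₛ⁻¹(κ g) T + g N + h B`. -/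
def wp (g h : ScalarField γ₀) : TangentField γ₀ := fun γ s =>
  antiS (kap * g) γ s • tang γ.1 s + g γ s • norml γ.1 s + h γ s • binorm γ.1 s

/-- The set `℘(𝒳)` of tangent fields `∂ₛ⁻¹(κ g) T + g N + h B` with `g, h ∈ 𝒜₁`. -/
def wpX (γ₀ : ℝ → E3) : Set (TangentField γ₀) :=
  {X | ∃ g ∈ Alg γ₀ 1, ∃ h ∈ Alg γ₀ 1, X = wp g h}

/-! ### Variational derivatives -/

/-- `Γ` is a variation, through balanced asymptotically linear curves, of the curve `γ` with
variational vector field `v` along `γ`. All derivatives in `s` are differentiable in the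
parameter `ε` at `ε = 0`, the asymptotic control being uniform in `ε`: for `n ≥ 1` the
difference quotients of the `n`-th derivatives are bounded by a polynomial times the
curvature of `γ`, and this curvature is bounded by a polynomial times that of `Γ ε`. -/
structure IsVariation (γ : BAL γ₀) (v : ℝ → E3) (Γ : ℝ → BAL γ₀) : Prop where
  base : Γ 0 = γ
  velocity : ∀ (n : ℕ) (s : ℝ),
    HasDerivAt (fun ε => iteratedDeriv n (Γ ε).1 s) (iteratedDeriv n v s) 0
  control : ∀ n : ℕ, 1 ≤ n → ∃ P : Polynomial ℝ, ∀ᶠ ε in 𝓝 (0 : ℝ), ∀ s : ℝ,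
    ‖iteratedDeriv n (Γ ε).1 s - iteratedDeriv n γ.1 s‖ ≤ |ε| * P.eval s * curv γ.1 s
  curv_control : ∃ P : Polynomial ℝ, ∀ᶠ ε in 𝓝 (0 : ℝ), ∀ s : ℝ,
    curv γ.1 s ≤ P.eval s * curv (Γ ε).1 s

/-- `G` is the variational derivative of the field `F` along `X`: it is the derivative of `F`
along every variation with variational vector field `X`. -/
def HasVar {V : Type} [NormedAddCommGroup V] [NormedSpace ℝ V]
    (X : TangentField γ₀) (F G : FieldAlong γ₀ V) : Prop :=
  ∀ (γ : BAL γ₀) (Γ : ℝ → BAL γ₀), IsVariation γ (X γ) Γ →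
    ∀ s : ℝ, HasDerivAt (fun ε => F (Γ ε) s) (G γ s) 0

open Classical in
/-- The variational derivative of the field `F` along `X`, computed along some variation with
variational vector field `X`. It is the operator on scalar fields if `V` is the real line and
the operator on tangent fields if `V` is Euclidean three-space. -/
def var {V : Type} [NormedAddCommGroup V] [NormedSpace ℝ V]
    (X : TangentField γ₀) (F : FieldAlong γ₀ V) : FieldAlong γ₀ V := fun γ s =>
  if h : ∃ Γ : ℝ → BAL γ₀, IsVariation γ (X γ) Γ then
    deriv (fun ε => F (h.choose ε) s) 0
  else 0

/-- The commutator of tangent fields. -/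
def comm (X Y : TangentField γ₀) : TangentField γ₀ := var X Y - var Y X

end

end Filament

open Filament

/-! For `X = ∂ₛ⁻¹(κ g) T + g N + h B` the tangential part of `∂ₛ X` is `κ g - κ g = 0`, so `∂ₛ X = p
N + q B` is orthogonal to `T` and is the velocity of the unit tangent (`dS_coordF_wp`, `hasVar_tF`).
Everything else is determined by the tangent: `κ² = |T'|²`, `N = κ⁻¹ T'`, `B = T × N`, `τ = ⟨N',
B⟩`, and the renormalized length changes by minus the integral of the change of `T`, paired with `e`
(`renLength_eq`). This yields the variations of all generators of the algebra.

Analytically, a field of degree `n` is dominated, together with its derivatives in `s`, by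
polynomials times `κⁿ`, and its change along a variation by `ε` times such a bound (`Good`). The
operations that generate the spaces `𝒜ₙ` preserve these bounds, and the bounds justify the
interchange of `∂_ε` with `∂ₛ` and with integration (`HasVar.dS`, `HasVar.setIntegral`). By
induction over expressions, `δ_X` exists and maps `𝒜ₙ` into itself (`Gen.exists_hasVar`,
`var_mem_alg`); it obeys the Leibniz rule and commutes with `∂ₛ`, `∂ₛ⁻¹` and `∫`
(`isDerivation_var`).

A variation along `X` is built from its tangents. The tangent of `γ` is moved on the unit sphere
with velocity `∂ₛ X`, the motion being cut off far out so that near the ends nothing changes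
(`exists_tangentDeformation`). A correction on a compact interval, of vanishing first order, makes
the total displacement parallel to `e` (`IsTangentDeformation.exists_correction`). Integration by
the balanced antiderivative then gives balanced curves, with velocity `X` because `X` is the
balanced antiderivative of its own derivative (`coordF_wp_eq_anti`).

The algebra rests on one rigidity statement: if the coordinates of `T` are admitted in expressions,
a derivation is determined by its values on `s`, `ℓ` and `T` (`IsDerivation.eq_zero`). Linearity of
`δ_X` in `X` and the identity for `δ_[X,Y]` are checked on these generators. That the bracket stays
in `℘(𝒳)` is the identity `kap_mul_commN`, by which its tangential component is `∂ₛ⁻¹` of `κ` times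
its normal component. The Jacobi identity follows by letting `δ_[X,Y]` act on coordinates of tangent
fields. -/

namespace Filament

/-! ### Families of functions bounded by polynomials times a weight -/

section Tame

variable {ι ι' : Type*} {l : Filter ι} {l' : Filter ι'} {w w' u v : ι → ℝ → ℝ}

/-- Along `l`, the family `u` is bounded by a polynomial times the weight `w`. -/
def Tame (l : Filter ι) (w u : ι → ℝ → ℝ) : Prop :=
  ∃ (C : ℝ) (m : ℕ), 0 ≤ C ∧ ∀ᶠ i in l, ∀ s, |u i s| ≤ C * (1 + s ^ 2) ^ m * |w i s|

theorem one_le_br (s : ℝ) : (1 : ℝ) ≤ 1 + s ^ 2 := by nlinarith [sq_nonneg s]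

theorem one_le_br_pow (s : ℝ) (m : ℕ) : (1 : ℝ) ≤ (1 + s ^ 2) ^ m := one_le_pow₀ (one_le_br s)

theorem br_pow_le (s : ℝ) {m n : ℕ} (h : m ≤ n) : (1 + s ^ 2) ^ m ≤ (1 + s ^ 2) ^ n :=
  pow_le_pow_right₀ (one_le_br s) h

theorem br_pow_pos (s : ℝ) (m : ℕ) : (0 : ℝ) < (1 + s ^ 2) ^ m := by positivity

theorem Tame.congr (h : Tame l w u) (huv : ∀ᶠ i in l, u i = v i) : Tame l w v := by
  obtain ⟨C, m, hC, H⟩ := h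
  refine ⟨C, m, hC, ?_⟩
  filter_upwards [H, huv] with i h1 h2 s
  rw [← h2]; exact h1 s

theorem Tame.add (hu : Tame l w u) (hv : Tame l w v) : Tame l w (fun i s => u i s + v i s) := by
  obtain ⟨C, m, hC, H⟩ := hu
  obtain ⟨D, n, hD, H'⟩ := hv
  refine ⟨C + D, m + n, by positivity, ?_⟩
  filter_upwards [H, H'] with i h1 h2 s
  have a1 := mul_le_mul_of_nonneg_right (mul_le_mul_of_nonneg_left
    (br_pow_le s (Nat.le_add_right m n)) hC) (abs_nonneg (w i s))
  have a2 := mul_le_mul_of_nonneg_right (mul_le_mul_of_nonneg_left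
    (br_pow_le s (Nat.le_add_left n m)) hD) (abs_nonneg (w i s))
  calc |u i s + v i s| ≤ |u i s| + |v i s| := abs_add_le _ _
    _ ≤ _ := add_le_add ((h1 s).trans a1) ((h2 s).trans a2)
    _ = _ := by ring

theorem Tame.mul (hu : Tame l w u) (hv : Tame l w' v) :
    Tame l (fun i s => w i s * w' i s) (fun i s => u i s * v i s) := by
  obtain ⟨C, m, hC, H⟩ := hu
  obtain ⟨D, n, hD, H'⟩ := hv
  refine ⟨C * D, m + n, by positivity, ?_⟩
  filter_upwards [H, H'] with i h1 h2 s
  rw [abs_mul, abs_mul]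
  calc |u i s| * |v i s| ≤ _ := mul_le_mul (h1 s) (h2 s) (abs_nonneg _) (by positivity)
    _ = _ := by rw [pow_add]; ring

theorem Tame.mono (hu : Tame l w u) (hw : Tame l w' w) : Tame l w' u := by
  obtain ⟨C, m, hC, H⟩ := hu
  obtain ⟨D, n, hD, H'⟩ := hw
  refine ⟨C * D, m + n, by positivity, ?_⟩
  filter_upwards [H, H'] with i h1 h2 s
  calc |u i s| ≤ C * (1 + s ^ 2) ^ m * |w i s| := h1 s
    _ ≤ C * (1 + s ^ 2) ^ m * (D * (1 + s ^ 2) ^ n * |w' i s|) :=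
        mul_le_mul_of_nonneg_left (h2 s) (by positivity)
    _ = _ := by rw [pow_add]; ring

theorem Tame.of_le (hu : Tame l w u) (h : ∀ᶠ i in l, ∀ s, |v i s| ≤ |u i s|) : Tame l w v := by
  obtain ⟨C, m, hC, H⟩ := hu
  refine ⟨C, m, hC, ?_⟩
  filter_upwards [H, h] with i h1 h2 s
  exact (h2 s).trans (h1 s)

theorem Tame.refl : Tame l w w := ⟨1, 0, zero_le_one, Eventually.of_forall fun i s => by simp⟩

theorem Tame.const (c : ℝ) : Tame l (fun _ _ => 1) (fun _ _ => c) :=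
  ⟨|c|, 0, abs_nonneg c, Eventually.of_forall fun i s => by simp⟩

theorem Tame.comp_tendsto (hu : Tame l w u) {j : ι' → ι} (hj : Tendsto j l' l) :
    Tame l' (fun i => w (j i)) (fun i => u (j i)) := by
  obtain ⟨C, m, hC, H⟩ := hu
  exact ⟨C, m, hC, hj.eventually H⟩

/-- Along `l`, the family `u` is smooth, and its derivatives of order at most `K` are tame. -/
def TameTo (K : ℕ) (l : Filter ι) (w u : ι → ℝ → ℝ) : Prop :=
  (∀ᶠ i in l, ContDiff ℝ ∞ (u i)) ∧ ∀ k ≤ K, Tame l w (fun i => iteratedDeriv k (u i))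

/-- Along `l`, the family `u` is smooth, and all its derivatives are tame. -/
def SmoothTame (l : Filter ι) (w u : ι → ℝ → ℝ) : Prop :=
  (∀ᶠ i in l, ContDiff ℝ ∞ (u i)) ∧ ∀ k, Tame l w (fun i => iteratedDeriv k (u i))

theorem smoothTame_iff : SmoothTame l w u ↔ ∀ K, TameTo K l w u :=
  ⟨fun h K => ⟨h.1, fun k _ => h.2 k⟩, fun h => ⟨(h 0).1, fun k => (h k).2 k le_rfl⟩⟩

theorem TameTo.tame {K : ℕ} (h : TameTo K l w u) : Tame l w u := by
  simpa using h.2 0 (Nat.zero_le _)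

theorem tameTo_zero : TameTo 0 l w u ↔ (∀ᶠ i in l, ContDiff ℝ ∞ (u i)) ∧ Tame l w u := by
  constructor
  · exact fun h => ⟨h.1, h.tame⟩
  · rintro ⟨h1, h2⟩
    refine ⟨h1, fun k hk => ?_⟩
    obtain rfl : k = 0 := by omega
    simpa using h2

/-- This splitting drives the inductions on the number of controlled derivatives. Products,
reciprocals, square roots and compositions have derivatives that are again products of functions
already controlled to order `K`. -/
theorem tameTo_succ {K : ℕ} : TameTo (K + 1) l w u ↔
    (∀ᶠ i in l, ContDiff ℝ ∞ (u i)) ∧ Tame l w u ∧ TameTo K l w (fun i => deriv (u i)) := by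
  constructor
  · intro h
    refine ⟨h.1, h.tame, ?_, fun k hk => ?_⟩
    · filter_upwards [h.1] with i hi
      exact (contDiff_infty_iff_deriv.1 hi).2
    · simpa only [iteratedDeriv_succ'] using h.2 (k + 1) (by omega)
  · rintro ⟨h1, h2, h3⟩
    refine ⟨h1, fun k hk => ?_⟩
    cases k with
    | zero => simpa using h2
    | succ k => simpa only [iteratedDeriv_succ'] using h3.2 k (by omega)

theorem TameTo.le {K L : ℕ} (h : TameTo K l w u) (hL : L ≤ K) : TameTo L l w u :=
  ⟨h.1, fun k hk => h.2 k (hk.trans hL)⟩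

theorem TameTo.congr {K : ℕ} (h : TameTo K l w u) (huv : ∀ᶠ i in l, u i = v i) :
    TameTo K l w v := by
  refine ⟨?_, fun k hk => (h.2 k hk).congr ?_⟩
  · filter_upwards [h.1, huv] with i h1 h2; rwa [← h2]
  · filter_upwards [huv] with i h2; rw [h2]

theorem TameTo.mono {K : ℕ} (h : TameTo K l w u) (hw : Tame l w' w) : TameTo K l w' u :=
  ⟨h.1, fun k hk => (h.2 k hk).mono hw⟩

theorem TameTo.add {K : ℕ} (hu : TameTo K l w u) (hv : TameTo K l w v) :
    TameTo K l w (fun i s => u i s + v i s) := by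
  refine ⟨?_, fun k hk => ((hu.2 k hk).add (hv.2 k hk)).congr ?_⟩
  · filter_upwards [hu.1, hv.1] with i h1 h2 using h1.add h2
  · filter_upwards [hu.1, hv.1] with i h1 h2
    funext s
    exact (iteratedDeriv_add (h1.contDiffAt.of_le (by exact_mod_cast le_top))
      (h2.contDiffAt.of_le (by exact_mod_cast le_top))).symm

theorem TameTo.mul {K : ℕ} (hu : TameTo K l w u) (hv : TameTo K l w' v) :
    TameTo K l (fun i s => w i s * w' i s) (fun i s => u i s * v i s) := by
  induction K generalizing u v w w' with
  | zero =>
    rw [tameTo_zero] at *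
    refine ⟨?_, hu.2.mul hv.2⟩
    filter_upwards [hu.1, hv.1] with i h1 h2 using h1.mul h2
  | succ K ih =>
    have hu' := hu.le (Nat.le_succ K)
    have hv' := hv.le (Nat.le_succ K)
    rw [tameTo_succ] at *
    refine ⟨?_, hu.2.1.mul hv.2.1, ((ih hu.2.2 hv').add (ih hu' hv.2.2)).congr ?_⟩
    · filter_upwards [hu.1, hv.1] with i h1 h2 using h1.mul h2
    · filter_upwards [hu.1, hv.1] with i h1 h2
      funext s
      exact (deriv_fun_mul (h1.differentiable (by simp) s) (h2.differentiable (by simp) s)).symm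

namespace SmoothTame

theorem toTameTo (h : SmoothTame l w u) (K : ℕ) : TameTo K l w u := smoothTame_iff.1 h K

theorem tame (h : SmoothTame l w u) : Tame l w u := (h.toTameTo 0).tame

theorem congr (h : SmoothTame l w u) (huv : ∀ᶠ i in l, u i = v i) : SmoothTame l w v :=
  smoothTame_iff.2 fun K => (h.toTameTo K).congr huv

theorem congr' (h : SmoothTame l w u) (huv : ∀ i s, u i s = v i s) : SmoothTame l w v :=
  h.congr (Eventually.of_forall fun i => funext fun s => huv i s)

theorem mono (h : SmoothTame l w u) (hw : Tame l w' w) : SmoothTame l w' u :=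
  smoothTame_iff.2 fun K => (h.toTameTo K).mono hw

theorem weight_congr (h : SmoothTame l w u) (hw : ∀ i s, w i s = w' i s) : SmoothTame l w' u := by
  obtain rfl : w = w' := funext fun i => funext fun s => hw i s
  exact h

theorem add (hu : SmoothTame l w u) (hv : SmoothTame l w v) :
    SmoothTame l w (fun i s => u i s + v i s) :=
  smoothTame_iff.2 fun K => (hu.toTameTo K).add (hv.toTameTo K)

theorem mul (hu : SmoothTame l w u) (hv : SmoothTame l w' v) :
    SmoothTame l (fun i s => w i s * w' i s) (fun i s => u i s * v i s) :=
  smoothTame_iff.2 fun K => (hu.toTameTo K).mul (hv.toTameTo K)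

theorem const (c : ℝ) : SmoothTame l (fun _ _ => 1) (fun _ _ => c) := by
  refine ⟨Eventually.of_forall fun i => contDiff_const, fun k => ?_⟩
  cases k with
  | zero => simpa using Tame.const c
  | succ k =>
    have : iteratedDeriv (k + 1) (fun _ : ℝ => c) = fun _ => 0 := by
      funext s; simp [iteratedDeriv_const]
    simpa only [this] using (Tame.const (l := l) 0)

theorem zero : SmoothTame l w (fun _ _ => 0) :=
  (const 0).congr' (fun _ _ => rfl) |>.mul (w' := w) (v := fun _ _ => 0)
    ⟨Eventually.of_forall fun i => contDiff_const, fun k => ⟨0, 0, le_rfl,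
      Eventually.of_forall fun i s => by simp⟩⟩ |>.weight_congr (fun _ _ => one_mul _) |>.congr' (by simp)

theorem const_mul (c : ℝ) (hu : SmoothTame l w u) : SmoothTame l w (fun i s => c * u i s) :=
  ((const c).mul hu).weight_congr fun i s => one_mul _

theorem neg (hu : SmoothTame l w u) : SmoothTame l w (fun i s => -u i s) :=
  (hu.const_mul (-1)).congr' fun i s => by ring

theorem sub (hu : SmoothTame l w u) (hv : SmoothTame l w v) :
    SmoothTame l w (fun i s => u i s - v i s) :=
  (hu.add hv.neg).congr' fun i s => by ring

theorem deriv (hu : SmoothTame l w u) : SmoothTame l w (fun i => deriv (u i)) :=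
  smoothTame_iff.2 fun K => (tameTo_succ.1 (hu.toTameTo (K + 1))).2.2

theorem of_deriv (h1 : ∀ᶠ i in l, ContDiff ℝ ∞ (u i)) (h2 : Tame l w u)
    (h3 : SmoothTame l w (fun i => _root_.deriv (u i))) : SmoothTame l w u :=
  smoothTame_iff.2 fun K => (tameTo_succ.2 ⟨h1, h2, h3.toTameTo K⟩).le (Nat.le_succ K)

theorem comp_tendsto (hu : SmoothTame l w u) {j : ι' → ι} (hj : Tendsto j l' l) :
    SmoothTame l' (fun i => w (j i)) (fun i => u (j i)) :=
  ⟨hj.eventually hu.1, fun k => (hu.2 k).comp_tendsto hj⟩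

theorem sum {α : Type*} (t : Finset α) {f : α → ι → ℝ → ℝ} (h : ∀ a ∈ t, SmoothTame l w (f a)) :
    SmoothTame l w (fun i s => ∑ a ∈ t, f a i s) := by
  classical
  induction t using Finset.induction_on with
  | empty =>
    simpa only [Finset.sum_empty] using zero
  | insert a t ha ih =>
    simp only [Finset.sum_insert ha]
    exact (h a (Finset.mem_insert_self a t)).add
      (ih fun b hb => h b (Finset.mem_insert_of_mem hb))

/-- The reciprocal of a family that is bounded below by its weight, up to a polynomial. -/
theorem inv (hu : SmoothTame l w u) (h0 : ∀ᶠ i in l, ∀ s, u i s ≠ 0) (hw : Tame l u w)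
    (hw0 : ∀ᶠ i in l, ∀ s, w i s ≠ 0) :
    SmoothTame l (fun i s => (w i s)⁻¹) (fun i s => (u i s)⁻¹) := by
  have hsm : ∀ᶠ i in l, ContDiff ℝ ∞ (fun s => (u i s)⁻¹) := by
    filter_upwards [hu.1, h0] with i h1 h2 using h1.inv h2
  have hb : Tame l (fun i s => (w i s)⁻¹) (fun i s => (u i s)⁻¹) := by
    obtain ⟨C, m, hC, H⟩ := hw
    refine ⟨C, m, hC, ?_⟩
    filter_upwards [H, h0, hw0] with i h1 h2 h3 s
    have b1 : 0 < |u i s| := abs_pos.2 (h2 s)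
    have b2 : 0 < |w i s| := abs_pos.2 (h3 s)
    rw [abs_inv, abs_inv, inv_le_iff_one_le_mul₀ b1, mul_assoc, mul_comm (|w i s|⁻¹), ← mul_assoc,
      ← div_eq_mul_inv, one_le_div b2]
    exact h1 s
  refine smoothTame_iff.2 fun K => ?_
  induction K with
  | zero => exact tameTo_zero.2 ⟨hsm, hb⟩
  | succ K ih =>
    refine tameTo_succ.2 ⟨hsm, hb, ?_⟩
    -- `(1/u)' = -u' (1/u)²`, of weight `w · w⁻¹ · w⁻¹ = w⁻¹`; the reciprocal enters to order `K`
    -- only.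
    refine ((((hu.deriv.const_mul (-1)).toTameTo K).mul (ih.mul ih)).congr ?_).mono ?_
    · filter_upwards [hu.1, h0] with i h1 h2
      funext s
      rw [deriv_fun_inv'' (h1.differentiable (by simp) s) (h2 s)]
      field_simp
    · refine Tame.refl.of_le ?_
      filter_upwards [hw0] with i h3 s
      refine le_of_eq ?_
      have := h3 s
      congr 1
      field_simp

/-- The square root of a positive family that is bounded below by its weight. -/
theorem sqrt (hu : SmoothTame l (fun i s => w i s ^ 2) u) (h0 : ∀ᶠ i in l, ∀ s, 0 < u i s)
    (hw : Tame l u (fun i s => w i s ^ 2)) (hw0 : ∀ᶠ i in l, ∀ s, w i s ≠ 0) :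
    SmoothTame l w (fun i s => √(u i s)) := by
  have hsm : ∀ᶠ i in l, ContDiff ℝ ∞ (fun s => √(u i s)) := by
    filter_upwards [hu.1, h0] with i h1 h2 using h1.sqrt fun s => (h2 s).ne'
  have hb : Tame l w (fun i s => √(u i s)) := by
    obtain ⟨C, m, hC, H⟩ := hu.tame
    refine ⟨√C, m, by positivity, ?_⟩
    filter_upwards [H, h0] with i h1 h2 s
    rw [abs_of_nonneg (Real.sqrt_nonneg _)]
    apply Real.sqrt_le_iff.2 ⟨by positivity, ?_⟩
    calc u i s ≤ |u i s| := le_abs_self _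
      _ ≤ _ := h1 s
      _ ≤ C * ((1 + s ^ 2) ^ m * (1 + s ^ 2) ^ m) * |w i s ^ 2| := by
        gcongr
        exact le_mul_of_one_le_right (by positivity) (one_le_br_pow s m)
      _ = _ := by
        rw [mul_pow, mul_pow, Real.sq_sqrt hC, abs_pow]; ring
  have hinv := hu.inv (h0.mono fun i h s => (h s).ne') hw
    (hw0.mono fun i h s => pow_ne_zero 2 (h s))
  refine smoothTame_iff.2 fun K => ?_
  induction K with
  | zero => exact tameTo_zero.2 ⟨hsm, hb⟩
  | succ K ih =>
    refine tameTo_succ.2 ⟨hsm, hb, ?_⟩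
    -- `(√u)' = (u'/2) u⁻¹ √u`, of weight `w² · w⁻² · w = w`; the root enters to order `K` only.
    refine ((((hu.deriv.const_mul (1 / 2)).mul hinv).toTameTo K).mul ih |>.congr ?_).mono ?_
    · filter_upwards [hu.1, h0] with i h1 h2
      funext s
      rw [deriv_sqrt (h1.differentiable (by simp) s) (h2 s).ne']
      have h3 : √(u i s) ≠ 0 := (Real.sqrt_pos.2 (h2 s)).ne'
      have h4 : (u i s) = √(u i s) ^ 2 := (Real.sq_sqrt (h2 s).le).symm
      have h5 : (u i s)⁻¹ = (√(u i s) ^ 2)⁻¹ := by rw [← h4]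
      rw [h5]
      field_simp
    · refine Tame.refl.of_le ?_
      filter_upwards [hw0] with i h3 s
      refine le_of_eq ?_
      have := h3 s
      congr 1
      field_simp

/-- Composition with a function all of whose derivatives are bounded. -/
theorem comp {φ : ℝ → ℝ} (hφ : ContDiff ℝ ∞ φ) (hb : ∀ k, ∃ C, ∀ x, |iteratedDeriv k φ x| ≤ C)
    (hu : SmoothTame l (fun _ _ => 1) u) :
    SmoothTame l (fun _ _ => 1) (fun i s => φ (u i s)) := by
  refine smoothTame_iff.2 fun K => ?_
  have hb0 : ∀ {φ : ℝ → ℝ}, (∀ k, ∃ C, ∀ x, |iteratedDeriv k φ x| ≤ C) →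
      Tame l (fun _ _ => 1) (fun i s => φ (u i s)) := by
    intro φ h
    obtain ⟨C, hC⟩ := h 0
    refine ⟨C, 0, (abs_nonneg _).trans (hC 0), Eventually.of_forall fun i s => ?_⟩
    simpa using hC (u i s)
  have hsm : ∀ {φ : ℝ → ℝ}, ContDiff ℝ ∞ φ → ∀ᶠ i in l, ContDiff ℝ ∞ (fun s => φ (u i s)) := by
    intro φ h
    filter_upwards [hu.1] with i h1 using h.comp h1
  induction K generalizing φ with
  | zero => exact tameTo_zero.2 ⟨hsm hφ, hb0 hb⟩
  | succ K ih =>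
    have hφ' : ContDiff ℝ ∞ (_root_.deriv φ) := (contDiff_infty_iff_deriv.1 hφ).2
    have h2 := ih hφ' (fun k => by simpa only [iteratedDeriv_succ'] using hb (k + 1))
    refine tameTo_succ.2 ⟨hsm hφ, hb0 hb, ((h2.mul (hu.deriv.toTameTo K)).congr ?_).mono ?_⟩
    · filter_upwards [hu.1] with i h1
      funext s
      exact (deriv_comp s (hφ.differentiable (by simp) _) (h1.differentiable (by simp) s)).symm
    · simpa using Tame.refl
end SmoothTame

theorem iteratedDeriv_bounded_of_hasCompactSupport {φ : ℝ → ℝ} (hφ : ContDiff ℝ ∞ φ)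
    (hc : HasCompactSupport φ) (k : ℕ) : ∃ C, ∀ x, |iteratedDeriv k φ x| ≤ C := by
  have h1 : HasCompactSupport (iteratedDeriv k φ) := by
    induction k with
    | zero => simpa using hc
    | succ k ih => rw [iteratedDeriv_succ]; exact ih.deriv
  have h2 : Continuous (iteratedDeriv k φ) := hφ.continuous_iteratedDeriv k (by exact_mod_cast le_top)
  simpa using h1.exists_bound_of_continuous h2

end Tame

end Filament

namespace Filament

/-! ### Differentiation in a parameter -/

section Calculus

/-- A function differentiable in the parameter at every point, with second derivatives in `s`
that depend on the parameter in a locally Lipschitz way, has first derivatives in `s`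
differentiable in the parameter. -/
theorem hasDerivAt_deriv_param {u : ℝ → ℝ → ℝ} {G : ℝ → ℝ} {s : ℝ} (hG : DifferentiableAt ℝ G s)
    (hu : ∀ t, HasDerivAt (fun ε => u ε t) (G t) 0) (h0 : ContDiff ℝ ∞ (u 0))
    (hs : ∀ᶠ ε in 𝓝 (0 : ℝ), ContDiff ℝ ∞ (u ε)) {M : ℝ}
    (hM : ∀ᶠ ε in 𝓝 (0 : ℝ), ∀ t ∈ Set.Icc (s - 1) (s + 1),
      |iteratedDeriv 2 (fun t => u ε t - u 0 t) t| ≤ |ε| * M) :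
    HasDerivAt (fun ε => deriv (u ε) s) (deriv G s) 0 := by
  have hM0 : 0 ≤ M := by
    by_contra! hneg
    obtain ⟨δ, hδ, H⟩ := Metric.eventually_nhds_iff.1 hM
    have := H (y := δ / 2) (by rw [dist_zero_right, Real.norm_eq_abs, abs_of_pos] <;> linarith) s
      ⟨by linarith, by linarith⟩
    have h2 : |δ / 2| * M < 0 := mul_neg_of_pos_of_neg (abs_pos.2 (by positivity)) hneg
    exact absurd (abs_nonneg _) (not_le.2 (this.trans_lt h2))
  rw [hasDerivAt_iff_tendsto_slope_zero]
  simp only [zero_add, smul_eq_mul]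
  rw [Metric.tendsto_nhds]
  intro η hη
  -- choose `h`
  have hGs := hasDerivAt_iff_tendsto_slope_zero.1 hG.hasDerivAt
  simp only [smul_eq_mul] at hGs
  have e1 := Metric.tendsto_nhds.1 hGs (η / 3) (by positivity)
  -- The Taylor remainder below costs `|h| M`. The denominator `3 (M + 1)` makes this less than `η /
  -- 3` also for `M = 0`, and `|h| < 1` keeps the segment inside the interval of `hM`.
  have e2 : ∀ᶠ h in 𝓝[≠] (0 : ℝ), |h| < min 1 (η / (3 * (M + 1))) := by
    apply eventually_nhdsWithin_of_eventually_nhds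
    have : (0 : ℝ) < min 1 (η / (3 * (M + 1))) := by positivity
    filter_upwards [Metric.ball_mem_nhds (0 : ℝ) this] with x hx
    rwa [Metric.mem_ball, dist_zero_right, Real.norm_eq_abs] at hx
  obtain ⟨h, ⟨h1, h2⟩, h3⟩ := ((e1.and e2).and self_mem_nhdsWithin).exists
  have hh : h ≠ 0 := h3
  have h4 : |h| < 1 := h2.trans_le (min_le_left _ _)
  have h5 : |h| * M < η / 3 := by
    have := h2.trans_le (min_le_right _ _)
    rw [lt_div_iff₀ (by positivity)] at this
    nlinarith [abs_nonneg h]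
  have q1 := hasDerivAt_iff_tendsto_slope_zero.1 (hu (s + h))
  have q2 := hasDerivAt_iff_tendsto_slope_zero.1 (hu s)
  simp only [zero_add, smul_eq_mul] at q1 q2
  have q3 := Metric.tendsto_nhds.1 ((q1.sub q2).const_mul h⁻¹) (η / 3) (by positivity)
  filter_upwards [q3, self_mem_nhdsWithin, eventually_nhdsWithin_of_eventually_nhds hs,
    eventually_nhdsWithin_of_eventually_nhds hM] with ε r1 hε hsε hMε
  have hε : ε ≠ 0 := hε
  set d : ℝ → ℝ := fun t => u ε t - u 0 t with hd
  have hds : ContDiff ℝ ∞ d := hsε.sub h0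
  have hdd : deriv d s = deriv (u ε) s - deriv (u 0) s :=
    deriv_fun_sub (hsε.differentiable (by simp) s) (h0.differentiable (by simp) s)
  have hds' : ContDiff ℝ ∞ (deriv d) := (contDiff_infty_iff_deriv.1 hds).2
  have hmem : ∀ t ∈ segment ℝ s (s + h), t ∈ Set.Icc (s - 1) (s + 1) := by
    intro t ht
    rw [segment_eq_uIcc, Set.mem_uIcc] at ht
    rw [abs_lt] at h4
    rcases ht with ht | ht <;> exact ⟨by linarith [ht.1], by linarith [ht.2]⟩
  -- The mean value inequality twice: the bound on `d''` controls the oscillation of `d'`, and this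
  -- controls the Taylor remainder of `d`. Divided by `ε h`, the remainder is at most `|h| M`,
  -- uniformly in `ε`.
  have key : |d (s + h) - d s - h * deriv d s| ≤ |ε| * M * |h| * |h| := by
    have a1 : ∀ t ∈ segment ℝ s (s + h), ‖deriv d t - deriv d s‖ ≤ |ε| * M * |h| := by
      intro t ht
      have := (convex_segment s (s + h)).norm_image_sub_le_of_norm_deriv_le
        (f := deriv d) (C := |ε| * M) (fun x _ => hds'.differentiable (by simp) x)
        (fun x hx => by
          have := hMε x (hmem x hx)
          rwa [iteratedDeriv_succ, iteratedDeriv_one] at this)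
        (left_mem_segment ℝ s (s + h)) ht
      refine this.trans (mul_le_mul_of_nonneg_left ?_ (by positivity))
      rw [segment_eq_uIcc, Set.mem_uIcc] at ht
      rw [Real.norm_eq_abs, abs_le]
      rcases ht with ht | ht <;> constructor <;>
        linarith [ht.1, ht.2, le_abs_self h, neg_abs_le h]
    have hder : ∀ t, HasDerivAt (fun t => d t - t * deriv d s) (deriv d t - deriv d s) t := by
      intro t
      simpa using (hds.differentiable (by simp) t).hasDerivAt.fun_sub
        ((hasDerivAt_id t).mul_const (deriv d s))
    have := (convex_segment s (s + h)).norm_image_sub_le_of_norm_deriv_le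
      (f := fun t => d t - t * deriv d s) (C := |ε| * M * |h|)
      (fun x _ => (hder x).differentiableAt)
      (fun x hx => by rw [(hder x).deriv]; exact a1 x hx)
      (left_mem_segment ℝ s (s + h)) (right_mem_segment ℝ s (s + h))
    simp only [add_sub_cancel_left, Real.norm_eq_abs] at this
    convert this using 2
    ring
  rw [Real.dist_eq] at *
  have key' : |ε⁻¹ * h⁻¹ * (d (s + h) - d s) - ε⁻¹ * deriv d s| ≤ |h| * M := by
    have : ε⁻¹ * h⁻¹ * (d (s + h) - d s) - ε⁻¹ * deriv d s
        = ε⁻¹ * h⁻¹ * (d (s + h) - d s - h * deriv d s) := by field_simp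
    rw [this, abs_mul, abs_mul, abs_inv, abs_inv]
    have p1 : 0 < |ε| := abs_pos.2 hε
    have p2 : 0 < |h| := abs_pos.2 hh
    calc _ ≤ |ε|⁻¹ * |h|⁻¹ * (|ε| * M * |h| * |h|) := by gcongr
      _ = _ := by field_simp
  have r2 : h⁻¹ * (ε⁻¹ * (u ε (s + h) - u 0 (s + h)) - ε⁻¹ * (u ε s - u 0 s))
      = ε⁻¹ * h⁻¹ * (d (s + h) - d s) := by simp only [hd]; ring
  rw [r2] at r1
  rw [← hdd]
  -- Three errors of size `η / 3`: the Taylor remainder in `s`, the difference quotient in `ε` at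
  -- fixed `h`, and the difference quotient of `G`.
  calc |ε⁻¹ * deriv d s - deriv G s|
      = |-(ε⁻¹ * h⁻¹ * (d (s + h) - d s) - ε⁻¹ * deriv d s)
        + (ε⁻¹ * h⁻¹ * (d (s + h) - d s) - h⁻¹ * (G (s + h) - G s))
        + (h⁻¹ * (G (s + h) - G s) - deriv G s)| := by congr 1; ring
    _ ≤ _ := abs_add_three _ _ _
    _ < η := by rw [abs_neg]; linarith

/-- Dominated convergence: `b` bounds the difference quotients based at `0`. Only comparison with
the base parameter is needed, hence no differentiability at other parameters. -/
theorem hasDerivAt_integral_param {μ : Measure ℝ} {F : ℝ → ℝ → ℝ} {G b : ℝ → ℝ}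
    (hF : ∀ᶠ ε in 𝓝 (0 : ℝ), Continuous (F ε)) (hF0 : Integrable (F 0) μ) (hG : Continuous G)
    (hbi : Integrable b μ) (hb : ∀ᶠ ε in 𝓝 (0 : ℝ), ∀ s, |F ε s - F 0 s| ≤ |ε| * b s)
    (hd : ∀ s, HasDerivAt (fun ε => F ε s) (G s) 0) :
    HasDerivAt (fun ε => ∫ s, F ε s ∂μ) (∫ s, G s ∂μ) 0 := by
  have hmem := hF.and hb
  have hF' : Continuous fun a => ContinuousLinearMap.toSpanSingleton ℝ (G a) := by
    refine continuous_clm_apply.2 fun y => ?_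
    simpa using (by fun_prop : Continuous fun x => y * G x)
  have := hasFDerivAt_integral_of_dominated_loc_of_lip' (𝕜 := ℝ) (μ := μ) (F := F) (x₀ := 0)
    (bound := b) (s := {ε | Continuous (F ε) ∧ ∀ s, |F ε s - F 0 s| ≤ |ε| * b s})
    (F' := fun a => ContinuousLinearMap.toSpanSingleton ℝ (G a)) hmem
    (fun x hx => hx.1.aestronglyMeasurable) hF0 hF'.aestronglyMeasurable
    (ae_of_all _ fun a x hx => by
      simpa [mul_comm] using hx.2 a) hbi
    (ae_of_all _ fun a => (hd a).hasFDerivAt)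
  have h2 := this.2.hasDerivAt
  rw [ContinuousLinearMap.integral_apply this.1] at h2
  simpa using h2

end Calculus

/-! ### The balanced antiderivative -/

section Antiderivative

/-- The antiderivative whose limits at both ends add up to zero. -/
noncomputable def anti (u : ℝ → ℝ) (s : ℝ) : ℝ :=
  (1 / 2) * ((∫ t in Set.Iic s, u t) - ∫ t in Set.Ioi s, u t)

variable {u v : ℝ → ℝ}

theorem setIntegral_Ioi_eq (hu : Integrable u) (s : ℝ) :
    ∫ t in Set.Ioi s, u t = (∫ t, u t) - ∫ t in Set.Iic s, u t := by
  have := integral_add_compl (measurableSet_Iic (a := s)) hu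
  rw [Set.compl_Iic] at this
  linarith

theorem anti_eq (hu : Integrable u) (s : ℝ) :
    anti u s = (∫ t in Set.Iic s, u t) - (1 / 2) * ∫ t, u t := by
  rw [anti, setIntegral_Ioi_eq hu]; ring

theorem anti_sub (hu : Integrable u) (hv : Integrable v) (s : ℝ) :
    anti (fun t => u t - v t) s = anti u s - anti v s := by
  rw [anti, anti, anti, integral_sub hu.integrableOn hv.integrableOn,
    integral_sub hu.integrableOn hv.integrableOn]; ring

theorem anti_add (hu : Integrable u) (hv : Integrable v) (s : ℝ) :
    anti (fun t => u t + v t) s = anti u s + anti v s := by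
  rw [anti, anti, anti, integral_add hu.integrableOn hv.integrableOn,
    integral_add hu.integrableOn hv.integrableOn]; ring

theorem anti_const_mul (c : ℝ) (s : ℝ) : anti (fun t => c * u t) s = c * anti u s := by
  rw [anti, anti, integral_const_mul, integral_const_mul]; ring

theorem hasDerivAt_anti (hc : Continuous u) (hu : Integrable u) (s : ℝ) :
    HasDerivAt (anti u) (u s) s := by
  have h1 : anti u = fun x => (∫ t in (0 : ℝ)..x, u t) +
      ((∫ t in Set.Iic (0 : ℝ), u t) - (1 / 2) * ∫ t, u t) := by
    funext x
    rw [anti_eq hu, ← intervalIntegral.integral_Iic_sub_Iic hu.integrableOn hu.integrableOn]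
    ring
  rw [h1]
  exact (intervalIntegral.integral_hasDerivAt_right (hc.intervalIntegrable _ _)
    (hc.stronglyMeasurableAtFilter _ _) hc.continuousAt).add_const _

theorem tendsto_anti_atTop (hu : Integrable u) :
    Tendsto (anti u) atTop (𝓝 ((1 / 2) * ∫ t, u t)) := by
  have h1 := (tendsto_setIntegral_of_monotone (μ := volume) (f := u) (s := fun s : ℝ => Set.Iic s)
    (fun s => measurableSet_Iic) (fun a b h => Set.Iic_subset_Iic.2 h) hu.integrableOn)
  rw [Set.iUnion_Iic, Measure.restrict_univ] at h1
  have h2 := h1.sub_const ((1 / 2) * ∫ t, u t)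
  have h3 : anti u = fun s => (∫ t in Set.Iic s, u t) - (1 / 2) * ∫ t, u t :=
    funext fun s => anti_eq hu s
  rw [h3]
  convert h2 using 2
  ring

theorem tendsto_anti_atBot (hu : Integrable u) :
    Tendsto (anti u) atBot (𝓝 (-((1 / 2) * ∫ t, u t))) := by
  have hu' : Integrable fun t => u (-t) := hu.comp_neg
  have h3 : anti u = fun s => -(anti (fun t => u (-t)) (-s)) := by
    funext s
    rw [anti, anti, integral_comp_neg_Iic, integral_comp_neg_Ioi, neg_neg]; ring
  rw [h3]
  have := ((tendsto_anti_atTop hu').comp tendsto_neg_atBot_atTop).neg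
  rwa [integral_neg_eq_self] at this

theorem abs_anti_le (hu : Integrable u) (s : ℝ) : |anti u s| ≤ ∫ t, |u t| := by
  have h1 : |∫ t in Set.Iic s, u t| ≤ ∫ t in Set.Iic s, |u t| := abs_integral_le_integral_abs
  have h2 : |∫ t in Set.Ioi s, u t| ≤ ∫ t in Set.Ioi s, |u t| := abs_integral_le_integral_abs
  have h3 : ∫ t in Set.Iic s, |u t| ≤ ∫ t, |u t| :=
    setIntegral_le_integral hu.abs (ae_of_all _ fun t => abs_nonneg _)
  have h4 : ∫ t in Set.Ioi s, |u t| ≤ ∫ t, |u t| :=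
    setIntegral_le_integral hu.abs (ae_of_all _ fun t => abs_nonneg _)
  rw [anti, abs_mul, abs_of_pos (by norm_num : (0 : ℝ) < 1 / 2)]
  have := abs_sub (∫ t in Set.Iic s, u t) (∫ t in Set.Ioi s, u t)
  linarith

/-- A primitive whose limits at both ends add up to zero is the balanced antiderivative. -/
theorem eq_anti_of_hasDerivAt {F : ℝ → ℝ} {L : ℝ} (hc : Continuous u) (hu : Integrable u)
    (hF : ∀ s, HasDerivAt F (u s) s) (h1 : Tendsto F atTop (𝓝 L)) (h2 : Tendsto F atBot (𝓝 (-L))) :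
    F = anti u := by
  have hd : ∀ s, HasDerivAt (fun s => F s - anti u s) 0 s := fun s => by
    simpa using (hF s).fun_sub (hasDerivAt_anti hc hu s)
  have hconst : ∀ s, F s - anti u s = F 0 - anti u 0 := fun s =>
    is_const_of_deriv_eq_zero (fun s => (hd s).differentiableAt) (fun s => (hd s).deriv) s 0
  have t1 := h1.sub (tendsto_anti_atTop hu)
  have t2 := h2.sub (tendsto_anti_atBot hu)
  simp only [hconst] at t1 t2
  have e1 := tendsto_nhds_unique t1 tendsto_const_nhds
  have e2 := tendsto_nhds_unique t2 tendsto_const_nhds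
  funext s
  have := hconst s
  linarith

end Antiderivative
end Filament

namespace Filament

/-! ### Vectors and vector products in coordinates -/

section Coordinates

theorem inner_eq_sum (u v : E3) : inner ℝ u v = ∑ i, u i * v i := by
  rw [PiLp.inner_apply]
  exact Finset.sum_congr rfl fun i _ => by simp [mul_comm]

theorem norm_sq_eq_sum (u : E3) : ‖u‖ ^ 2 = ∑ i, u i * u i := by
  rw [← real_inner_self_eq_norm_sq, inner_eq_sum]

theorem abs_coord_le (u : E3) (i : Fin 3) : |u i| ≤ ‖u‖ := PiLp.norm_apply_le u i

theorem norm_le_sum_abs (u : E3) : ‖u‖ ≤ ∑ i, |u i| := by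
  refine abs_le_of_sq_le_sq' ?_ (by positivity) |>.2
  rw [norm_sq_eq_sum]
  simp only [Fin.sum_univ_three]
  rw [← abs_mul_abs_self (u 0), ← abs_mul_abs_self (u 1), ← abs_mul_abs_self (u 2)]
  have := abs_nonneg (u 0); have := abs_nonneg (u 1); have := abs_nonneg (u 2)
  nlinarith [mul_nonneg (abs_nonneg (u 0)) (abs_nonneg (u 1)),
    mul_nonneg (abs_nonneg (u 0)) (abs_nonneg (u 2)), mul_nonneg (abs_nonneg (u 1)) (abs_nonneg (u 2))]

theorem hasDerivAt_coord {c : ℝ → E3} {v : E3} {s : ℝ} :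
    HasDerivAt c v s ↔ ∀ i, HasDerivAt (fun t => c t i) (v i) s := by
  constructor
  · intro h i
    exact ((EuclideanSpace.proj i : E3 →L[ℝ] ℝ).hasFDerivAt.comp_hasDerivAt s h)
  · intro h
    have := hasDerivAt_pi.2 h
    exact ((PiLp.continuousLinearEquiv 2 ℝ (fun _ : Fin 3 => ℝ)).symm.toContinuousLinearMap.hasFDerivAt.comp_hasDerivAt
      s this)

theorem deriv_coord {c : ℝ → E3} (hc : Differentiable ℝ c) (s : ℝ) (i : Fin 3) :
    deriv c s i = deriv (fun t => c t i) s :=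
  ((hasDerivAt_coord.1 (hc s).hasDerivAt i).deriv).symm

theorem contDiff_coord {c : ℝ → E3} : ContDiff ℝ ∞ c ↔ ∀ i, ContDiff ℝ ∞ fun s => c s i :=
  contDiff_euclidean

theorem iteratedDeriv_coord {c : ℝ → E3} (hc : ContDiff ℝ ∞ c) (n : ℕ) (i : Fin 3) :
    (fun s => iteratedDeriv n c s i) = iteratedDeriv n fun t => c t i := by
  induction n generalizing c with
  | zero => simp
  | succ n ih =>
    rw [iteratedDeriv_succ', iteratedDeriv_succ', ih (contDiff_infty_iff_deriv.1 hc).2]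
    congr 1
    funext t
    exact deriv_coord (hc.differentiable (by simp)) t i

theorem cross_coord (u v : E3) : cross u v 0 = u 1 * v 2 - u 2 * v 1 ∧
    cross u v 1 = u 2 * v 0 - u 0 * v 2 ∧ cross u v 2 = u 0 * v 1 - u 1 * v 0 := by
  refine ⟨?_, ?_, ?_⟩ <;> simp [cross, crossProduct]

/-- An orthonormal pair, completed by its vector product, is an orthonormal basis. -/
theorem frame_complete {t n b : Fin 3 → ℝ} (h1 : ∑ i, t i * t i = 1) (h2 : ∑ i, n i * n i = 1)
    (h3 : ∑ i, t i * n i = 0) (b0 : b 0 = t 1 * n 2 - t 2 * n 1)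
    (b1 : b 1 = t 2 * n 0 - t 0 * n 2) (b2 : b 2 = t 0 * n 1 - t 1 * n 0) :
    (∑ i, b i * b i = 1) ∧ (∑ i, t i * b i = 0) ∧ (∑ i, n i * b i = 0) ∧
    ∀ i j, t i * t j + n i * n j + b i * b j = if i = j then 1 else 0 := by
  simp only [Fin.sum_univ_three] at *
  have e1 : b 0 * b 0 + b 1 * b 1 + b 2 * b 2 = 1 := by
    rw [b0, b1, b2]
    linear_combination (n 0 * n 0 + n 1 * n 1 + n 2 * n 2) * h1 + h2
      - (t 0 * n 0 + t 1 * n 1 + t 2 * n 2) * h3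
  have e2 : t 0 * b 0 + t 1 * b 1 + t 2 * b 2 = 0 := by rw [b0, b1, b2]; ring
  have e3 : n 0 * b 0 + n 1 * b 1 + n 2 * b 2 = 0 := by rw [b0, b1, b2]; ring
  refine ⟨e1, e2, e3, ?_⟩
  -- The Gram relations say that the matrix with rows `t`, `n`, `b` times its transpose is `1`. For
  -- square matrices the factors may be exchanged, which gives the completeness relation.
  have hM : (!![t 0, t 1, t 2; n 0, n 1, n 2; b 0, b 1, b 2] : Matrix (Fin 3) (Fin 3) ℝ) *
      !![t 0, n 0, b 0; t 1, n 1, b 1; t 2, n 2, b 2] = 1 := by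
    ext i j
    fin_cases i <;> fin_cases j <;>
      simp [Matrix.mul_apply, Fin.sum_univ_three] <;> linarith
  have hM' := mul_eq_one_comm.1 hM
  intro i j
  have := congrFun (congrFun hM' i) j
  rw [Matrix.one_apply] at this
  rw [← this]
  fin_cases i <;> fin_cases j <;> simp [Matrix.mul_apply, Fin.sum_univ_three]

end Coordinates

/-! ### Frenet frame and Frenet equations -/

section Frenet

/-- Coordinates of the unit tangent. -/
noncomputable def tC (γ : ℝ → E3) (i : Fin 3) (s : ℝ) : ℝ := tang γ s i

/-- Coordinates of the principal normal. -/
noncomputable def nC (γ : ℝ → E3) (i : Fin 3) (s : ℝ) : ℝ := norml γ s i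

/-- Coordinates of the binormal. -/
noncomputable def bC (γ : ℝ → E3) (i : Fin 3) (s : ℝ) : ℝ := binorm γ s i

variable {γ : ℝ → E3}

theorem contDiff_tang (hγ : IsAPC γ) : ContDiff ℝ ∞ (tang γ) :=
  (contDiff_infty_iff_deriv.1 hγ.1).2

theorem contDiff_tC (hγ : IsAPC γ) (i : Fin 3) : ContDiff ℝ ∞ (tC γ i) :=
  contDiff_coord.1 (contDiff_tang hγ) i

theorem curv_pos (h0 : ∀ s, curv γ s ≠ 0) (s : ℝ) : 0 < curv γ s :=
  lt_of_le_of_ne (norm_nonneg _) (h0 s).symm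

theorem contDiff_curv (hγ : IsAPC γ) (h0 : ∀ s, curv γ s ≠ 0) : ContDiff ℝ ∞ (curv γ) :=
  ContDiff.norm ℝ (contDiff_infty_iff_deriv.1 (contDiff_tang hγ)).2
    fun s hs => h0 s (by rw [curv, hs, norm_zero])

theorem nC_eq (hγ : IsAPC γ) (i : Fin 3) (s : ℝ) :
    nC γ i s = (curv γ s)⁻¹ * deriv (tC γ i) s := by
  rw [nC, norml, PiLp.smul_apply, smul_eq_mul,
    deriv_coord ((contDiff_tang hγ).differentiable (by simp))]
  rfl

theorem contDiff_nC (hγ : IsAPC γ) (h0 : ∀ s, curv γ s ≠ 0) (i : Fin 3) :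
    ContDiff ℝ ∞ (nC γ i) := by
  have : nC γ i = fun s => (curv γ s)⁻¹ * deriv (tC γ i) s := funext fun s => nC_eq hγ i s
  rw [this]
  exact ((contDiff_curv hγ h0).inv h0).mul (contDiff_infty_iff_deriv.1 (contDiff_tC hγ i)).2

theorem bC_zero (γ : ℝ → E3) (s : ℝ) :
    bC γ 0 s = tC γ 1 s * nC γ 2 s - tC γ 2 s * nC γ 1 s := (cross_coord _ _).1

theorem bC_one (γ : ℝ → E3) (s : ℝ) :
    bC γ 1 s = tC γ 2 s * nC γ 0 s - tC γ 0 s * nC γ 2 s := (cross_coord _ _).2.1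

theorem bC_two (γ : ℝ → E3) (s : ℝ) :
    bC γ 2 s = tC γ 0 s * nC γ 1 s - tC γ 1 s * nC γ 0 s := (cross_coord _ _).2.2

theorem contDiff_bC (hγ : IsAPC γ) (h0 : ∀ s, curv γ s ≠ 0) (i : Fin 3) :
    ContDiff ℝ ∞ (bC γ i) := by
  have ht := contDiff_tC hγ
  have hn := contDiff_nC hγ h0
  fin_cases i
  · exact (funext (bC_zero γ) : bC γ 0 = _) ▸ ((ht 1).mul (hn 2)).sub ((ht 2).mul (hn 1))
  · exact (funext (bC_one γ) : bC γ 1 = _) ▸ ((ht 2).mul (hn 0)).sub ((ht 0).mul (hn 2))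
  · exact (funext (bC_two γ) : bC γ 2 = _) ▸ ((ht 0).mul (hn 1)).sub ((ht 1).mul (hn 0))

theorem tors_eq (hγ : IsAPC γ) (h0 : ∀ s, curv γ s ≠ 0) (s : ℝ) :
    tors γ s = ∑ i, deriv (nC γ i) s * bC γ i s := by
  have : Differentiable ℝ (norml γ) :=
    (contDiff_coord.2 fun i => contDiff_nC hγ h0 i).differentiable (by simp)
  rw [tors, inner_eq_sum]
  exact Finset.sum_congr rfl fun i _ => by rw [deriv_coord this]; rfl

theorem deriv_tC (hγ : IsAPC γ) (h0 : ∀ s, curv γ s ≠ 0) (i : Fin 3) (s : ℝ) :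
    deriv (tC γ i) s = curv γ s * nC γ i s := by
  rw [nC_eq hγ, mul_inv_cancel_left₀ (h0 s)]

theorem sum_tC_sq (hγ : IsAPC γ) (s : ℝ) : ∑ i, tC γ i s * tC γ i s = 1 := by
  rw [show ∑ i, tC γ i s * tC γ i s = ‖tang γ s‖ ^ 2 from (norm_sq_eq_sum _).symm, tang, hγ.2 s,
    one_pow]

theorem curv_sq (hγ : IsAPC γ) (s : ℝ) :
    curv γ s ^ 2 = ∑ i, deriv (tC γ i) s * deriv (tC γ i) s := by
  rw [curv, norm_sq_eq_sum]
  exact Finset.sum_congr rfl fun i _ => by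
    rw [deriv_coord ((contDiff_tang hγ).differentiable (by simp))]; rfl

theorem sum_nC_sq (hγ : IsAPC γ) (h0 : ∀ s, curv γ s ≠ 0) (s : ℝ) :
    ∑ i, nC γ i s * nC γ i s = 1 := by
  have h1 := curv_sq hγ s
  simp only [deriv_tC hγ h0] at h1
  have h2 : curv γ s ^ 2 * ∑ i, nC γ i s * nC γ i s = curv γ s ^ 2 * 1 := by
    rw [mul_one, Finset.mul_sum]
    refine Eq.trans ?_ h1.symm
    exact Finset.sum_congr rfl fun i _ => by ring
  exact mul_left_cancel₀ (pow_ne_zero 2 (h0 s)) h2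

theorem hasDerivAt_tC (hγ : IsAPC γ) (h0 : ∀ s, curv γ s ≠ 0) (i : Fin 3) (s : ℝ) :
    HasDerivAt (tC γ i) (curv γ s * nC γ i s) s := by
  rw [← deriv_tC hγ h0]
  exact ((contDiff_tC hγ i).differentiable (by simp) s).hasDerivAt

theorem sum_deriv_mul_eq_zero {f g : Fin 3 → ℝ → ℝ} {f' g' : Fin 3 → ℝ} {s c : ℝ}
    (hf : ∀ i, HasDerivAt (f i) (f' i) s) (hg : ∀ i, HasDerivAt (g i) (g' i) s)
    (h : ∀ s, ∑ i, f i s * g i s = c) : ∑ i, (f' i * g i s + f i s * g' i) = 0 := by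
  have h1 : HasDerivAt (fun s => ∑ i, f i s * g i s) (∑ i, (f' i * g i s + f i s * g' i)) s :=
    HasDerivAt.fun_sum fun i _ => (hf i).fun_mul (hg i)
  simp only [h] at h1
  exact h1.unique (hasDerivAt_const _ _)

theorem sum_tC_nC (hγ : IsAPC γ) (h0 : ∀ s, curv γ s ≠ 0) (s : ℝ) :
    ∑ i, tC γ i s * nC γ i s = 0 := by
  have h1 := sum_deriv_mul_eq_zero (fun i => hasDerivAt_tC hγ h0 i s)
    (fun i => hasDerivAt_tC hγ h0 i s) (sum_tC_sq hγ)
  have h2 : (2 * curv γ s) * ∑ i, tC γ i s * nC γ i s = (2 * curv γ s) * 0 := by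
    rw [mul_zero, Finset.mul_sum, ← h1]
    exact Finset.sum_congr rfl fun i _ => by ring
  exact mul_left_cancel₀ (mul_ne_zero two_ne_zero (h0 s)) h2

theorem frenet_frame (hγ : IsAPC γ) (h0 : ∀ s, curv γ s ≠ 0) (s : ℝ) :
    (∑ i, bC γ i s * bC γ i s = 1) ∧ (∑ i, tC γ i s * bC γ i s = 0) ∧
    (∑ i, nC γ i s * bC γ i s = 0) ∧
    ∀ i j, tC γ i s * tC γ j s + nC γ i s * nC γ j s + bC γ i s * bC γ j s =
      if i = j then 1 else 0 :=
  frame_complete (t := fun i => tC γ i s) (n := fun i => nC γ i s) (b := fun i => bC γ i s)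
    (sum_tC_sq hγ s) (sum_nC_sq hγ h0 s) (sum_tC_nC hγ h0 s) (bC_zero γ s) (bC_one γ s) (bC_two γ s)

theorem expand_frame (hγ : IsAPC γ) (h0 : ∀ s, curv γ s ≠ 0) (s : ℝ) (v : Fin 3 → ℝ) (i : Fin 3) :
    v i = (∑ j, v j * tC γ j s) * tC γ i s + (∑ j, v j * nC γ j s) * nC γ i s +
      (∑ j, v j * bC γ j s) * bC γ i s := by
  have h := (frenet_frame hγ h0 s).2.2.2
  have : v i = ∑ j, v j * (tC γ i s * tC γ j s + nC γ i s * nC γ j s + bC γ i s * bC γ j s) := by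
    simp [h]
  rw [this]
  simp only [Fin.sum_univ_three]
  ring

/-- Expansion of `N'` in the frame: differentiating `⟨N, N⟩ = 1` kills the `N`-component,
differentiating `⟨T, N⟩ = 0` gives the `T`-component `-κ`, and the `B`-component is the torsion by
definition. -/
theorem hasDerivAt_nC (hγ : IsAPC γ) (h0 : ∀ s, curv γ s ≠ 0) (i : Fin 3) (s : ℝ) :
    HasDerivAt (nC γ i) (-(curv γ s * tC γ i s) + tors γ s * bC γ i s) s := by
  have hd : ∀ i, HasDerivAt (nC γ i) (deriv (nC γ i) s) s := fun i =>
    ((contDiff_nC hγ h0 i).differentiable (by simp) s).hasDerivAt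
  convert hd i using 1
  rw [expand_frame hγ h0 s (fun j => deriv (nC γ j) s) i, ← tors_eq hγ h0]
  have h1 := sum_deriv_mul_eq_zero hd hd (sum_nC_sq hγ h0)
  have h2 := sum_deriv_mul_eq_zero (fun i => hasDerivAt_tC hγ h0 i s) hd (sum_tC_nC hγ h0)
  have h3 := sum_nC_sq hγ h0 s
  simp only [Fin.sum_univ_three] at *
  linear_combination (-nC γ i s / 2) * h1 - tC γ i s * h2 + curv γ s * tC γ i s * h3

/-- Product rule for `B = T × N`: the curvature terms `κ N × N` and `-κ T × T` vanish, and `τ T × B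
= -τ N` remains. -/
theorem hasDerivAt_bC (hγ : IsAPC γ) (h0 : ∀ s, curv γ s ≠ 0) (i : Fin 3) (s : ℝ) :
    HasDerivAt (bC γ i) (-(tors γ s * nC γ i s)) s := by
  have ht := fun i => hasDerivAt_tC hγ h0 i s
  have hn := fun i => hasDerivAt_nC hγ h0 i s
  have hd : HasDerivAt (bC γ i) (deriv (bC γ i) s) s :=
    ((contDiff_bC hγ h0 i).differentiable (by simp) s).hasDerivAt
  have h1 := sum_tC_sq hγ s
  have h2 := sum_tC_nC hγ h0 s
  simp only [Fin.sum_univ_three] at *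
  fin_cases i
  · refine (((ht 1).fun_mul (hn 2)).fun_sub ((ht 2).fun_mul (hn 1))).congr_of_eventuallyEq
      (Eventually.of_forall (bC_zero γ)) |>.congr_deriv ?_
    simp only [Fin.isValue, Fin.zero_eta, bC_one, bC_two]
    linear_combination (-tors γ s * nC γ 0 s) * h1 + tors γ s * tC γ 0 s * h2
  · refine (((ht 2).fun_mul (hn 0)).fun_sub ((ht 0).fun_mul (hn 2))).congr_of_eventuallyEq
      (Eventually.of_forall (bC_one γ)) |>.congr_deriv ?_
    simp only [Fin.isValue, Fin.mk_one, bC_zero, bC_two]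
    linear_combination (-tors γ s * nC γ 1 s) * h1 + tors γ s * tC γ 1 s * h2
  · refine (((ht 0).fun_mul (hn 1)).fun_sub ((ht 1).fun_mul (hn 0))).congr_of_eventuallyEq
      (Eventually.of_forall (bC_two γ)) |>.congr_deriv ?_
    simp only [Fin.isValue, Fin.reduceFinMk, bC_zero, bC_one]
    linear_combination (-tors γ s * nC γ 2 s) * h1 + tors γ s * tC γ 2 s * h2

theorem contDiff_tors (hγ : IsAPC γ) (h0 : ∀ s, curv γ s ≠ 0) : ContDiff ℝ ∞ (tors γ) := by
  have : tors γ = fun s => ∑ i, deriv (nC γ i) s * bC γ i s := funext fun s => tors_eq hγ h0 s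
  rw [this]
  exact ContDiff.sum fun i _ =>
    (contDiff_infty_iff_deriv.1 (contDiff_nC hγ h0 i)).2.mul (contDiff_bC hγ h0 i)

end Frenet
end Filament

namespace Filament

/-! ### Global bounds from the asymptotic conditions -/

section PolynomialBounds

theorem exists_bound_polynomial (P : Polynomial ℝ) :
    ∃ (C : ℝ) (m : ℕ), 0 ≤ C ∧ ∀ s, |P.eval s| ≤ C * (1 + s ^ 2) ^ m := by
  induction P using Polynomial.induction_on' with
  | add p q hp hq =>
    obtain ⟨C, m, hC, h⟩ := hp
    obtain ⟨D, n, hD, h'⟩ := hq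
    refine ⟨C + D, m + n, by positivity, fun s => ?_⟩
    have a1 := mul_le_mul_of_nonneg_left (br_pow_le s (Nat.le_add_right m n)) hC
    have a2 := mul_le_mul_of_nonneg_left (br_pow_le s (Nat.le_add_left n m)) hD
    rw [Polynomial.eval_add]
    have := abs_add_le (p.eval s) (q.eval s)
    linarith [h s, h' s]
  | monomial n a =>
    refine ⟨|a|, n, abs_nonneg a, fun s => ?_⟩
    rw [Polynomial.eval_monomial, abs_mul, abs_pow]
    gcongr
    rw [abs_le]
    constructor <;> nlinarith [sq_nonneg (s - 1), sq_nonneg (s + 1)]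

theorem eval_br_pow (C s : ℝ) (m : ℕ) :
    (Polynomial.C C * (1 + Polynomial.X ^ 2) ^ m : Polynomial ℝ).eval s = C * (1 + s ^ 2) ^ m := by
  simp

theorem PolyLike.exists_bound {f : ℝ → ℝ} (h : PolyLike f) (hf : Continuous f) :
    ∃ (C : ℝ) (m : ℕ), 0 ≤ C ∧ ∀ s, |f s| ≤ C * (1 + s ^ 2) ^ m := by
  obtain ⟨P, hP, hlim⟩ := h
  obtain ⟨C, m, hC, hPb⟩ := exists_bound_polynomial P
  rw [← cocompact_eq_atBot_atTop] at hlim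
  have h1 : ∀ᶠ s in cocompact ℝ, |f s / P.eval s| ≤ 1 := by
    filter_upwards [Metric.tendsto_nhds.1 hlim 1 one_pos] with s hs
    rw [Real.dist_eq, sub_zero] at hs
    exact hs.le
  -- At a root of `P` the quotient is `0` by convention and carries no information on `f`. The roots
  -- are finitely many and are absorbed into the compact set.
  have h2 : ∀ᶠ s in cocompact ℝ, P.eval s ≠ 0 := by
    have : {s | P.eval s ≠ 0}ᶜ.Finite := by
      refine (P.roots.toFinset.finite_toSet).subset fun s hs => ?_
      simpa [hP] using hs
    exact mem_cocompact.2 ⟨_, this.isCompact, by simp⟩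
  obtain ⟨K, hK, hKs⟩ := mem_cocompact.1 (h1.and h2)
  obtain ⟨D, hD⟩ := hK.exists_bound_of_continuousOn hf.continuousOn
  refine ⟨C + |D|, m, by positivity, fun s => ?_⟩
  have hb := one_le_br_pow s m
  by_cases hs : s ∈ K
  · have := (hD s hs).trans (le_abs_self D)
    rw [Real.norm_eq_abs] at this
    nlinarith [abs_nonneg D]
  · obtain ⟨h3, h4⟩ := hKs hs
    rw [abs_div, div_le_one (abs_pos.2 h4)] at h3
    nlinarith [abs_nonneg D, hPb s]

theorem RapidDecr.exists_bound {f : ℝ → ℝ} (h : RapidDecr f) (hf : Continuous f) (m : ℕ) :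
    ∃ C : ℝ, 0 < C ∧ ∀ s, (1 + s ^ 2) ^ m * |f s| ≤ C := by
  have h1 := h (Polynomial.C 1 * (1 + Polynomial.X ^ 2) ^ m)
  simp only [eval_br_pow] at h1
  rw [← cocompact_eq_atBot_atTop] at h1
  obtain ⟨K, hK, hKs⟩ := mem_cocompact.1 (Metric.tendsto_nhds.1 h1 1 one_pos)
  have hc : Continuous fun s => f s * (1 * (1 + s ^ 2) ^ m) := by fun_prop
  obtain ⟨D, hD⟩ := hK.exists_bound_of_continuousOn hc.continuousOn
  refine ⟨1 + |D|, by positivity, fun s => ?_⟩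
  have h2 : (1 + s ^ 2) ^ m * |f s| = |f s * (1 * (1 + s ^ 2) ^ m)| := by
    rw [one_mul, abs_mul, abs_of_pos (br_pow_pos s m), mul_comm]
  rw [h2]
  by_cases hs : s ∈ K
  · have := (hD s hs).trans (le_abs_self D)
    rw [Real.norm_eq_abs] at this
    linarith
  · have : dist (f s * (1 * (1 + s ^ 2) ^ m)) 0 < 1 := hKs hs
    rw [Real.dist_eq, sub_zero] at this
    linarith [abs_nonneg D]

/-- A polynomial times a rapidly decreasing function is dominated by an integrable function. -/
theorem RapidDecr.exists_integrable_bound {f : ℝ → ℝ} (h : RapidDecr f) (hf : Continuous f)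
    (m : ℕ) : ∃ D : ℝ, 0 ≤ D ∧ ∀ s, (1 + s ^ 2) ^ m * |f s| ≤ D * (1 + s ^ 2)⁻¹ := by
  obtain ⟨D, hD, hb⟩ := h.exists_bound hf (m + 1)
  refine ⟨D, hD.le, fun s => ?_⟩
  rw [← div_eq_mul_inv, le_div_iff₀ (by positivity)]
  calc _ = (1 + s ^ 2) ^ (m + 1) * |f s| := by ring
    _ ≤ D := hb s

end PolynomialBounds

/-! ### Bounds along a single balanced curve -/

section Fields

variable {γ₀ : ℝ → E3}

/-- The function `u` is smooth, and its derivatives are bounded by polynomials times `w`. -/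
def Reg (w u : ℝ → ℝ) : Prop := SmoothTame (⊤ : Filter Unit) (fun _ => w) (fun _ => u)

namespace Reg

variable {w w' u v : ℝ → ℝ}

theorem contDiff (h : Reg w u) : ContDiff ℝ ∞ u := by
  have := h.1
  simpa using this

theorem continuous (h : Reg w u) : Continuous u := h.contDiff.continuous

theorem exists_bound (h : Reg w u) :
    ∃ (C : ℝ) (m : ℕ), 0 ≤ C ∧ ∀ s, |u s| ≤ C * (1 + s ^ 2) ^ m * |w s| := by
  obtain ⟨C, m, hC, H⟩ := SmoothTame.tame h
  exact ⟨C, m, hC, by simpa using H⟩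

theorem family {ι : Type*} (h : Reg w u) (l : Filter ι) :
    SmoothTame l (fun _ => w) (fun _ => u) :=
  SmoothTame.comp_tendsto (j := fun _ => ()) h tendsto_top

theorem mul (hu : Reg w u) (hv : Reg w' v) : Reg (fun s => w s * w' s) (fun s => u s * v s) :=
  SmoothTame.mul hu hv

theorem add (hu : Reg w u) (hv : Reg w v) : Reg w (fun s => u s + v s) := SmoothTame.add hu hv

theorem const_mul (c : ℝ) (hu : Reg w u) : Reg w (fun s => c * u s) := SmoothTame.const_mul c hu

theorem deriv (hu : Reg w u) : Reg w (deriv u) := SmoothTame.deriv hu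

theorem mono (hu : Reg w u) (h : ∃ (C : ℝ) (m : ℕ), 0 ≤ C ∧
    ∀ s, |w s| ≤ C * (1 + s ^ 2) ^ m * |w' s|) : Reg w' u := by
  obtain ⟨C, m, hC, H⟩ := h
  exact SmoothTame.mono hu ⟨C, m, hC, Eventually.of_forall fun _ => H⟩

theorem of_tame (h1 : ContDiff ℝ ∞ u) (h2 : ∀ k, ∃ (C : ℝ) (m : ℕ), 0 ≤ C ∧
    ∀ s, |iteratedDeriv k u s| ≤ C * (1 + s ^ 2) ^ m * |w s|) : Reg w u :=
  ⟨Eventually.of_forall fun _ => h1, fun k => by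
    obtain ⟨C, m, hC, H⟩ := h2 k
    exact ⟨C, m, hC, Eventually.of_forall fun _ => H⟩⟩

theorem weight_congr (h : Reg w u) (hw : ∀ s, w s = w' s) : Reg w' u :=
  SmoothTame.weight_congr h fun _ => hw

theorem const (c : ℝ) : Reg (fun _ => 1) (fun _ => c) := SmoothTame.const c

end Reg

variable (γ : BAL γ₀)

theorem kap_pos (s : ℝ) : 0 < kap γ s := curv_pos γ.2.curv_ne_zero s

theorem kap_ne (s : ℝ) : kap γ s ≠ 0 := γ.2.curv_ne_zero s

theorem contDiff_kap : ContDiff ℝ ∞ (kap γ) := contDiff_curv γ.2.apc γ.2.curv_ne_zero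

theorem kap_zpow_pos (n : ℤ) (s : ℝ) : 0 < kap γ s ^ n := zpow_pos (kap_pos γ s) n

theorem reg_kap : Reg (kap γ) (kap γ) := by
  refine Reg.of_tame (contDiff_kap γ) fun k => ?_
  have hc : Continuous fun s => (kap γ s)⁻¹ * iteratedDeriv k (kap γ) s :=
    ((contDiff_kap γ).continuous.inv₀ (kap_ne γ)).mul
      ((contDiff_kap γ).continuous_iteratedDeriv k (by exact_mod_cast le_top))
  obtain ⟨C, m, hC, H⟩ := (γ.2.curv_poly k).exists_bound hc
  refine ⟨C, m, hC, fun s => ?_⟩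
  have h1 := H s
  have h2 := abs_pos.2 (kap_ne γ s)
  change |(kap γ s)⁻¹ * _| ≤ _ at h1
  rwa [abs_mul, abs_inv, inv_mul_le_iff₀ h2, mul_comm (|kap γ s|)] at h1

theorem reg_tors : Reg (fun _ => 1) (tors γ.1) := by
  refine Reg.of_tame (contDiff_tors γ.2.apc γ.2.curv_ne_zero) fun k => ?_
  obtain ⟨C, m, hC, H⟩ := (γ.2.tors_poly k).exists_bound
    ((contDiff_tors γ.2.apc γ.2.curv_ne_zero).continuous_iteratedDeriv k
      (by exact_mod_cast le_top))
  exact ⟨C, m, hC, fun s => by simpa using H s⟩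

theorem kap_bounded : ∃ C : ℝ, 0 < C ∧ ∀ s, kap γ s ≤ C := by
  obtain ⟨C, hC, H⟩ := γ.2.curv_rapid.exists_bound (contDiff_kap γ).continuous 0
  exact ⟨C, hC, fun s => (le_abs_self _).trans (by
    have := H s
    rwa [pow_zero, one_mul] at this)⟩

/-- The curvature is bounded, so a factor `κ` may be traded for a constant. On the level of weights
this is the inclusion `𝒜ₙ ⊂ 𝒜ₙ₋₁`. -/
theorem kap_zpow_le (n : ℤ) : ∃ C : ℝ, 0 < C ∧ ∀ s, kap γ s ^ n ≤ C * kap γ s ^ (n - 1) := by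
  obtain ⟨C, hC, H⟩ := kap_bounded γ
  refine ⟨C, hC, fun s => ?_⟩
  rw [zpow_sub_one₀ (kap_ne γ s)]
  have := kap_zpow_pos γ n s
  have h2 := kap_pos γ s
  calc kap γ s ^ n = kap γ s * (kap γ s ^ n * (kap γ s)⁻¹) := by field_simp
    _ ≤ _ := by gcongr; exact H s

theorem reg_lower {n : ℤ} {u : ℝ → ℝ} (h : Reg (fun s => kap γ s ^ n) u) :
    Reg (fun s => kap γ s ^ (n - 1)) u := by
  obtain ⟨C, hC, H⟩ := kap_zpow_le γ n
  refine h.mono ⟨C, 0, hC.le, fun s => ?_⟩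
  rw [abs_of_pos (kap_zpow_pos γ n s), abs_of_pos (kap_zpow_pos γ (n - 1) s), pow_zero, mul_one]
  exact H s

theorem reg_of_kap {u : ℝ → ℝ} (h : Reg (kap γ) u) : Reg (fun _ => 1) u := by
  have := reg_lower γ (n := 1) (by simpa using h)
  simpa using this

/-- A function bounded by a polynomial times a positive power of the curvature is integrable. -/
theorem integrable_of_bound {n : ℕ} {C : ℝ} {m : ℕ} {u : ℝ → ℝ} (hc : Continuous u) (hC : 0 ≤ C)
    (hu : ∀ s, |u s| ≤ C * (1 + s ^ 2) ^ m * |kap γ s ^ (n + 1)|) : Integrable u := by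
  obtain ⟨B, hB, hBk⟩ := kap_bounded γ
  obtain ⟨D, hD, h⟩ := γ.2.curv_rapid.exists_integrable_bound (contDiff_kap γ).continuous m
  refine ((integrable_inv_one_add_sq.const_mul (C * (B ^ n * D)))).mono'
    hc.aestronglyMeasurable (ae_of_all _ fun s => ?_)
  rw [Real.norm_eq_abs]
  refine (hu s).trans ?_
  have h1 : |kap γ s ^ (n + 1)| ≤ B ^ n * |kap γ s| := by
    rw [pow_succ, abs_mul, abs_pow]
    gcongr
    rw [abs_of_pos (kap_pos γ s)]
    exact hBk s
  calc _ ≤ C * (1 + s ^ 2) ^ m * (B ^ n * |kap γ s|) := by gcongr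
    _ = C * (B ^ n * ((1 + s ^ 2) ^ m * |kap γ s|)) := by ring
    _ ≤ C * (B ^ n * (D * (1 + s ^ 2)⁻¹)) :=
      mul_le_mul_of_nonneg_left (mul_le_mul_of_nonneg_left (h s) (by positivity)) hC
    _ = _ := by ring

theorem integrable_br_mul_kap (m n : ℕ) :
    Integrable fun s => (1 + s ^ 2) ^ m * kap γ s ^ (n + 1) := by
  refine integrable_of_bound γ (n := n) (C := 1) (m := m) ?_ zero_le_one fun s => ?_
  · have := (contDiff_kap γ).continuous
    fun_prop
  · rw [abs_mul, abs_of_pos (br_pow_pos s m), one_mul]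

theorem integrable_of_reg {n : ℕ} {u : ℝ → ℝ} (h : Reg (fun s => kap γ s ^ (n + 1)) u) :
    Integrable u := by
  obtain ⟨C, m, hC, H⟩ := h.exists_bound
  exact integrable_of_bound γ h.continuous hC H

theorem tendsto_zero_of_reg {u : ℝ → ℝ} (h : Reg (kap γ) u) :
    Tendsto u (atBot ⊔ atTop) (𝓝 0) := by
  obtain ⟨C, m, hC, H⟩ := h.exists_bound
  have h1 := γ.2.curv_rapid (Polynomial.C C * (1 + Polynomial.X ^ 2) ^ m)
  simp only [eval_br_pow] at h1
  refine squeeze_zero_norm (fun s => ?_) h1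
  rw [Real.norm_eq_abs]
  refine (H s).trans (le_of_eq ?_)
  rw [abs_of_pos (kap_pos γ s)]
  exact mul_comm _ _

/-- Integration destroys decay: only the bound by the `L¹` norm of `u` survives in order zero,
whereas the higher derivatives are those of `u`. -/
theorem reg_anti {u : ℝ → ℝ} (h : Reg (fun s => kap γ s ^ 2) u) :
    Reg (fun _ => 1) (anti u) := by
  have hi := integrable_of_reg γ (n := 1) h
  have hd : deriv (anti u) = u := funext fun s => (hasDerivAt_anti h.continuous hi s).deriv
  refine SmoothTame.of_deriv (Eventually.of_forall fun _ => ?_)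
    ⟨∫ t, |u t|, 0, integral_nonneg fun t => abs_nonneg _, Eventually.of_forall fun _ s => ?_⟩ ?_
  · rw [contDiff_infty_iff_deriv, hd]
    exact ⟨fun s => (hasDerivAt_anti h.continuous hi s).differentiableAt, h.contDiff⟩
  · simpa using abs_anti_le hi s
  · rw [hd]
    have := reg_lower γ (n := 1) (reg_lower γ (n := 2) (by exact_mod_cast h))
    exact (by simpa using this : Reg (fun _ => 1) u)

/-- The rows and columns of an orthogonal matrix are unit vectors, so the coordinates are at most
`1`. The Frenet equations express each derivative by `κ`, `τ` and the frame; as they are coupled,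
the induction on the order treats the three vectors together. -/
theorem reg_frame (i : Fin 3) :
    Reg (fun _ => 1) (tC γ.1 i) ∧ Reg (fun _ => 1) (nC γ.1 i) ∧ Reg (fun _ => 1) (bC γ.1 i) := by
  have hγ := γ.2.apc
  have h0 := γ.2.curv_ne_zero
  have b1 : ∀ {x y z : ℝ}, x * x + y * y + z * z = 1 → |x| ≤ 1 ∧ |y| ≤ 1 ∧ |z| ≤ 1 := by
    intro x y z h
    refine ⟨?_, ?_, ?_⟩ <;> rw [abs_le_one_iff_mul_self_le_one] <;>
      nlinarith [mul_self_nonneg x, mul_self_nonneg y, mul_self_nonneg z]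
  have bd : ∀ s, |tC γ.1 i s| ≤ 1 ∧ |nC γ.1 i s| ≤ 1 ∧ |bC γ.1 i s| ≤ 1 := fun s =>
    b1 (by simpa using (frenet_frame hγ h0 s).2.2.2 i i)
  have tm : ∀ {u : ℝ → ℝ}, (∀ s, |u s| ≤ 1) → Tame (⊤ : Filter Unit) (fun _ _ => 1) fun _ => u :=
    fun h => ⟨1, 0, zero_le_one, Eventually.of_forall fun _ s => by simpa using h s⟩
  have sm : ∀ {u : ℝ → ℝ}, ContDiff ℝ ∞ u → ∀ᶠ _ in (⊤ : Filter Unit), ContDiff ℝ ∞ u :=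
    fun h => Eventually.of_forall fun _ => h
  have hk : SmoothTame (⊤ : Filter Unit) (fun _ _ => 1) fun _ => kap γ := reg_of_kap γ (reg_kap γ)
  have ht : SmoothTame (⊤ : Filter Unit) (fun _ _ => 1) fun _ => tors γ.1 := reg_tors γ
  have main : ∀ K, TameTo K (⊤ : Filter Unit) (fun _ _ => 1) (fun _ => tC γ.1 i) ∧
      TameTo K (⊤ : Filter Unit) (fun _ _ => 1) (fun _ => nC γ.1 i) ∧
      TameTo K (⊤ : Filter Unit) (fun _ _ => 1) (fun _ => bC γ.1 i) := by
    intro K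
    induction K with
    | zero =>
      exact ⟨tameTo_zero.2 ⟨sm (contDiff_tC hγ i), tm fun s => (bd s).1⟩,
        tameTo_zero.2 ⟨sm (contDiff_nC hγ h0 i), tm fun s => (bd s).2.1⟩,
        tameTo_zero.2 ⟨sm (contDiff_bC hγ h0 i), tm fun s => (bd s).2.2⟩⟩
    | succ K ih =>
      obtain ⟨i1, i2, i3⟩ := ih
      have one : Tame (⊤ : Filter Unit) (fun _ _ => (1 : ℝ)) (fun _ _ => 1 * 1) := by
        simpa using Tame.const (1 : ℝ)
      have k1 := ((hk.toTameTo K).mul i2).mono one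
      have k2 := ((((hk.const_mul (-1)).toTameTo K).mul i1).mono one).add
        (((ht.toTameTo K).mul i3).mono one)
      have k3 := (((ht.const_mul (-1)).toTameTo K).mul i2).mono one
      refine ⟨tameTo_succ.2 ⟨sm (contDiff_tC hγ i), tm fun s => (bd s).1, k1.congr ?_⟩,
        tameTo_succ.2 ⟨sm (contDiff_nC hγ h0 i), tm fun s => (bd s).2.1, k2.congr ?_⟩,
        tameTo_succ.2 ⟨sm (contDiff_bC hγ h0 i), tm fun s => (bd s).2.2, k3.congr ?_⟩⟩
      · exact Eventually.of_forall fun _ => funext fun s => (hasDerivAt_tC hγ h0 i s).deriv.symm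
      · refine Eventually.of_forall fun _ => funext fun s => ?_
        rw [(hasDerivAt_nC hγ h0 i s).deriv]
        simp only [kap]
        ring
      · refine Eventually.of_forall fun _ => funext fun s => ?_
        rw [(hasDerivAt_bC hγ h0 i s).deriv]
        ring
  exact ⟨smoothTame_iff.2 fun K => (main K).1, smoothTame_iff.2 fun K => (main K).2.1,
    smoothTame_iff.2 fun K => (main K).2.2⟩

theorem reg_deriv_tC (i : Fin 3) : Reg (kap γ) (deriv (tC γ.1 i)) := by
  have h := (reg_kap γ).mul (reg_frame γ i).2.1
  have e : (fun s => kap γ s * nC γ.1 i s) = deriv (tC γ.1 i) :=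
    funext fun s => (deriv_tC γ.2.apc γ.2.curv_ne_zero i s).symm
  rw [e] at h
  simpa using h

end Fields
end Filament

namespace Filament

variable {γ₀ : ℝ → E3}

/-! ### Bounds along variations -/

section Bounds

/-- The factor `c i` comes out of the integral of the dominating function. With `c ε = ε`, smallness
in the parameter therefore survives an integration although decay in `s` does not. -/
theorem smoothTame_anti {ι : Type*} {l : Filter ι} (γ : BAL γ₀) {c : ι → ℝ} {d : ι → ℝ → ℝ}
    {n : ℕ} (h : SmoothTame l (fun i s => c i * kap γ s ^ (n + 1)) d) :
    SmoothTame l (fun i _ => c i) (fun i => anti (d i)) := by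
  obtain ⟨C, m, hC, H⟩ := h.tame
  have hbd : ∀ᶠ i in l, ∀ s, |d i s| ≤ |c i| * (C * ((1 + s ^ 2) ^ m * kap γ s ^ (n + 1))) := by
    filter_upwards [H] with i hi s
    refine (hi s).trans (le_of_eq ?_)
    rw [abs_mul, abs_of_pos (pow_pos (kap_pos γ s) _)]
    ring
  have hI := (integrable_br_mul_kap γ m n).const_mul C
  have hint : ∀ᶠ i in l, Integrable (d i) := by
    filter_upwards [hbd, h.1] with i hi hs
    exact (hI.const_mul |c i|).mono' hs.continuous.aestronglyMeasurable
      (ae_of_all _ fun s => by simpa using hi s)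
  have hder : ∀ᶠ i in l, deriv (anti (d i)) = d i := by
    filter_upwards [hint, h.1] with i hi hs
    exact funext fun s => (hasDerivAt_anti hs.continuous hi s).deriv
  refine SmoothTame.of_deriv ?_ ?_ ?_
  · filter_upwards [hint, h.1, hder] with i hi hs hd
    rw [contDiff_infty_iff_deriv, hd]
    exact ⟨fun s => (hasDerivAt_anti hs.continuous hi s).differentiableAt, hs⟩
  · refine ⟨∫ s, C * ((1 + s ^ 2) ^ m * kap γ s ^ (n + 1)), 0, integral_nonneg fun s => ?_, ?_⟩
    · have := kap_pos γ s
      positivity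
    · filter_upwards [hint, hbd] with i hi hb s
      refine (abs_anti_le hi s).trans ?_
      rw [pow_zero, mul_one, mul_comm, ← integral_const_mul]
      exact integral_mono hi.abs (hI.const_mul _) fun s => hb s
  · refine (h.congr (hder.mono fun i hi => hi.symm)).mono ?_
    obtain ⟨B, hB, hBk⟩ := kap_bounded γ
    refine ⟨B ^ (n + 1), 0, by positivity, Eventually.of_forall fun i s => ?_⟩
    rw [abs_mul, abs_of_pos (pow_pos (kap_pos γ s) _), pow_zero, mul_one, mul_comm]
    gcongr
    · exact (kap_pos γ s).le
    · exact hBk s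

theorem smoothTame_integral {ι : Type*} {l : Filter ι} (γ : BAL γ₀) {c : ι → ℝ} {d : ι → ℝ → ℝ}
    {n : ℕ} (h : SmoothTame l (fun i s => c i * kap γ s ^ (n + 1)) d) :
    SmoothTame l (fun i _ => c i) (fun i _ => ∫ t, d i t) := by
  obtain ⟨C, m, hC, H⟩ := h.tame
  have hI := (integrable_br_mul_kap γ m n).const_mul C
  have hz : Tame l (fun i _ => c i) (fun i _ => ∫ t, d i t) := by
    refine ⟨∫ s, C * ((1 + s ^ 2) ^ m * kap γ s ^ (n + 1)), 0, integral_nonneg fun s => ?_, ?_⟩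
    · have := kap_pos γ s
      positivity
    · filter_upwards [H, h.1] with i hi hs s
      rw [pow_zero, mul_one, mul_comm, ← integral_const_mul]
      refine norm_integral_le_of_norm_le (f := d i) (hI.const_mul |c i|) (ae_of_all _ fun t => ?_)
      refine (hi t).trans (le_of_eq ?_)
      rw [abs_mul, abs_of_pos (pow_pos (kap_pos γ t) _)]
      ring
  refine SmoothTame.of_deriv (Eventually.of_forall fun i => contDiff_const) hz ?_
  simp only [deriv_const']
  exact SmoothTame.zero

/-- Bounds of order `n` for a scalar field: along a curve, and along variations of it. -/
structure Good (n : ℤ) (f : ScalarField γ₀) : Prop where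
  reg : ∀ γ : BAL γ₀, Reg (fun s => kap γ s ^ n) (f γ)
  ctl : ∀ (γ : BAL γ₀) (v : ℝ → E3) (Γ : ℝ → BAL γ₀), IsVariation γ v Γ →
    SmoothTame (𝓝 0) (fun ε s => ε * kap γ s ^ n) (fun ε s => f (Γ ε) s - f γ s)

theorem tame_weight_lower (γ : BAL γ₀) (n : ℤ) {ι : Type*} {l : Filter ι} (c : ι → ℝ) :
    Tame l (fun i s => c i * kap γ s ^ (n - 1)) (fun i s => c i * kap γ s ^ n) := by
  obtain ⟨C, hC, H⟩ := kap_zpow_le γ n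
  refine ⟨C, 0, hC.le, Eventually.of_forall fun i s => ?_⟩
  rw [abs_mul, abs_mul, abs_of_pos (kap_zpow_pos γ n s), abs_of_pos (kap_zpow_pos γ (n - 1) s)]
  calc _ ≤ |c i| * (C * kap γ s ^ (n - 1)) := by gcongr; exact H s
    _ = _ := by ring

theorem tame_weight_small (w : ℝ → ℝ) :
    Tame (𝓝 (0 : ℝ)) (fun _ s => w s) (fun ε s => ε * w s) := by
  refine ⟨1, 0, zero_le_one, ?_⟩
  filter_upwards [Metric.ball_mem_nhds (0 : ℝ) one_pos] with ε hε s
  rw [Metric.mem_ball, dist_zero_right, Real.norm_eq_abs] at hε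
  rw [abs_mul, pow_zero, mul_one]
  gcongr

namespace Good

variable {n i j : ℤ} {f g : ScalarField γ₀}

theorem contDiff (hf : Good n f) (γ : BAL γ₀) : ContDiff ℝ ∞ (f γ) := (hf.reg γ).contDiff

theorem differentiable (hf : Good n f) (γ : BAL γ₀) : Differentiable ℝ (f γ) :=
  (hf.contDiff γ).differentiable (by simp)

theorem integrable (hf : Good 2 f) (γ : BAL γ₀) : Integrable (f γ) :=
  integrable_of_reg γ (n := 1) (by exact_mod_cast hf.reg γ)

/-- The value at `Γ ε` is the value at `γ` plus the change; near `ε = 0` the factor `ε` in the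
weight of the change can be dropped. -/
theorem family (hf : Good n f) {γ : BAL γ₀} {v : ℝ → E3} {Γ : ℝ → BAL γ₀}
    (h : IsVariation γ v Γ) :
    SmoothTame (𝓝 0) (fun _ s => kap γ s ^ n) (fun ε => f (Γ ε)) :=
  (((hf.ctl γ v Γ h).mono (tame_weight_small _)).add ((hf.reg γ).family _)).congr' fun ε s => by
    ring

theorem add (hf : Good n f) (hg : Good n g) : Good n (f + g) where
  reg γ := (hf.reg γ).add (hg.reg γ)
  ctl γ v Γ h := ((hf.ctl γ v Γ h).add (hg.ctl γ v Γ h)).congr' fun ε s => by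
    simp only [Pi.add_apply]; ring

theorem smul (c : ℝ) (hf : Good n f) : Good n (c • f) where
  reg γ := (hf.reg γ).const_mul c
  ctl γ v Γ h := ((hf.ctl γ v Γ h).const_mul c).congr' fun ε s => by
    simp only [Pi.smul_apply, smul_eq_mul]; ring

theorem neg (hf : Good n f) : Good n (-f) := by simpa using hf.smul (-1)

theorem sub (hf : Good n f) (hg : Good n g) : Good n (f - g) := by
  simpa [sub_eq_add_neg] using hf.add hg.neg

theorem zero (n : ℤ) : Good n (0 : ScalarField γ₀) where
  reg γ := SmoothTame.zero
  ctl γ v Γ h := SmoothTame.zero.congr' fun ε s => by simp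

theorem lower (hf : Good n f) : Good (n - 1) f where
  reg γ := reg_lower γ (hf.reg γ)
  ctl γ v Γ h := (hf.ctl γ v Γ h).mono (tame_weight_lower γ n _)

theorem mul (hf : Good i f) (hg : Good j g) : Good (i + j) (f * g) where
  reg γ := SmoothTame.weight_congr (SmoothTame.mul (hf.reg γ) (hg.reg γ)) fun _ s =>
    (zpow_add₀ (kap_ne γ s) i j).symm
  ctl γ v Γ h := by
    -- With hats for values at `Γ ε`, the change of the product is `(f̂ - f) ĝ + f (ĝ - g)`; this is
    -- the first summand.
    have h1 := ((hf.ctl γ v Γ h).mul (hg.family h)).weight_congr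
      (w' := fun ε s => ε * kap γ s ^ (i + j)) fun ε s => by rw [zpow_add₀ (kap_ne γ s)]; ring
    have h2 := (((hf.reg γ).family _).mul (hg.ctl γ v Γ h)).weight_congr
      (w' := fun ε s => ε * kap γ s ^ (i + j)) fun ε s => by rw [zpow_add₀ (kap_ne γ s)]; ring
    exact (h1.add h2).congr' fun ε s => by simp only [Pi.mul_apply]; ring

theorem dS (hf : Good n f) : Good n (dS f) where
  reg γ := (hf.reg γ).deriv
  ctl γ v Γ h := (hf.ctl γ v Γ h).deriv.congr' fun ε s =>
    deriv_fun_sub (hf.differentiable (Γ ε) s) (hf.differentiable γ s)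

theorem antiS (hf : Good 2 f) : Good 0 (antiS f) where
  reg γ := (reg_anti γ (by exact_mod_cast hf.reg γ)).weight_congr fun s => (zpow_zero _).symm
  ctl γ v Γ h := by
    have h1 := smoothTame_anti γ (n := 1) (by exact_mod_cast hf.ctl γ v Γ h)
    refine (h1.congr' fun ε s => ?_).weight_congr fun ε s => by simp
    exact anti_sub (hf.integrable _) (hf.integrable _) s

theorem intS (hf : Good 2 f) : Good 0 (intS f) where
  reg γ := (Reg.const (∫ t, f γ t)).weight_congr fun s => (zpow_zero _).symm
  ctl γ v Γ h := by
    have h1 := smoothTame_integral γ (n := 1) (by exact_mod_cast hf.ctl γ v Γ h)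
    refine (h1.congr' fun ε s => ?_).weight_congr fun ε s => by simp
    exact integral_sub (hf.integrable _) (hf.integrable _)

theorem sum {α : Type*} (t : Finset α) {F : α → ScalarField γ₀} (h : ∀ a ∈ t, Good n (F a)) :
    Good n (∑ a ∈ t, F a) :=
  Finset.sum_induction F (Good n) (fun _ _ => Good.add) (Good.zero n) h

theorem of_param {f : ℝ → ℝ} (hf : Reg (fun _ => 1) f) :
    Good 0 (fun _ s => f s : ScalarField γ₀) where
  reg γ := hf.weight_congr fun s => (zpow_zero _).symm
  ctl γ v Γ h := SmoothTame.zero.congr' fun ε s => by simp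

theorem one : Good 0 (fun _ _ => 1 : ScalarField γ₀) := of_param (Reg.const 1)

theorem param : Good 0 (fun _ s => s : ScalarField γ₀) := by
  refine of_param (SmoothTame.of_deriv (Eventually.of_forall fun _ => contDiff_id)
    ⟨1, 1, zero_le_one, Eventually.of_forall fun _ s => ?_⟩ ?_)
  · rw [abs_one, pow_one, one_mul, mul_one, abs_le]
    constructor <;> nlinarith [sq_nonneg (s - 1), sq_nonneg (s + 1)]
  · simpa using SmoothTame.const (l := (⊤ : Filter Unit)) 1

end Good

end Bounds

/-! ### Bounds for curvature, torsion and frame -/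

section Generators

/-- Coordinates of the unit tangent, as scalar fields. -/
noncomputable def tF (i : Fin 3) : ScalarField γ₀ := fun γ => tC γ.1 i

/-- Coordinates of the principal normal, as scalar fields. -/
noncomputable def nF (i : Fin 3) : ScalarField γ₀ := fun γ => nC γ.1 i

/-- Coordinates of the binormal, as scalar fields. -/
noncomputable def bF (i : Fin 3) : ScalarField γ₀ := fun γ => bC γ.1 i

/-- The inverse of the curvature, as a scalar field. -/
noncomputable def kapInv : ScalarField γ₀ := fun γ s => (kap γ s)⁻¹

/-- The torsion, as a scalar field. -/
noncomputable def tau : ScalarField γ₀ := fun γ => tors γ.1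

/-- The `k`-th derivative of the tangent is the `(k + 1)`-st of the curve, so the control of orders
`n ≥ 1` covers every `k`. The change of `T` carries a full factor `κ`, although `T` itself has
degree `0`; the bounds for `T'` and for the renormalized length depend on this surplus. -/
theorem ctl_tF (i : Fin 3) (γ : BAL γ₀) (v : ℝ → E3) (Γ : ℝ → BAL γ₀) (h : IsVariation γ v Γ) :
    SmoothTame (𝓝 0) (fun ε s => ε * kap γ s) (fun ε s => tF i (Γ ε) s - tF i γ s) := by
  refine ⟨Eventually.of_forall fun ε => (contDiff_tC (Γ ε).2.apc i).sub (contDiff_tC γ.2.apc i),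
    fun k => ?_⟩
  obtain ⟨P, hP⟩ := h.control (k + 1) (by omega)
  obtain ⟨C, m, hC, hPb⟩ := exists_bound_polynomial P
  refine ⟨C, m, hC, ?_⟩
  filter_upwards [hP] with ε hε s
  have e : ∀ δ : BAL γ₀, iteratedDeriv k (tF i δ) s = iteratedDeriv (k + 1) δ.1 s i := fun δ => by
    rw [iteratedDeriv_succ']
    exact (congrFun (iteratedDeriv_coord (contDiff_tang δ.2.apc) k i) s).symm
  have hk : ((k : ℕ) : WithTop ℕ∞) ≤ ∞ := by exact_mod_cast le_top
  have e2 : iteratedDeriv k (fun s => tF i (Γ ε) s - tF i γ s) s =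
      (iteratedDeriv (k + 1) (Γ ε).1 s - iteratedDeriv (k + 1) γ.1 s) i := by
    rw [PiLp.sub_apply, ← e, ← e]
    exact iteratedDeriv_sub ((contDiff_tC (Γ ε).2.apc i).contDiffAt.of_le hk)
      ((contDiff_tC γ.2.apc i).contDiffAt.of_le hk)
  rw [e2]
  refine (abs_coord_le _ i).trans ((hε s).trans ?_)
  rw [abs_mul, abs_of_pos (kap_pos γ s)]
  calc |ε| * P.eval s * curv γ.1 s ≤ |ε| * (C * (1 + s ^ 2) ^ m) * kap γ s := by
        refine mul_le_mul_of_nonneg_right (mul_le_mul_of_nonneg_left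
          ((le_abs_self _).trans (hPb s)) (abs_nonneg ε)) (kap_pos γ s).le
    _ = _ := by ring

theorem good_tF (i : Fin 3) : Good 0 (tF i : ScalarField γ₀) where
  reg γ := (reg_frame γ i).1.weight_congr fun s => (zpow_zero _).symm
  ctl γ v Γ h := (ctl_tF i γ v Γ h).mono
    (by simpa using tame_weight_lower γ 1 (fun ε : ℝ => ε))

theorem good_dS_tF (i : Fin 3) : Good 1 (dS (tF i) : ScalarField γ₀) where
  reg γ := (reg_deriv_tC γ i).weight_congr fun s => (zpow_one _).symm
  ctl γ v Γ h := ((ctl_tF i γ v Γ h).deriv.congr' fun ε s =>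
    deriv_fun_sub ((good_tF i).differentiable (Γ ε) s) ((good_tF i).differentiable γ s)).weight_congr
      fun ε s => by rw [zpow_one]

theorem kap_sq (γ : BAL γ₀) (s : ℝ) :
    kap γ s ^ 2 = ∑ i, dS (tF i) γ s * dS (tF i) γ s := curv_sq γ.2.apc s

/-- The quantity polynomial in `T'` is `κ²`. Its square root keeps the bounds because `curv_control`
bounds it from below, and the change of `κ` is the change of `κ²` divided by the sum of the two
curvatures, which is at least the curvature of `γ`. -/
theorem good_kap : Good 1 (kap : ScalarField γ₀) where
  reg γ := (reg_kap γ).weight_congr fun s => (zpow_one _).symm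
  ctl γ v Γ h := by
    have hsq : Good 2 (∑ i, dS (tF i) * dS (tF i) : ScalarField γ₀) :=
      Good.sum _ fun i _ => by simpa using (good_dS_tF i).mul (good_dS_tF i)
    have hfam : SmoothTame (𝓝 0) (fun _ s => kap γ s ^ 2) (fun ε s => kap (Γ ε) s ^ 2) :=
      (hsq.family h).congr' (fun ε s => by
        rw [kap_sq]; simp [Finset.sum_apply]) |>.weight_congr fun ε s => by norm_cast
    have hctl : SmoothTame (𝓝 0) (fun ε s => ε * kap γ s ^ 2)
        (fun ε s => kap (Γ ε) s ^ 2 - kap γ s ^ 2) :=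
      (hsq.ctl γ v Γ h).congr' (fun ε s => by
        rw [kap_sq, kap_sq]; simp [Finset.sum_apply]) |>.weight_congr fun ε s => by norm_cast
    have hlow : Tame (𝓝 (0 : ℝ)) (fun ε s => kap (Γ ε) s ^ 2) (fun _ s => kap γ s ^ 2) := by
      obtain ⟨P, hP⟩ := h.curv_control
      obtain ⟨C, m, hC, hPb⟩ := exists_bound_polynomial P
      refine ⟨C ^ 2, m + m, by positivity, ?_⟩
      filter_upwards [hP] with ε hε s
      rw [abs_pow, abs_pow, abs_of_pos (kap_pos γ s), abs_of_pos (kap_pos (Γ ε) s)]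
      have h1 : kap γ s ≤ C * (1 + s ^ 2) ^ m * kap (Γ ε) s := (hε s).trans
        (mul_le_mul_of_nonneg_right ((le_abs_self _).trans (hPb s)) (kap_pos (Γ ε) s).le)
      calc kap γ s ^ 2 ≤ (C * (1 + s ^ 2) ^ m * kap (Γ ε) s) ^ 2 :=
            pow_le_pow_left₀ (kap_pos γ s).le h1 2
        _ = _ := by rw [pow_add]; ring
    have hk : SmoothTame (𝓝 0) (fun _ s => kap γ s) (fun ε s => kap (Γ ε) s) :=
      (hfam.sqrt (Eventually.of_forall fun ε s => pow_pos (kap_pos _ s) 2) hlow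
        (Eventually.of_forall fun ε s => kap_ne γ s)).congr' fun ε s =>
          Real.sqrt_sq (kap_pos _ s).le
    have hinv := (hk.add ((reg_kap γ).family (𝓝 (0 : ℝ)))).inv
      (Eventually.of_forall fun ε s => (add_pos (kap_pos _ s) (kap_pos γ s)).ne')
      (Tame.refl.of_le (Eventually.of_forall fun ε s => by
        rw [abs_of_pos (kap_pos γ s), abs_of_pos (add_pos (kap_pos _ s) (kap_pos γ s))]
        exact le_add_of_nonneg_left (kap_pos _ s).le))
      (Eventually.of_forall fun ε s => kap_ne γ s)
    refine (hctl.mul hinv).congr' (fun ε s => ?_) |>.weight_congr fun ε s => ?_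
    · have := (add_pos (kap_pos (Γ ε) s) (kap_pos γ s)).ne'
      field_simp
      ring
    · have := kap_ne γ s
      rw [zpow_one]
      field_simp

/-- The change of the reciprocal is minus the change of `κ` times both reciprocals, of weight `ε κ
κ⁻¹ κ⁻¹`. The reciprocal at `Γ ε` is uniformly bounded by means of `curv_control`. -/
theorem good_kapInv : Good (-1) (kapInv : ScalarField γ₀) where
  reg γ := SmoothTame.weight_congr (SmoothTame.inv (reg_kap γ)
    (Eventually.of_forall fun _ s => kap_ne γ s) Tame.refl
    (Eventually.of_forall fun _ s => kap_ne γ s)) fun _ s => (zpow_neg_one _).symm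
  ctl γ v Γ h := by
    have hk := (good_kap.family h).weight_congr (w' := fun _ s => kap γ s) fun ε s => zpow_one _
    have hlow : Tame (𝓝 (0 : ℝ)) (fun ε s => kap (Γ ε) s) (fun _ s => kap γ s) := by
      obtain ⟨P, hP⟩ := h.curv_control
      obtain ⟨C, m, hC, hPb⟩ := exists_bound_polynomial P
      refine ⟨C, m, hC, ?_⟩
      filter_upwards [hP] with ε hε s
      rw [abs_of_pos (kap_pos γ s), abs_of_pos (kap_pos (Γ ε) s)]
      exact (hε s).trans
        (mul_le_mul_of_nonneg_right ((le_abs_self _).trans (hPb s)) (kap_pos (Γ ε) s).le)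
    have hinv := hk.inv (Eventually.of_forall fun ε s => kap_ne _ s) hlow
      (Eventually.of_forall fun ε s => kap_ne γ s)
    have hinv0 := (SmoothTame.inv (reg_kap γ) (Eventually.of_forall fun _ s => kap_ne γ s) Tame.refl
      (Eventually.of_forall fun _ s => kap_ne γ s)).comp_tendsto
        (tendsto_top : Tendsto (fun _ : ℝ => ()) (𝓝 0) ⊤)
    refine (((good_kap.ctl γ v Γ h).const_mul (-1)).mul (hinv.mul hinv0)).congr'
      (fun ε s => ?_) |>.weight_congr fun ε s => ?_
    · have h1 := kap_ne (Γ ε) s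
      have h2 := kap_ne γ s
      simp only [kapInv]
      field_simp
      ring
    · have h2 := kap_ne γ s
      rw [zpow_one, zpow_neg_one]
      field_simp

theorem nF_eq (i : Fin 3) : (nF i : ScalarField γ₀) = kapInv * dS (tF i) :=
  funext fun γ => funext fun s => nC_eq γ.2.apc i s

theorem good_nF (i : Fin 3) : Good 0 (nF i : ScalarField γ₀) := by
  rw [nF_eq]
  simpa using good_kapInv.mul (good_dS_tF i)

theorem bF_zero : (bF 0 : ScalarField γ₀) = tF 1 * nF 2 - tF 2 * nF 1 :=
  funext fun γ => funext fun s => bC_zero γ.1 s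

theorem bF_one : (bF 1 : ScalarField γ₀) = tF 2 * nF 0 - tF 0 * nF 2 :=
  funext fun γ => funext fun s => bC_one γ.1 s

theorem bF_two : (bF 2 : ScalarField γ₀) = tF 0 * nF 1 - tF 1 * nF 0 :=
  funext fun γ => funext fun s => bC_two γ.1 s

theorem good_bF (i : Fin 3) : Good 0 (bF i : ScalarField γ₀) := by
  have h := fun j k => Good.mul (good_tF (γ₀ := γ₀) j) (good_nF k)
  simp only [add_zero] at h
  fin_cases i
  · exact bF_zero (γ₀ := γ₀) ▸ (h 1 2).sub (h 2 1)
  · exact bF_one (γ₀ := γ₀) ▸ (h 2 0).sub (h 0 2)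
  · exact bF_two (γ₀ := γ₀) ▸ (h 0 1).sub (h 1 0)

theorem tau_eq : (tau : ScalarField γ₀) = ∑ i, dS (nF i) * bF i := by
  funext γ s
  rw [tau, tors_eq γ.2.apc γ.2.curv_ne_zero]
  simp [Finset.sum_apply, dS, nF, bF]

theorem good_tau : Good 0 (tau : ScalarField γ₀) := by
  rw [tau_eq]
  exact Good.sum _ fun i _ => by simpa using (good_nF i).dS.mul (good_bF i)

end Generators
end Filament

namespace Filament

variable {γ₀ : ℝ → E3}

/-! ### Asymptotic ends and the renormalized length -/

section Ends

variable {p e : E3}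

/-- Replaces the reference curve by its asymptotic line. The length then appears as a shift of the
parameter by `-ℓ/2` at one end and `ℓ/2` at the other. -/
theorem isBalanced_iff {γ : ℝ → E3} {l c d : ℝ}
    (hc : Tendsto (fun s => γ₀ s - (p + (s + c) • e)) atTop (𝓝 0))
    (hd : Tendsto (fun s => γ₀ s - (p + (s + d) • e)) atBot (𝓝 0)) :
    IsBalanced γ₀ γ l ↔
      Tendsto (fun s => γ s - (p + (s + (c - l / 2)) • e)) atTop (𝓝 0) ∧
      Tendsto (fun s => γ s - (p + (s + (d + l / 2)) • e)) atBot (𝓝 0) := by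
  constructor
  · rintro ⟨h1, h2⟩
    constructor
    · have h3 := (h1.add hc).comp (tendsto_atTop_add_const_right _ (-(l / 2)) tendsto_id)
      rw [add_zero] at h3
      refine h3.congr fun s => ?_
      simp only [Function.comp_apply, id_eq, neg_add_cancel_right]
      module
    · have h3 := (h2.add hd).comp (tendsto_atBot_add_const_right _ (l / 2) tendsto_id)
      rw [add_zero] at h3
      refine h3.congr fun s => ?_
      simp only [Function.comp_apply, id_eq, add_sub_cancel_right]
      module
  · rintro ⟨h1, h2⟩
    constructor
    · have h3 := (h1.comp (tendsto_atTop_add_const_right _ (l / 2) tendsto_id)).sub hc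
      rw [sub_zero] at h3
      refine h3.congr fun s => ?_
      simp only [Function.comp_apply, id_eq]
      module
    · have h3 := (h2.comp (tendsto_atBot_add_const_right _ (-(l / 2)) tendsto_id)).sub hd
      rw [sub_zero] at h3
      refine h3.congr fun s => ?_
      simp only [Function.comp_apply, id_eq, ← sub_eq_add_neg]
      module

theorem tendsto_sub_ends (hline : AsymptoticToLine p e γ₀) (γ δ : BAL γ₀) :
    Tendsto (fun s => δ.1 s - γ.1 s) atTop (𝓝 (((renLength γ - renLength δ) / 2) • e)) ∧
    Tendsto (fun s => δ.1 s - γ.1 s) atBot (𝓝 (-(((renLength γ - renLength δ) / 2) • e))) := by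
  obtain ⟨⟨c, hc⟩, ⟨d, hd⟩⟩ := hline
  obtain ⟨h1, h2⟩ := (isBalanced_iff hc hd).1 γ.2.balanced.choose_spec
  obtain ⟨h3, h4⟩ := (isBalanced_iff hc hd).1 δ.2.balanced.choose_spec
  change Tendsto (fun s => γ.1 s - (p + (s + (c - renLength γ / 2)) • e)) _ _ at h1
  change Tendsto (fun s => γ.1 s - (p + (s + (d + renLength γ / 2)) • e)) _ _ at h2
  change Tendsto (fun s => δ.1 s - (p + (s + (c - renLength δ / 2)) • e)) _ _ at h3
  change Tendsto (fun s => δ.1 s - (p + (s + (d + renLength δ / 2)) • e)) _ _ at h4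
  constructor
  · have h := (h3.sub h1).add_const (((renLength γ - renLength δ) / 2) • e)
    rw [sub_zero, zero_add] at h
    refine h.congr fun s => ?_
    module
  · have h := (h4.sub h2).add_const (-(((renLength γ - renLength δ) / 2) • e))
    rw [sub_zero, zero_add] at h
    refine h.congr fun s => ?_
    module

theorem tendsto_coord {l : Filter ℝ} {c : ℝ → E3} {v : E3} (h : Tendsto c l (𝓝 v)) (i : Fin 3) :
    Tendsto (fun s => c s i) l (𝓝 (v i)) :=
  ((EuclideanSpace.proj i : E3 →L[ℝ] ℝ).continuous.tendsto v).comp h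

theorem hasDerivAt_curve_coord {γ : ℝ → E3} (hγ : IsAPC γ) (i : Fin 3) (s : ℝ) :
    HasDerivAt (fun s => γ s i) (tC γ i s) s :=
  hasDerivAt_coord.1 (hγ.1.differentiable (by simp) s).hasDerivAt i

theorem sum_sq_eq_one (he : ‖e‖ = 1) : ∑ i, e i * e i = 1 := by
  rw [← norm_sq_eq_sum, he, one_pow]

theorem integral_tC_sub (hline : AsymptoticToLine p e γ₀) {γ δ : BAL γ₀} {i : Fin 3}
    (hi : Integrable fun s => tF i δ s - tF i γ s) :
    ∫ s, (tF i δ s - tF i γ s) = (renLength γ - renLength δ) * e i := by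
  obtain ⟨h1, h2⟩ := tendsto_sub_ends hline γ δ
  refine (integral_of_hasDerivAt_of_tendsto (fun s => (hasDerivAt_curve_coord δ.2.apc i s).fun_sub
    (hasDerivAt_curve_coord γ.2.apc i s)) hi (tendsto_coord h2 i) (tendsto_coord h1 i)).trans ?_
  simp only [PiLp.neg_apply, PiLp.smul_apply, smul_eq_mul]
  ring

/-- Integrating the difference of the tangents gives the difference of the displacements between the
ends, which is `(ℓ(γ) - ℓ(δ)) e`; pairing with the unit vector `e` isolates the lengths. A quantity
defined by limits thus becomes an integral that can be differentiated in a parameter. -/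
theorem renLength_eq (he : ‖e‖ = 1) (hline : AsymptoticToLine p e γ₀) {γ δ : BAL γ₀}
    (hi : ∀ i, Integrable fun s => tF i δ s - tF i γ s) :
    renLength δ - renLength γ = -∑ i, e i * ∫ s, (tF i δ s - tF i γ s) := by
  simp only [integral_tC_sub hline (hi _)]
  have h := sum_sq_eq_one he
  simp only [Fin.sum_univ_three] at *
  linear_combination (-(renLength δ - renLength γ)) * h

theorem eventually_integrable_tF_sub {γ : BAL γ₀} {v : ℝ → E3} {Γ : ℝ → BAL γ₀}
    (h : IsVariation γ v Γ) (i : Fin 3) :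
    ∀ᶠ ε in 𝓝 (0 : ℝ), Integrable fun s => tF i (Γ ε) s - tF i γ s := by
  obtain ⟨C, m, hC, H⟩ := (ctl_tF i γ v Γ h).tame
  filter_upwards [H] with ε hε
  refine integrable_of_bound γ (n := 0) (C := |ε| * C) (m := m) ?_ (by positivity) fun s => ?_
  · exact ((contDiff_tC (Γ ε).2.apc i).sub (contDiff_tC γ.2.apc i)).continuous
  · refine (hε s).trans (le_of_eq ?_)
    rw [abs_mul, zero_add, pow_one]
    ring

theorem good_renLength (he : ‖e‖ = 1) (hline : AsymptoticToLine p e γ₀) :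
    Good 0 (fun γ _ => renLength γ : ScalarField γ₀) where
  reg γ := (Reg.const _).weight_congr fun s => (zpow_zero _).symm
  ctl γ v Γ h := by
    have h1 : ∀ i, SmoothTame (𝓝 (0 : ℝ)) (fun ε _ => ε)
        (fun ε _ => ∫ s, (tF i (Γ ε) s - tF i γ s)) := fun i =>
      smoothTame_integral γ (n := 0) ((ctl_tF i γ v Γ h).weight_congr fun ε s => by simp)
    have h2 := (SmoothTame.sum Finset.univ fun i _ => (h1 i).const_mul (e i)).neg
    refine (h2.congr ?_).weight_congr fun ε s => by simp
    filter_upwards [eventually_all.2 (eventually_integrable_tF_sub h)] with ε hε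
    exact funext fun s => (renLength_eq he hline hε).symm

/-- Over a unit step the curve is displaced by `e` in the limit, and by the mean value theorem the
`i`-th coordinate of this displacement is a value of the tangent at an intermediate point. The
hypotheses on `l` let the argument serve both ends. -/
theorem tendsto_tC_of_ends {γ : BAL γ₀} {l : Filter ℝ} {i : Fin 3} {c : E3} {L : ℝ}
    (h1 : Tendsto (fun s => γ.1 s - (c + s • e)) l (𝓝 0))
    (h2 : Tendsto (tC γ.1 i) l (𝓝 L)) (hl : l.NeBot) (hshift : Tendsto (fun s : ℝ => s + 1) l l)
    (hmid : ∀ ξ : ℝ → ℝ, (∀ s, s < ξ s ∧ ξ s < s + 1) → Tendsto ξ l l) : L = e i := by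
  have h3 := tendsto_coord ((h1.comp hshift).sub h1) i
  have hξ : ∀ s, ∃ x ∈ Set.Ioo s (s + 1), tC γ.1 i x = γ.1 (s + 1) i - γ.1 s i := fun s => by
    obtain ⟨x, hx, h⟩ := exists_hasDerivAt_eq_slope (fun s => γ.1 s i) (tC γ.1 i)
      (lt_add_one s) (fun x _ => (hasDerivAt_curve_coord γ.2.apc i x).continuousAt.continuousWithinAt)
      (fun x _ => hasDerivAt_curve_coord γ.2.apc i x)
    exact ⟨x, hx, by rw [h]; simp⟩
  choose ξ hξ1 hξ2 using hξ
  have h4 := (h2.comp (hmid ξ fun s => hξ1 s)).sub_const (e i)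
  have h5 : (fun s => (tC γ.1 i ∘ ξ) s - e i) =
      fun s => (((fun s => γ.1 s - (c + s • e)) ∘ fun s => s + 1) s - (γ.1 s - (c + s • e))) i := by
    funext s
    simp only [Function.comp_apply, hξ2, PiLp.sub_apply, PiLp.add_apply, PiLp.smul_apply, smul_eq_mul]
    ring
  rw [h5] at h4
  have := tendsto_nhds_unique h4 h3
  simp only [sub_zero, PiLp.zero_apply] at this
  linarith

/-- The limits exist because `T'` is integrable; closeness of the curve to the line then identifies
them. -/
theorem tendsto_tC (hline : AsymptoticToLine p e γ₀) (γ : BAL γ₀) (i : Fin 3) :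
    Tendsto (tC γ.1 i) atTop (𝓝 (e i)) ∧ Tendsto (tC γ.1 i) atBot (𝓝 (e i)) := by
  have hreg := reg_deriv_tC γ i
  have hint := integrable_of_reg γ (n := 0) (by simpa using hreg)
  have hd : ∀ s, HasDerivAt (fun s => tC γ.1 i s - anti (deriv (tC γ.1 i)) s) 0 s := fun s => by
    simpa using ((contDiff_tC γ.2.apc i).differentiable (by simp) s).hasDerivAt.fun_sub
      (hasDerivAt_anti hreg.continuous hint s)
  have hconst : tC γ.1 i = fun s => anti (deriv (tC γ.1 i)) s +
      (tC γ.1 i 0 - anti (deriv (tC γ.1 i)) 0) := by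
    funext s
    have := is_const_of_deriv_eq_zero (fun s => (hd s).differentiableAt) (fun s => (hd s).deriv) s 0
    linarith
  have lT : ∃ L, Tendsto (tC γ.1 i) atTop (𝓝 L) := by
    rw [hconst]; exact ⟨_, (tendsto_anti_atTop hint).add_const _⟩
  have lB : ∃ L, Tendsto (tC γ.1 i) atBot (𝓝 L) := by
    rw [hconst]; exact ⟨_, (tendsto_anti_atBot hint).add_const _⟩
  obtain ⟨⟨c, hc⟩, ⟨d, hd⟩⟩ := hline
  obtain ⟨h1, h2⟩ := (isBalanced_iff hc hd).1 γ.2.balanced.choose_spec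
  obtain ⟨L, hL⟩ := lT
  obtain ⟨M, hM⟩ := lB
  constructor
  · have : L = e i := by
      refine tendsto_tC_of_ends (c := p + (c - γ.2.balanced.choose / 2) • e) (h1.congr fun s => ?_)
        hL atTop_neBot (tendsto_atTop_add_const_right _ _ tendsto_id) fun ξ hξ =>
          tendsto_atTop_mono (fun s => (hξ s).1.le) tendsto_id
      module
    rwa [← this]
  · have : M = e i := by
      refine tendsto_tC_of_ends (c := p + (d + γ.2.balanced.choose / 2) • e) (h2.congr fun s => ?_)
        hM atBot_neBot (tendsto_atBot_add_const_right _ _ tendsto_id) fun ξ hξ =>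
          tendsto_atBot_mono (fun s => (hξ s).2.le)
            (tendsto_atBot_add_const_right _ 1 tendsto_id)
      module
    rwa [← this]

end Ends

/-! ### Rules for variational derivatives -/

section Calculus

variable {n m : ℤ} {f g F G : ScalarField γ₀} {X : TangentField γ₀}

theorem dS_add (hf : Good n f) (hg : Good m g) : dS (f + g) = dS f + dS g :=
  funext fun γ => funext fun s => deriv_add (hf.differentiable γ s) (hg.differentiable γ s)

theorem dS_sub (hf : Good n f) (hg : Good m g) : dS (f - g) = dS f - dS g :=
  funext fun γ => funext fun s => deriv_sub (hf.differentiable γ s) (hg.differentiable γ s)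

theorem dS_smul (c : ℝ) (f : ScalarField γ₀) : dS (c • f) = c • dS f :=
  funext fun γ => funext fun s => deriv_const_mul_field c

theorem dS_mul (hf : Good n f) (hg : Good m g) : dS (f * g) = dS f * g + f * dS g :=
  funext fun γ => funext fun s => deriv_mul (hf.differentiable γ s) (hg.differentiable γ s)

theorem dS_antiS (hf : Good 2 f) : dS (antiS f) = f :=
  funext fun γ => funext fun s =>
    (hasDerivAt_anti (hf.contDiff γ).continuous (hf.integrable γ) s).deriv

theorem antiS_add (hf : Good 2 f) (hg : Good 2 g) : antiS (f + g) = antiS f + antiS g :=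
  funext fun γ => funext fun s => anti_add (hf.integrable γ) (hg.integrable γ) s

theorem antiS_sub (hf : Good 2 f) (hg : Good 2 g) : antiS (f - g) = antiS f - antiS g :=
  funext fun γ => funext fun s => anti_sub (hf.integrable γ) (hg.integrable γ) s

theorem antiS_smul (c : ℝ) (f : ScalarField γ₀) : antiS (c • f) = c • antiS f :=
  funext fun γ => funext fun s => anti_const_mul c s

theorem intS_sub (hf : Good 2 f) (hg : Good 2 g) : intS (f - g) = intS f - intS g :=
  funext fun γ => funext fun s => integral_sub (hf.integrable γ) (hg.integrable γ)

theorem intS_smul (c : ℝ) (f : ScalarField γ₀) : intS (c • f) = c • intS f :=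
  funext fun γ => funext fun s => integral_const_mul c _

namespace HasVar

theorem add (hf : HasVar X f F) (hg : HasVar X g G) : HasVar X (f + g) (F + G) :=
  fun γ Γ h s => (hf γ Γ h s).fun_add (hg γ Γ h s)

theorem sub (hf : HasVar X f F) (hg : HasVar X g G) : HasVar X (f - g) (F - G) :=
  fun γ Γ h s => (hf γ Γ h s).fun_sub (hg γ Γ h s)

theorem smul (c : ℝ) (hf : HasVar X f F) : HasVar X (c • f) (c • F) :=
  fun γ Γ h s => (hf γ Γ h s).fun_const_smul c

theorem mul (hf : HasVar X f F) (hg : HasVar X g G) : HasVar X (f * g) (F * g + f * G) :=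
  fun γ Γ h s => by
    have h1 := (hf γ Γ h s).fun_mul (hg γ Γ h s)
    rw [h.base] at h1
    exact h1

theorem sum {α : Type*} (t : Finset α) {f F : α → ScalarField γ₀}
    (h : ∀ a ∈ t, HasVar X (f a) (F a)) : HasVar X (∑ a ∈ t, f a) (∑ a ∈ t, F a) :=
  fun γ Γ hΓ s => by
    simpa only [Finset.sum_apply] using HasDerivAt.fun_sum fun a ha => h a ha γ Γ hΓ s

theorem of_param (f : ℝ → ℝ) : HasVar X (fun _ s => f s) (0 : ScalarField γ₀) :=
  fun γ Γ h s => hasDerivAt_const _ _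

/-- The control of second derivatives in `s`, uniform on a compact interval around the point, is
what `hasDerivAt_deriv_param` needs to interchange `∂_ε` and `∂ₛ`. -/
theorem dS (hf : Good n f) (hG : Good m G) (h : HasVar X f G) : HasVar X (dS f) (dS G) := by
  intro γ Γ hΓ s
  obtain ⟨C, k, hC, H⟩ := (hf.ctl γ _ Γ hΓ).2 2
  have hcont : Continuous fun t => C * (1 + t ^ 2) ^ k * kap γ t ^ n := by
    have := (contDiff_kap γ).continuous.zpow₀ n fun t => Or.inl (kap_ne γ t)
    fun_prop
  obtain ⟨M, hM⟩ := (isCompact_Icc (a := s - 1) (b := s + 1)).exists_bound_of_continuousOn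
    hcont.continuousOn
  refine hasDerivAt_deriv_param (u := fun ε => f (Γ ε)) (M := M) (hG.differentiable γ s)
    (fun t => h γ Γ hΓ t) (hf.contDiff _) (Eventually.of_forall fun ε => hf.contDiff _) ?_
  filter_upwards [H] with ε hε t ht
  rw [hΓ.base]
  refine (hε t).trans ?_
  rw [abs_mul, mul_left_comm]
  refine mul_le_mul_of_nonneg_left (le_trans (le_of_eq ?_) (hM t ht)) (abs_nonneg ε)
  rw [Real.norm_eq_abs, abs_mul, abs_of_nonneg (mul_nonneg hC (br_pow_pos t k).le)]

theorem setIntegral (hf : Good 2 f) (hG : Good 2 G) (h : HasVar X f G) {γ : BAL γ₀}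
    {Γ : ℝ → BAL γ₀} (hΓ : IsVariation γ (X γ) Γ) (S : Set ℝ) :
    HasDerivAt (fun ε => ∫ t in S, f (Γ ε) t) (∫ t in S, G γ t) 0 := by
  obtain ⟨C, k, hC, H⟩ := (hf.ctl γ _ Γ hΓ).tame
  refine hasDerivAt_integral_param (F := fun ε => f (Γ ε))
    (b := fun s => C * ((1 + s ^ 2) ^ k * kap γ s ^ (1 + 1)))
    (Eventually.of_forall fun ε => (hf.contDiff _).continuous) (hf.integrable _).integrableOn
    (hG.contDiff γ).continuous ((integrable_br_mul_kap γ k 1).const_mul C).integrableOn ?_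
    fun s => h γ Γ hΓ s
  filter_upwards [H] with ε hε s
  rw [hΓ.base]
  refine (hε s).trans (le_of_eq ?_)
  rw [abs_mul, abs_of_pos (kap_zpow_pos γ 2 s)]
  norm_cast
  ring

theorem antiS (hf : Good 2 f) (hG : Good 2 G) (h : HasVar X f G) :
    HasVar X (antiS f) (antiS G) := fun γ Γ hΓ s =>
  ((h.setIntegral hf hG hΓ (Set.Iic s)).fun_sub (h.setIntegral hf hG hΓ (Set.Ioi s))).const_mul _

theorem intS (hf : Good 2 f) (hG : Good 2 G) (h : HasVar X f G) :
    HasVar X (intS f) (intS G) := fun γ Γ hΓ s => by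
  simpa [Filament.intS] using h.setIntegral hf hG hΓ Set.univ

theorem kap_of_sq (h : HasVar X (kap * kap) G) :
    HasVar X kap ((1 / 2 : ℝ) • (kapInv * G)) := fun γ Γ hΓ s => by
  have h1 := (h γ Γ hΓ s).sqrt (by
    rw [hΓ.base]; exact (mul_pos (kap_pos γ s) (kap_pos γ s)).ne')
  simp only [Pi.mul_apply, hΓ.base, Real.sqrt_mul_self (kap_pos _ s).le] at h1
  refine h1.congr_deriv ?_
  have := kap_ne γ s
  change _ = 1 / 2 * ((kap γ s)⁻¹ * G γ s)
  field_simp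

theorem inv_kap (h : HasVar X kap G) : HasVar X kapInv (-(kapInv * kapInv * G)) :=
  fun γ Γ hΓ s => by
    have h1 := (h γ Γ hΓ s).fun_inv (kap_ne _ s)
    rw [hΓ.base] at h1
    refine h1.congr_deriv ?_
    have := kap_ne γ s
    change _ = -((kap γ s)⁻¹ * (kap γ s)⁻¹ * G γ s)
    field_simp

theorem congr (h : HasVar X f F) (hG : F = G) : HasVar X f G := hG ▸ h

/-- `HasVar` speaks of every variation while `var` uses a chosen one. As soon as variations exist
the two agree, so the choice is immaterial. -/
theorem var_eq {V : Type} [NormedAddCommGroup V] [NormedSpace ℝ V] {f F : FieldAlong γ₀ V}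
    (hX : ∀ γ : BAL γ₀, ∃ Γ : ℝ → BAL γ₀, IsVariation γ (X γ) Γ)
    (h : HasVar X f F) : var X f = F := by
  funext γ s
  rw [var, dif_pos (hX γ)]
  exact (h γ _ (hX γ).choose_spec s).deriv

end HasVar

end Calculus

/-! ### Variations of frame, curvature and torsion -/

section Formulas

/-- Coordinates of a tangent field, as scalar fields. -/
def coordF (X : TangentField γ₀) (i : Fin 3) : ScalarField γ₀ := fun γ s => X γ s i

theorem coordF_wp (g h : ScalarField γ₀) (i : Fin 3) :
    coordF (wp g h) i = antiS (kap * g) * tF i + g * nF i + h * bF i := rfl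

theorem hasVar_iff_coordF {X Y Z : TangentField γ₀} :
    HasVar X Y Z ↔ ∀ i, HasVar X (coordF Y i) (coordF Z i) :=
  ⟨fun h i γ Γ hΓ s => hasDerivAt_coord.1 (h γ Γ hΓ s) i,
    fun h γ Γ hΓ s => hasDerivAt_coord.2 fun i => h i γ Γ hΓ s⟩

theorem dS_tF (i : Fin 3) : dS (tF i : ScalarField γ₀) = kap * nF i :=
  funext fun γ => funext fun s => (hasDerivAt_tC γ.2.apc γ.2.curv_ne_zero i s).deriv

theorem dS_nF (i : Fin 3) : dS (nF i : ScalarField γ₀) = -(kap * tF i) + tau * bF i :=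
  funext fun γ => funext fun s => (hasDerivAt_nC γ.2.apc γ.2.curv_ne_zero i s).deriv

theorem dS_bF (i : Fin 3) : dS (bF i : ScalarField γ₀) = -(tau * nF i) :=
  funext fun γ => funext fun s => (hasDerivAt_bC γ.2.apc γ.2.curv_ne_zero i s).deriv

theorem kap_mul_kapInv : (kap * kapInv : ScalarField γ₀) = 1 :=
  funext fun γ => funext fun s => mul_inv_cancel₀ (kap_ne γ s)

theorem frame_tt : (∑ i, tF i * tF i : ScalarField γ₀) = 1 :=
  funext fun γ => funext fun s => by
    rw [Finset.sum_apply, Finset.sum_apply]; exact sum_tC_sq γ.2.apc s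

theorem frame_nn : (∑ i, nF i * nF i : ScalarField γ₀) = 1 :=
  funext fun γ => funext fun s => by
    rw [Finset.sum_apply, Finset.sum_apply]; exact sum_nC_sq γ.2.apc γ.2.curv_ne_zero s

theorem frame_bb : (∑ i, bF i * bF i : ScalarField γ₀) = 1 :=
  funext fun γ => funext fun s => by
    rw [Finset.sum_apply, Finset.sum_apply]; exact (frenet_frame γ.2.apc γ.2.curv_ne_zero s).1

theorem frame_tn : (∑ i, tF i * nF i : ScalarField γ₀) = 0 :=
  funext fun γ => funext fun s => by
    rw [Finset.sum_apply, Finset.sum_apply]; exact sum_tC_nC γ.2.apc γ.2.curv_ne_zero s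

theorem frame_tb : (∑ i, tF i * bF i : ScalarField γ₀) = 0 :=
  funext fun γ => funext fun s => by
    rw [Finset.sum_apply, Finset.sum_apply]; exact (frenet_frame γ.2.apc γ.2.curv_ne_zero s).2.1

theorem frame_nb : (∑ i, nF i * bF i : ScalarField γ₀) = 0 :=
  funext fun γ => funext fun s => by
    rw [Finset.sum_apply, Finset.sum_apply]; exact (frenet_frame γ.2.apc γ.2.curv_ne_zero s).2.2.1

/-- The `N`-component of the variational derivative of the unit tangent along `wp g h`. -/
noncomputable def pF (g h : ScalarField γ₀) : ScalarField γ₀ :=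
  dS g + kap * antiS (kap * g) - tau * h

/-- The `B`-component of the variational derivative of the unit tangent along `wp g h`. -/
noncomputable def qF (g h : ScalarField γ₀) : ScalarField γ₀ := dS h + tau * g

/-- The `B`-component of the variational derivative of the principal normal along `wp g h`. -/
noncomputable def rF (g h : ScalarField γ₀) : ScalarField γ₀ :=
  kapInv * (dS (qF g h) + tau * pF g h)

variable {g h : ScalarField γ₀}

theorem Good.kap_mul (hg : Good 1 g) : Good 2 (kap * g) := good_kap.mul hg

theorem good_pF (hg : Good 1 g) (hh : Good 1 h) : Good 1 (pF g h) :=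
  (hg.dS.add (good_kap.mul hg.kap_mul.antiS)).sub (by simpa using good_tau.mul hh)

theorem good_qF (hg : Good 1 g) (hh : Good 1 h) : Good 1 (qF g h) :=
  hh.dS.add (by simpa using good_tau.mul hg)

theorem good_rF (hg : Good 1 g) (hh : Good 1 h) : Good 0 (rF g h) := by
  have h1 : Good 1 (tau * pF g h) := by simpa using good_tau.mul (good_pF hg hh)
  rw [rF]
  simpa using good_kapInv.mul ((good_qF hg hh).dS.add h1)

theorem Good.mul_zero_right {n : ℤ} {f u : ScalarField γ₀} (hf : Good n f) (hu : Good 0 u) :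
    Good n (f * u) := by simpa using hf.mul hu

theorem Good.lower_zero {f : ScalarField γ₀} (hf : Good 1 f) : Good 0 f := by simpa using hf.lower

theorem good_coordF_wp (hg : Good 1 g) (hh : Good 1 h) (i : Fin 3) : Good 0 (coordF (wp g h) i) :=
  ((hg.kap_mul.antiS.mul_zero_right (good_tF i)).add
    (hg.mul_zero_right (good_nF i)).lower_zero).add (hh.mul_zero_right (good_bF i)).lower_zero

/-- No `T`-component remains: `∂ₛ` of the coefficient `∂ₛ⁻¹(κ g)` contributes `κ g`, and `g N'`
contributes `-κ g`. This is the infinitesimal preservation of arclength and the reason for the form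
of the fields `wp g h`. -/
theorem dS_coordF_wp (hg : Good 1 g) (hh : Good 1 h) (i : Fin 3) :
    dS (coordF (wp g h) i) = pF g h * nF i + qF g h * bF i := by
  have h1 := hg.kap_mul.antiS.mul (good_tF i)
  have h2 := hg.mul_zero_right (good_nF i)
  have h3 := hh.mul_zero_right (good_bF i)
  rw [coordF_wp, dS_add (h1.add (h2.lower_zero)) h3, dS_add h1 h2, dS_mul hg.kap_mul.antiS (good_tF i),
    dS_mul hg (good_nF i), dS_mul hh (good_bF i), dS_antiS hg.kap_mul, dS_tF, dS_nF, dS_bF, pF, qF]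
  ring

theorem good_dS_coordF_wp (hg : Good 1 g) (hh : Good 1 h) (i : Fin 3) :
    Good 1 (dS (coordF (wp g h) i)) := by
  rw [dS_coordF_wp hg hh]
  exact ((good_pF hg hh).mul_zero_right (good_nF i)).add ((good_qF hg hh).mul_zero_right (good_bF i))

theorem dS_dS_coordF_wp (hg : Good 1 g) (hh : Good 1 h) (i : Fin 3) :
    dS (dS (coordF (wp g h) i)) = -(kap * pF g h) * tF i + (dS (pF g h) - tau * qF g h) * nF i +
      (dS (qF g h) + tau * pF g h) * bF i := by
  have hp := good_pF hg hh
  have hq := good_qF hg hh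
  rw [dS_coordF_wp hg hh, dS_add (hp.mul_zero_right (good_nF i)) (hq.mul_zero_right (good_bF i)),
    dS_mul hp (good_nF i), dS_mul hq (good_bF i), dS_nF, dS_bF]
  ring

theorem contDiff_wp (hg : Good 1 g) (hh : Good 1 h) (γ : BAL γ₀) : ContDiff ℝ ∞ (wp g h γ) :=
  contDiff_coord.2 fun i => (good_coordF_wp hg hh i).contDiff γ

/-- The order-one clause of `velocity`, read in coordinates. -/
theorem hasVar_tF_dS (hg : Good 1 g) (hh : Good 1 h) (i : Fin 3) :
    HasVar (wp g h) (tF i) (dS (coordF (wp g h) i)) := by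
  intro γ Γ hΓ s
  have h1 := hasDerivAt_coord.1 (hΓ.velocity 1 s) i
  simp only [iteratedDeriv_one] at h1
  rw [deriv_coord ((contDiff_wp hg hh γ).differentiable (by simp))] at h1
  exact h1

theorem hasVar_tF (hg : Good 1 g) (hh : Good 1 h) (i : Fin 3) :
    HasVar (wp g h) (tF i) (pF g h * nF i + qF g h * bF i) :=
  dS_coordF_wp hg hh i ▸ hasVar_tF_dS hg hh i

theorem hasVar_dS_tF (hg : Good 1 g) (hh : Good 1 h) (i : Fin 3) :
    HasVar (wp g h) (dS (tF i)) (-(kap * pF g h) * tF i + (dS (pF g h) - tau * qF g h) * nF i +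
      (dS (qF g h) + tau * pF g h) * bF i) :=
  dS_dS_coordF_wp hg hh i ▸ (hasVar_tF_dS hg hh i).dS (good_tF i) (good_dS_coordF_wp hg hh i)

theorem kap_mul_kap : (kap * kap : ScalarField γ₀) = ∑ i, dS (tF i) * dS (tF i) :=
  funext fun γ => funext fun s => by
    have := kap_sq γ s
    simpa [Finset.sum_apply, sq] using this

/-- Varying `κ² = |T'|²` gives `2 κ δκ = 2 ⟨κ N, δT'⟩`, so `δκ` is the `N`-component of the second
derivative of the field. -/
theorem hasVar_kap (hg : Good 1 g) (hh : Good 1 h) :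
    HasVar (wp g h) kap (dS (pF g h) - tau * qF g h) := by
  have h1 := HasVar.sum Finset.univ fun i _ => (hasVar_dS_tF hg hh i).mul (hasVar_dS_tF hg hh i)
  rw [← kap_mul_kap] at h1
  refine h1.kap_of_sq.congr ?_
  have e1 := frame_tn (γ₀ := γ₀)
  have e2 := frame_nn (γ₀ := γ₀)
  have e3 := frame_nb (γ₀ := γ₀)
  have e4 := kap_mul_kapInv (γ₀ := γ₀)
  have e5 : ∀ f : ScalarField γ₀, (1 / 2 : ℝ) • (f + f) = f := fun f => by
    rw [← two_smul ℝ f, smul_smul]; norm_num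
  refine Eq.trans ?_ (e5 _)
  congr 1
  simp only [Fin.sum_univ_three, dS_tF] at *
  set u : ScalarField γ₀ := dS (pF g h) - tau * qF g h
  set w : ScalarField γ₀ := dS (qF g h) + tau * pF g h
  linear_combination (-2 * kapInv * kap * kap * pF g h) * e1 + (2 * kapInv * kap * u) * e2 +
    (2 * kapInv * kap * w) * e3 + 2 * u * e4

/-- Product rule for `N = κ⁻¹ T'`. The `N`-component of `κ⁻¹ δT'` is cancelled by the variation of
`κ⁻¹`, as it must be for a unit vector. -/
theorem hasVar_nF (hg : Good 1 g) (hh : Good 1 h) (i : Fin 3) :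
    HasVar (wp g h) (nF i) (-(pF g h * tF i) + rF g h * bF i) := by
  rw [nF_eq]
  refine ((hasVar_kap hg hh).inv_kap.mul (hasVar_dS_tF hg hh i)).congr ?_
  have e4 := kap_mul_kapInv (γ₀ := γ₀)
  rw [dS_tF, rF]
  set u : ScalarField γ₀ := dS (pF g h) - tau * qF g h
  linear_combination (-kapInv * u * nF i - pF g h * tF i) * e4

theorem bF_mul_nF : (bF 1 * nF 2 - bF 2 * nF 1 : ScalarField γ₀) = -tF 0 ∧
    (bF 2 * nF 0 - bF 0 * nF 2 : ScalarField γ₀) = -tF 1 ∧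
    (bF 0 * nF 1 - bF 1 * nF 0 : ScalarField γ₀) = -tF 2 := by
  have e1 := frame_tn (γ₀ := γ₀)
  have e2 := frame_nn (γ₀ := γ₀)
  simp only [Fin.sum_univ_three, bF_zero, bF_one, bF_two] at *
  refine ⟨?_, ?_, ?_⟩
  · linear_combination nF 0 * e1 - tF 0 * e2
  · linear_combination nF 1 * e1 - tF 1 * e2
  · linear_combination nF 2 * e1 - tF 2 * e2

theorem tF_mul_bF : (tF 1 * bF 2 - tF 2 * bF 1 : ScalarField γ₀) = -nF 0 ∧
    (tF 2 * bF 0 - tF 0 * bF 2 : ScalarField γ₀) = -nF 1 ∧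
    (tF 0 * bF 1 - tF 1 * bF 0 : ScalarField γ₀) = -nF 2 := by
  have e1 := frame_tn (γ₀ := γ₀)
  have e2 := frame_tt (γ₀ := γ₀)
  simp only [Fin.sum_univ_three, bF_zero, bF_one, bF_two] at *
  refine ⟨?_, ?_, ?_⟩
  · linear_combination tF 0 * e1 - nF 0 * e2
  · linear_combination tF 1 * e1 - nF 1 * e2
  · linear_combination tF 2 * e1 - nF 2 * e2

/-- Product rule for `B = T × N`: with `p`, `q`, `r` for `pF`, `qF`, `rF`, the terms `p N × N` and
`-p T × T` vanish and `q B × N + r T × B` remains. -/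
theorem hasVar_bF (hg : Good 1 g) (hh : Good 1 h) (i : Fin 3) :
    HasVar (wp g h) (bF i) (-(qF g h * tF i) - rF g h * nF i) := by
  have ht := hasVar_tF hg hh
  have hn := hasVar_nF hg hh
  obtain ⟨a0, a1, a2⟩ := bF_mul_nF (γ₀ := γ₀)
  obtain ⟨b0, b1, b2⟩ := tF_mul_bF (γ₀ := γ₀)
  fin_cases i
  · have := ((ht 1).mul (hn 2)).sub ((ht 2).mul (hn 1))
    rw [← bF_zero] at this
    refine this.congr ?_
    simp only [Fin.zero_eta]
    linear_combination qF g h * a0 + rF g h * b0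
  · have := ((ht 2).mul (hn 0)).sub ((ht 0).mul (hn 2))
    rw [← bF_one] at this
    refine this.congr ?_
    simp only [Fin.mk_one]
    linear_combination qF g h * a1 + rF g h * b1
  · have := ((ht 0).mul (hn 1)).sub ((ht 1).mul (hn 0))
    rw [← bF_two] at this
    refine this.congr ?_
    simp only [Fin.reduceFinMk]
    linear_combination qF g h * a2 + rF g h * b2

/-- In `τ = ⟨N', B⟩` the first factor contributes the `B`-component `r'` of `(δN)'`, the second
contributes `⟨-κ T + τ B, -q T - r N⟩ = κ q`. -/
theorem hasVar_tau (hg : Good 1 g) (hh : Good 1 h) :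
    HasVar (wp g h) tau (dS (rF g h) + kap * qF g h) := by
  have hp := good_pF hg hh
  have hq := good_qF hg hh
  have hr := good_rF hg hh
  have hN : ∀ i : Fin 3, Good 0 (-(pF g h * tF i) + rF g h * bF i) := fun i =>
    ((hp.mul_zero_right (good_tF i)).lower_zero.neg).add (hr.mul_zero_right (good_bF i))
  have h1 := HasVar.sum Finset.univ fun i _ =>
    ((hasVar_nF hg hh i).dS (good_nF i) (hN i)).mul (hasVar_bF hg hh i)
  rw [← tau_eq] at h1
  refine h1.congr ?_
  have d1 : ∀ i : Fin 3, dS (-(pF g h * tF i) + rF g h * bF i) =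
      -(dS (pF g h) * tF i + pF g h * (kap * nF i)) + (dS (rF g h) * bF i - rF g h * (tau * nF i)) := by
    intro i
    have := dS_add ((hp.mul_zero_right (good_tF i)).lower_zero.neg) (hr.mul_zero_right (good_bF i))
    rw [this, ← neg_one_smul ℝ (pF g h * tF i), dS_smul, dS_mul hp (good_tF i),
      dS_mul hr (good_bF i), dS_tF, dS_bF, neg_one_smul]
    ring
  have e1 := frame_tn (γ₀ := γ₀)
  have e2 := frame_tt (γ₀ := γ₀)
  have e3 := frame_tb (γ₀ := γ₀)
  have e4 := frame_nn (γ₀ := γ₀)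
  have e5 := frame_nb (γ₀ := γ₀)
  have e6 := frame_bb (γ₀ := γ₀)
  simp only [Fin.sum_univ_three, d1, dS_nF] at *
  linear_combination (kap * rF g h) * e1 + (kap * qF g h) * e2 +
    (-dS (pF g h) - tau * qF g h) * e3 + (-kap * pF g h - 2 * rF g h * tau) * e5 + dS (rF g h) * e6

end Formulas
end Filament

namespace Filament

variable {γ₀ : ℝ → E3}

/-! ### Tools for the construction of variations -/

section Preliminaries

theorem SmoothTame.coeff {ι : Type*} {l : Filter ι} (c : ι → ℝ) :
    SmoothTame l (fun i _ => c i) (fun i _ => c i) := by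
  refine SmoothTame.of_deriv (Eventually.of_forall fun i => contDiff_const) Tame.refl ?_
  simp only [deriv_const']
  exact SmoothTame.zero

theorem reg_of_hasCompactSupport {w b : ℝ → ℝ} (hb : ContDiff ℝ ∞ b) (hc : HasCompactSupport b)
    (hw : Continuous w) (hw0 : ∀ s, w s ≠ 0) : Reg w b := by
  refine Reg.of_tame hb fun k => ?_
  have h1 : HasCompactSupport (iteratedDeriv k b) := by
    induction k with
    | zero => simpa using hc
    | succ k ih => rw [iteratedDeriv_succ]; exact ih.deriv
  have h2 : Continuous (iteratedDeriv k b) :=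
    hb.continuous_iteratedDeriv k (by exact_mod_cast le_top)
  have h3 : HasCompactSupport fun s => iteratedDeriv k b s * (w s)⁻¹ := h1.mul_right
  obtain ⟨C, hC⟩ := h3.exists_bound_of_continuous (h2.mul (hw.inv₀ hw0))
  refine ⟨C, 0, (norm_nonneg _).trans (hC 0), fun s => ?_⟩
  have := hC s
  rw [Real.norm_eq_abs, abs_mul, abs_inv, mul_inv_le_iff₀ (abs_pos.2 (hw0 s))] at this
  simpa using this

theorem exists_uniform_bound (γ : BAL γ₀) {u : ℝ → ℝ → ℝ}
    (h : Tame (𝓝 (0 : ℝ)) (fun ε s => ε * kap γ s) u) :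
    ∃ M : ℝ, 0 < M ∧ ∀ᶠ ε in 𝓝 (0 : ℝ), ∀ s, |u ε s| ≤ M * |ε| := by
  obtain ⟨C, m, hC, H⟩ := h
  obtain ⟨D, hD, hDb⟩ := γ.2.curv_rapid.exists_bound (contDiff_kap γ).continuous m
  refine ⟨C * D + 1, by positivity, ?_⟩
  filter_upwards [H] with ε hε s
  refine (hε s).trans ?_
  rw [abs_mul]
  calc C * (1 + s ^ 2) ^ m * (|ε| * |kap γ s|) = C * ((1 + s ^ 2) ^ m * |kap γ s|) * |ε| := by ring
    _ ≤ C * D * |ε| :=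
      mul_le_mul_of_nonneg_right (mul_le_mul_of_nonneg_left (hDb s) hC) (abs_nonneg _)
    _ ≤ _ := by gcongr; linarith

theorem eventually_mul_abs_le (M : ℝ) {η : ℝ} (hη : 0 < η) : ∀ᶠ ε in 𝓝 (0 : ℝ), M * |ε| ≤ η := by
  have h : Tendsto (fun ε : ℝ => M * |ε|) (𝓝 0) (𝓝 (M * |(0 : ℝ)|)) :=
    (continuous_const.mul continuous_abs).tendsto 0
  rw [abs_zero, mul_zero] at h
  exact (h.eventually (gt_mem_nhds hη)).mono fun ε h => h.le

/-- Allows the scale of the cutoff to depend on `ε` merely continuously at `0`; a fractional power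
of `|ε|` will be used. -/
theorem hasDerivAt_mul_self_of_continuousAt {c : ℝ → ℝ} (hc : ContinuousAt c 0) :
    HasDerivAt (fun ε => ε * c ε) (c 0) 0 := by
  rw [hasDerivAt_iff_tendsto_slope_zero]
  refine (hc.tendsto.mono_left nhdsWithin_le_nhds).congr' ?_
  filter_upwards [self_mem_nhdsWithin] with ε hε
  have : ε ≠ 0 := hε
  simp [this]

/-- All derivatives in `s` of a family with uniform bounds are differentiable in the parameter. -/
theorem hasDerivAt_iteratedDeriv_param {w : ℝ → ℝ} (hw : Continuous w) {u : ℝ → ℝ → ℝ} {G : ℝ → ℝ}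
    (hu : SmoothTame (𝓝 0) (fun ε s => ε * w s) u) (hu0 : ∀ s, u 0 s = 0) (hG : ContDiff ℝ ∞ G)
    (h : ∀ s, HasDerivAt (fun ε => u ε s) (G s) 0) (n : ℕ) (s : ℝ) :
    HasDerivAt (fun ε => iteratedDeriv n (u ε) s) (iteratedDeriv n G s) 0 := by
  induction n generalizing u G with
  | zero => simpa using h s
  | succ n ih =>
    simp only [iteratedDeriv_succ']
    have h00 : u 0 = fun _ => 0 := funext hu0
    refine ih hu.deriv (fun s => by rw [h00]; simp) (contDiff_infty_iff_deriv.1 hG).2 fun s => ?_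
    obtain ⟨C, m, hC, H⟩ := hu.2 2
    have hcont : Continuous fun t => C * (1 + t ^ 2) ^ m * w t := by fun_prop
    obtain ⟨M, hM⟩ := (isCompact_Icc (a := s - 1) (b := s + 1)).exists_bound_of_continuousOn
      hcont.continuousOn
    refine hasDerivAt_deriv_param (M := M) (hG.differentiable (by simp) s) h
      (by rw [h00]; exact contDiff_const) hu.1 ?_
    filter_upwards [H] with ε hε t ht
    simp only [hu0, sub_zero]
    refine (hε t).trans ?_
    rw [abs_mul, mul_left_comm]
    refine mul_le_mul_of_nonneg_left (le_trans (le_of_eq ?_) (hM t ht)) (abs_nonneg ε)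
    rw [Real.norm_eq_abs, abs_mul, abs_of_nonneg (mul_nonneg hC (br_pow_pos t m).le)]

end Preliminaries

/-! ### Deforming the unit tangent with a moving cutoff -/

section Cutoff

variable (γ : BAL γ₀) {x : Fin 3 → ℝ → ℝ}

/-- A deformation of the unit tangent of `γ`, in coordinates: small compared with the curvature,
compactly supported for each parameter, with velocity `x`. -/
structure IsTangentDeformation (x : Fin 3 → ℝ → ℝ) (D : Fin 3 → ℝ → ℝ → ℝ) : Prop where
  tame : ∀ i, SmoothTame (𝓝 0) (fun ε s => ε * kap γ s) (D i)
  deriv_small : ∀ i, ∀ η > 0, ∀ᶠ ε in 𝓝 (0 : ℝ), ∀ s, |deriv (D i ε) s| ≤ η * kap γ s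
  support : ∀ᶠ ε in 𝓝 (0 : ℝ), ∃ R : ℝ, ∀ i s, R < |s| → D i ε s = 0
  velocity : ∀ i s, HasDerivAt (fun ε => D i ε s) (x i s) 0
  base : ∀ i s, D i 0 s = 0
  unit : ∀ᶠ ε in 𝓝 (0 : ℝ), ∀ s, ∑ i, (tC γ.1 i s + D i ε s) * (tC γ.1 i s + D i ε s) = 1

theorem exists_cutoff : ∃ φ : ℝ → ℝ, ContDiff ℝ ∞ φ ∧ HasCompactSupport φ ∧ φ 0 = 1 ∧
    ∀ t, 2 ≤ |t| → φ t = 0 := by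
  let f : ContDiffBump (0 : ℝ) := ⟨1, 2, one_pos, one_lt_two⟩
  refine ⟨f, f.contDiff, f.hasCompactSupport, f.one_of_mem_closedBall (by simp [f]), fun t ht => ?_⟩
  exact f.zero_of_le_dist (by rw [dist_zero_right, Real.norm_eq_abs]; exact ht)

/-- For `W ⟂ T` and `q = |W|² / 4` the vector `((1 - q) T + W) / (1 + q)` has length `1` (inverse
stereographic projection), is rational in `W`, and its denominator is at least `1`. Here `W` is `ε
x`, cut off at distance of order `1 / δ` with `δ → 0` as `ε → 0`. The radius tends to infinity, so
the velocity is `x` everywhere, but slowly enough that polynomial factors on the support are beaten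
by `ε`. -/
theorem exists_tangentDeformation (hx : ∀ i, Reg (kap γ) (x i))
    (horth : ∀ s, ∑ i, tC γ.1 i s * x i s = 0) :
    ∃ D : Fin 3 → ℝ → ℝ → ℝ, IsTangentDeformation γ x D := by
  obtain ⟨φ, hφ, hφc, hφ1, hφ0⟩ := exists_cutoff
  -- The scale `δ` is at first an independent parameter in `[0, 1]`. The bounds are uniform in it,
  -- so their polynomial order is known before `δ` is chosen as a function of `ε`.
  let l : Filter (ℝ × ℝ) := 𝓝 0 ×ˢ 𝓟 (Set.Icc 0 1)
  have hε1 : ∀ᶠ a : ℝ × ℝ in l, |a.1| ≤ 1 := by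
    have h : ∀ᶠ ε in 𝓝 (0 : ℝ), |ε| ≤ 1 := by
      simpa using eventually_mul_abs_le 1 one_pos
    exact tendsto_fst.eventually h
  have hδ1 : ∀ᶠ a : ℝ × ℝ in l, |a.2| ≤ 1 := by
    have h : ∀ᶠ δ in 𝓟 (Set.Icc (0 : ℝ) 1), |δ| ≤ 1 := by
      filter_upwards [mem_principal_self _] with δ hδ
      exact abs_le.2 ⟨by linarith [hδ.1], hδ.2⟩
    exact tendsto_snd.eventually h
  have hcut : SmoothTame l (fun _ _ => 1) (fun a s => φ (a.2 * s)) := by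
    have h1 : SmoothTame l (fun _ _ => 1) (fun a s => a.2 * s) := by
      refine ((SmoothTame.coeff (l := l) fun a => a.2).mul
        (SmoothTame.comp_tendsto (j := fun _ => ())
          ((Good.param (γ₀ := γ₀)).reg γ) tendsto_top)).mono ?_
      refine ⟨1, 0, zero_le_one, hδ1.mono fun a ha s => ?_⟩
      simpa using ha
    exact h1.comp hφ (iteratedDeriv_bounded_of_hasCompactSupport hφ hφc)
  let W : Fin 3 → ℝ × ℝ → ℝ → ℝ := fun i a s => a.1 * φ (a.2 * s) * x i s
  let q : ℝ × ℝ → ℝ → ℝ := fun a s => (1 / 4) * ∑ i, W i a s * W i a s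
  let ρ : ℝ × ℝ → ℝ → ℝ := fun a s => (1 + q a s)⁻¹
  let D : Fin 3 → ℝ × ℝ → ℝ → ℝ := fun i a s => -2 * (q a s * ρ a s) * tC γ.1 i s + ρ a s * W i a s
  have hW : ∀ i, SmoothTame l (fun a s => a.1 * kap γ s) (W i) := fun i =>
    (((SmoothTame.coeff (l := l) fun a => a.1).mul hcut).mul ((hx i).family l)).weight_congr
      fun a s => by simp
  obtain ⟨B, hB, hBk⟩ := kap_bounded γ
  have hsmall : Tame l (fun _ _ => 1) (fun a s => a.1 * kap γ s) := by
    refine ⟨B, 0, hB.le, hε1.mono fun a ha s => ?_⟩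
    rw [abs_mul, abs_of_pos (kap_pos γ s)]
    simp only [pow_zero, mul_one, abs_one]
    calc |a.1| * kap γ s ≤ 1 * B := mul_le_mul ha (hBk s) (kap_pos γ s).le zero_le_one
      _ = B := one_mul B
  have hq : SmoothTame l (fun a s => a.1 * kap γ s) q := by
    refine SmoothTame.const_mul (1 / 4) (SmoothTame.sum _ fun i _ =>
      (((hW i).mono hsmall).mul (hW i)).weight_congr fun a s => one_mul _)
  have hq0 : ∀ a s, 0 ≤ q a s := fun a s =>
    mul_nonneg (by norm_num) (Finset.sum_nonneg fun i _ => mul_self_nonneg _)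
  have hρ : SmoothTame l (fun _ _ => 1) ρ := by
    refine (((SmoothTame.const (l := l) 1).add (hq.mono hsmall)).inv
      (Eventually.of_forall fun a s => (by linarith [hq0 a s] : 0 < 1 + q a s).ne')
      (Tame.refl.of_le (Eventually.of_forall fun a s => ?_))
      (Eventually.of_forall fun a s => one_ne_zero)).weight_congr fun a s => inv_one
    rw [abs_one, abs_of_pos (by linarith [hq0 a s])]
    linarith [hq0 a s]
  have hD : ∀ i, SmoothTame l (fun a s => a.1 * kap γ s) (D i) := fun i =>
    ((((hq.mul hρ).const_mul (-2)).mul ((reg_frame γ i).1.family l)).weight_congr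
      fun a s => by ring).add ((hρ.mul (hW i)).weight_congr fun a s => by ring)
  have hDzero : ∀ i (a : ℝ × ℝ) s, 2 ≤ |a.2 * s| → D i a s = 0 := by
    intro i a s has
    have h0 : ∀ j, W j a s = 0 := fun j => by simp [W, hφ0 _ has]
    simp [D, q, h0]
  have hunit : ∀ (a : ℝ × ℝ) s,
      ∑ i, (tC γ.1 i s + D i a s) * (tC γ.1 i s + D i a s) = 1 := by
    intro a s
    have h1 := sum_tC_sq γ.2.apc s
    have h2 : ∑ i, tC γ.1 i s * W i a s = 0 := by
      have := horth s
      simp only [W, Fin.sum_univ_three] at *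
      linear_combination a.1 * φ (a.2 * s) * this
    have h3 : ∑ i, W i a s * W i a s = 4 * q a s := by simp only [q]; ring
    have h4 : ρ a s * (1 + q a s) = 1 :=
      inv_mul_cancel₀ (by linarith [hq0 a s] : 0 < 1 + q a s).ne'
    simp only [D, Fin.sum_univ_three] at *
    linear_combination (1 - 2 * q a s * ρ a s) ^ 2 * h1 +
      2 * (1 - 2 * q a s * ρ a s) * ρ a s * h2 + ρ a s ^ 2 * h3 + 4 * q a s * ρ a s * h4
  choose C m hC H using fun i => (hD i).deriv.tame
  -- Where `|δ s| ≤ 2`, the factor `(1 + s²)^m` is of size `δ^(-2m)`. With `|ε| = δ^(2M + 1)` and `m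
  -- ≤ M` at least one factor `δ` is left over.
  let M : ℕ := ∑ i, m i
  let δ : ℝ → ℝ := fun ε => |ε| ^ (((2 * M + 1 : ℕ) : ℝ)⁻¹)
  have hδ0 : δ 0 = 0 := by
    simp only [δ, abs_zero]
    exact Real.zero_rpow (by positivity)
  have hδpow : ∀ ε, δ ε ^ (2 * M + 1) = |ε| := fun ε =>
    Real.rpow_inv_natCast_pow (abs_nonneg ε) (by omega)
  have hδnn : ∀ ε, 0 ≤ δ ε := fun ε => Real.rpow_nonneg (abs_nonneg ε) _
  have hδc : ContinuousAt δ 0 :=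
    (Real.continuousAt_rpow_const _ _ (Or.inr (by positivity))).comp continuous_abs.continuousAt
  have hδle : ∀ᶠ ε in 𝓝 (0 : ℝ), δ ε ≤ 1 := by
    have := hδc.eventually (p := fun t => t < 1) (gt_mem_nhds (by rw [hδ0]; exact one_pos))
    exact this.mono fun ε h => h.le
  have hj : Tendsto (fun ε => (ε, δ ε)) (𝓝 (0 : ℝ)) l :=
    tendsto_id.prodMk (tendsto_principal.2 (hδle.mono fun ε h => ⟨hδnn ε, h⟩))
  have hWd : ∀ i s, HasDerivAt (fun ε => W i (ε, δ ε) s) (x i s) 0 := by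
    intro i s
    have hc : ContinuousAt (fun ε => φ (δ ε * s)) 0 :=
      hφ.continuous.continuousAt.comp (hδc.mul continuousAt_const)
    have := (hasDerivAt_mul_self_of_continuousAt hc).mul_const (x i s)
    rw [hδ0, zero_mul, hφ1, one_mul] at this
    exact this
  have hW0 : ∀ i s, W i (0, δ 0) s = 0 := fun i s => by simp [W]
  have hqd : ∀ s, HasDerivAt (fun ε => q (ε, δ ε) s) 0 0 := by
    intro s
    have := (HasDerivAt.fun_sum (u := Finset.univ) fun i _ => (hWd i s).fun_mul (hWd i s)).const_mul (1 / 4 : ℝ)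
    refine HasDerivAt.congr_deriv (f := fun ε => q (ε, δ ε) s) this ?_
    simp [hW0]
  have hq00 : ∀ s, q (0, δ 0) s = 0 := fun s => by simp [q, hW0]
  have hρ0 : ∀ s, ρ (0, δ 0) s = 1 := fun s => by simp [ρ, hq00]
  have hρd : ∀ s, HasDerivAt (fun ε => ρ (ε, δ ε) s) 0 0 := by
    intro s
    have := ((hqd s).const_add 1).fun_inv (by rw [hq00]; norm_num)
    simpa using this
  refine ⟨fun i ε => D i (ε, δ ε), fun i => (hD i).comp_tendsto hj, ?_, ?_, ?_, ?_, ?_⟩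
  · intro i η hη
    have hlim : ∀ᶠ ε in 𝓝 (0 : ℝ), C i * 5 ^ m i * δ ε < η := by
      have : ContinuousAt (fun ε => C i * 5 ^ m i * δ ε) 0 := continuousAt_const.mul hδc
      exact this.eventually (gt_mem_nhds (by simpa only [hδ0, mul_zero] using hη))
    filter_upwards [hj.eventually (H i), hlim, hδle] with ε h1 h2 h3 s
    have hk := kap_pos γ s
    by_cases hs : 2 < |δ ε * s|
    · have hopen : IsOpen {s : ℝ | 2 < |δ ε * s|} := isOpen_lt continuous_const (by fun_prop)
      have : D i (ε, δ ε) =ᶠ[𝓝 s] fun _ => 0 := by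
        filter_upwards [hopen.mem_nhds hs] with t ht
        exact hDzero i _ t (le_of_lt ht)
      rw [this.deriv_eq]
      simp
      positivity
    · have hs := not_lt.1 hs
      -- `5 = 1 + 4`, from `δ ≤ 1` and `|δ s| ≤ 2`.
      have h4 : (1 + s ^ 2) * δ ε ^ 2 ≤ 5 := by
        have a1 : (δ ε * s) ^ 2 ≤ 4 := by
          rw [← sq_abs]; nlinarith [abs_nonneg (δ ε * s)]
        nlinarith [hδnn ε]
      have h5 : (1 + s ^ 2) ^ m i * |ε| ≤ 5 ^ m i * δ ε := by
        have hmM : m i ≤ M := Finset.single_le_sum (f := m) (fun _ _ => Nat.zero_le _) (Finset.mem_univ i)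
        have a2 : |ε| ≤ δ ε ^ (2 * m i) * δ ε := by
          rw [← hδpow ε, ← pow_succ]
          exact pow_le_pow_of_le_one (hδnn ε) h3 (by omega)
        calc (1 + s ^ 2) ^ m i * |ε| ≤ (1 + s ^ 2) ^ m i * (δ ε ^ (2 * m i) * δ ε) := by gcongr
          _ = ((1 + s ^ 2) * δ ε ^ 2) ^ m i * δ ε := by rw [mul_pow, ← pow_mul]; ring
          _ ≤ 5 ^ m i * δ ε := by
            have := hδnn ε
            gcongr
      refine (h1 s).trans ?_
      rw [abs_mul, abs_of_pos hk]
      calc C i * (1 + s ^ 2) ^ m i * (|ε| * kap γ s)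
          = C i * ((1 + s ^ 2) ^ m i * |ε|) * kap γ s := by ring
        _ ≤ C i * (5 ^ m i * δ ε) * kap γ s := by gcongr; exact hC i
        _ ≤ η * kap γ s := by gcongr; linarith
  · refine Eventually.of_forall fun ε => ?_
    -- At `ε = 0` the scale is `0` and nothing is cut off, but the deformation itself vanishes.
    rcases eq_or_ne ε 0 with rfl | hε
    · exact ⟨0, fun i s _ => by simp [D, hW0, hq00]⟩
    · have hδp : 0 < δ ε := Real.rpow_pos_of_pos (abs_pos.2 hε) _
      refine ⟨2 / δ ε, fun i s hs => hDzero i _ s ?_⟩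
      rw [div_lt_iff₀ hδp] at hs
      rw [abs_mul, abs_of_pos hδp]
      linarith
  · intro i s
    have := ((((hqd s).fun_mul (hρd s)).const_mul (-2)).mul_const (tC γ.1 i s)).fun_add
      ((hρd s).fun_mul (hWd i s))
    refine HasDerivAt.congr_deriv (f := fun ε => D i (ε, δ ε) s) this ?_
    simp [hq00, hρ0]
  · exact fun i s => by simp [D, hW0, hq00]
  · exact Eventually.of_forall fun ε s => hunit _ s

end Cutoff
end Filament

namespace Filament

variable {γ₀ : ℝ → E3}

/-! ### Correcting the total displacement -/

section Correction

variable (γ : BAL γ₀)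

/-- On a fixed compact set the polynomial factor is a constant, so the factor `ε` alone makes the
derivative small against the curvature. -/
theorem deriv_small_of_support {F : ℝ → ℝ → ℝ}
    (hF : SmoothTame (𝓝 0) (fun ε s => ε * kap γ s) F) {S : ℝ}
    (hS : ∀ᶠ ε in 𝓝 (0 : ℝ), ∀ s, S < |s| → F ε s = 0) {η : ℝ} (hη : 0 < η) :
    ∀ᶠ ε in 𝓝 (0 : ℝ), ∀ s, |deriv (F ε) s| ≤ η * kap γ s := by
  obtain ⟨C, m, hC, H⟩ := hF.deriv.tame
  filter_upwards [H, eventually_mul_abs_le (C * (1 + S ^ 2) ^ m) hη, hS] with ε h1 h2 h3 s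
  have hk := kap_pos γ s
  by_cases hs : S < |s|
  · have hopen : IsOpen {s : ℝ | S < |s|} := isOpen_lt continuous_const continuous_abs
    have : F ε =ᶠ[𝓝 s] fun _ => 0 := by
      filter_upwards [hopen.mem_nhds hs] with t ht using h3 t ht
    rw [this.deriv_eq]
    simp
    positivity
  · have hs : s ^ 2 ≤ S ^ 2 := by
      rw [← sq_abs s]
      exact pow_le_pow_left₀ (abs_nonneg s) (not_lt.1 hs) 2
    refine (h1 s).trans ?_
    rw [abs_mul, abs_of_pos hk]
    calc C * (1 + s ^ 2) ^ m * (|ε| * kap γ s) ≤ C * (1 + S ^ 2) ^ m * (|ε| * kap γ s) := by gcongr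
      _ = C * (1 + S ^ 2) ^ m * |ε| * kap γ s := by ring
      _ ≤ η * kap γ s := by gcongr

theorem exists_bump (c r : ℝ) (hr : 0 < r) : ∃ b : ℝ → ℝ, ContDiff ℝ ∞ b ∧ HasCompactSupport b ∧
    (∀ t, 0 ≤ b t) ∧ (∀ t, b t ≤ 1) ∧ (∀ t, |t - c| ≤ r → b t = 1) ∧
    (∀ t, 2 * r ≤ |t - c| → b t = 0) := by
  let f : ContDiffBump c := ⟨r, 2 * r, hr, by linarith⟩
  refine ⟨f, f.contDiff, f.hasCompactSupport, fun t => f.nonneg, fun t => f.le_one,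
    fun t ht => f.one_of_mem_closedBall ?_, fun t ht => f.zero_of_le_dist ?_⟩
  · rw [Metric.mem_closedBall, Real.dist_eq]; exact ht
  · rw [Real.dist_eq]; exact ht

variable {γ} {x : Fin 3 → ℝ → ℝ} {D : Fin 3 → ℝ → ℝ → ℝ}

theorem SmoothTame.eventually_integrable {u : ℝ → ℝ → ℝ}
    (hu : SmoothTame (𝓝 0) (fun ε s => ε * kap γ s) u) : ∀ᶠ ε in 𝓝 (0 : ℝ), Integrable (u ε) := by
  obtain ⟨C, m, hC, H⟩ := hu.tame
  filter_upwards [H, hu.1] with ε hε hs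
  refine integrable_of_bound γ (n := 0) (C := |ε| * C) (m := m) hs.continuous (by positivity)
    fun s => (hε s).trans (le_of_eq ?_)
  rw [abs_mul, zero_add, pow_one]
  ring

theorem IsTangentDeformation.hasDerivAt_setIntegral (hD : IsTangentDeformation γ x D)
    (hx : ∀ i, Reg (kap γ) (x i)) (i : Fin 3) (S : Set ℝ) :
    HasDerivAt (fun ε => ∫ s in S, D i ε s) (∫ s in S, x i s) 0 := by
  obtain ⟨C, m, hC, H⟩ := (hD.tame i).tame
  have h0 : D i 0 = fun _ => 0 := funext (hD.base i)
  refine hasDerivAt_integral_param (F := D i) (b := fun s => C * ((1 + s ^ 2) ^ m * kap γ s ^ (0 + 1)))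
    ((hD.tame i).1.mono fun ε h => h.continuous) (by rw [h0]; exact integrable_zero _ _ _)
    (hx i).continuous ((integrable_br_mul_kap γ m 0).const_mul C).integrableOn ?_
    fun s => hD.velocity i s
  filter_upwards [H] with ε hε s
  rw [hD.base, sub_zero]
  refine (hε s).trans (le_of_eq ?_)
  rw [abs_mul, abs_of_pos (kap_pos γ s), zero_add, pow_one]
  ring

theorem IsTangentDeformation.hasDerivAt_integral (hD : IsTangentDeformation γ x D)
    (hx : ∀ i, Reg (kap γ) (x i)) (i : Fin 3) :
    HasDerivAt (fun ε => ∫ s, D i ε s) (∫ s, x i s) 0 := by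
  simpa using hD.hasDerivAt_setIntegral hx i Set.univ

/-- A deformation of the unit tangent can be corrected on a compact interval so that its integral
becomes parallel to the asymptotic direction. -/
theorem IsTangentDeformation.exists_correction {p e : E3} (he : ‖e‖ = 1)
    (hline : AsymptoticToLine p e γ₀) (hD : IsTangentDeformation γ x D)
    (hx : ∀ i, Reg (kap γ) (x i)) {A : ℝ} (hA : ∀ i, ∫ s, x i s = A * e i) :
    ∃ E : Fin 3 → ℝ → ℝ → ℝ, IsTangentDeformation γ x E ∧
      ∀ᶠ ε in 𝓝 (0 : ℝ), ∃ c : ℝ, ∀ i, ∫ s, E i ε s = c * e i := by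
  have hee := sum_sq_eq_one he
  have hkc := (contDiff_kap γ).continuous
  -- an interval on which the tangent is close to the asymptotic direction
  obtain ⟨s₀, hs₀⟩ : ∃ s₀, ∀ s ≥ s₀, 1 / 2 < ∑ i, tC γ.1 i s * e i := by
    have h1 : Tendsto (fun s => ∑ i, tC γ.1 i s * e i) atTop (𝓝 (∑ i, e i * e i)) :=
      tendsto_finsetSum _ fun i _ => (tendsto_tC hline γ i).1.mul_const _
    rw [hee] at h1
    exact eventually_atTop.1 (h1.eventually (lt_mem_nhds (by norm_num)))
  -- The bump `b` lives on `[s₀ + 2, s₀ + 6]`. The second bump `b₂` is `1` there and vanishes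
  -- outside `[s₀, s₀ + 8]`, in particular to the left of `s₀`, where the angle between the tangent
  -- and `e` is unknown.
  obtain ⟨b, hb, hbc, hb0, hb1, hbone, hbz⟩ := exists_bump (s₀ + 4) 1 one_pos
  obtain ⟨b₂, hb₂, hb₂c, hb₂0, hb₂1, hb₂one, hb₂z⟩ := exists_bump (s₀ + 4) 2 two_pos
  set β := ∫ s, b s with hβ
  have hbi : Integrable b := hb.continuous.integrable_of_hasCompactSupport hbc
  have hβ0 : 0 < β := by
    refine (integral_pos_iff_support_of_nonneg hb0 hbi).2 ?_
    have : Set.Ioo (s₀ + 3) (s₀ + 5) ⊆ Function.support b := fun t ht => by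
      rw [Function.mem_support, hbone t (abs_le.2 ⟨by linarith [ht.1], by linarith [ht.2]⟩)]
      exact one_ne_zero
    refine lt_of_lt_of_le ?_ (measure_mono this)
    rw [Real.volume_Ioo]
    simp only [ENNReal.ofReal_pos]
    linarith
  -- Minus the part of `∫ D` orthogonal to `e`, divided by the mass of the bump: adding `b d` makes
  -- the integral parallel to `e`.
  let d : Fin 3 → ℝ → ℝ := fun i ε =>
    -β⁻¹ * ((∫ s, D i ε s) - (∑ j, (∫ s, D j ε s) * e j) * e i)
  have hd0 : ∀ i, d i 0 = 0 := by
    have : ∀ i, D i 0 = fun _ => 0 := fun i => funext (hD.base i)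
    intro i
    simp [d, this]
  have hde : ∀ ε, ∑ i, d i ε * e i = 0 := by
    intro ε
    simp only [d, Fin.sum_univ_three] at *
    linear_combination β⁻¹ * ((∫ s, D 0 ε s) * e 0 + (∫ s, D 1 ε s) * e 1 + (∫ s, D 2 ε s) * e 2) * hee
  -- As `∫ x` is parallel to `e`, the orthogonal part of `∫ D` vanishes to first order. The
  -- correction therefore leaves the velocity unchanged.
  have hdd : ∀ i, HasDerivAt (d i) 0 0 := by
    intro i
    have h1 := fun i => hD.hasDerivAt_integral hx i
    have := ((h1 i).fun_sub ((HasDerivAt.fun_sum (u := Finset.univ)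
      fun j _ => (h1 j).mul_const (e j)).mul_const (e i))).const_mul (-β⁻¹)
    refine HasDerivAt.congr_deriv (f := d i) this ?_
    simp only [hA, Fin.sum_univ_three] at *
    linear_combination (β⁻¹ * A * e i) * hee
  have hdt : ∀ i, SmoothTame (𝓝 0) (fun ε _ => ε) (fun ε _ => d i ε) := by
    intro i
    have h1 : ∀ i, SmoothTame (𝓝 (0 : ℝ)) (fun ε _ => ε) (fun ε _ => ∫ s, D i ε s) := fun i =>
      smoothTame_integral γ (n := 0) ((hD.tame i).weight_congr fun ε s => by simp)
    have h2 := ((h1 i).sub ((SmoothTame.sum Finset.univ fun j _ =>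
      (h1 j).const_mul (e j)).const_mul (e i))).const_mul (-β⁻¹)
    refine h2.congr' fun ε s => ?_
    simp only [d, Fin.sum_univ_three]
    ring
  -- A multiple `η e` restores unit length without spoiling the direction of the integral. Since `|T
  -- + D| = 1`, `d ⟂ e` and `|e| = 1`, the vector `T + D + b d + η e` has length `1` if and only if
  -- `η² + 2 η θ = y`. The root `√(z² + y) - z` is small with `y`; `z` is `θ` on the support of `b`
  -- and is interpolated to `1` elsewhere, so as to stay away from `0`.
  let θ : ℝ → ℝ → ℝ := fun ε s => ∑ i, (tC γ.1 i s + D i ε s) * e i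
  let z : ℝ → ℝ → ℝ := fun ε s => b₂ s * θ ε s + (1 - b₂ s)
  let y : ℝ → ℝ → ℝ := fun ε s => -2 * (∑ i, (b s * d i ε) * (tC γ.1 i s + D i ε s)) -
    ∑ i, (b s * d i ε) * (b s * d i ε)
  let η : ℝ → ℝ → ℝ := fun ε s => √(z ε s ^ 2 + y ε s) - z ε s
  -- tameness
  obtain ⟨B, hB, hBk⟩ := kap_bounded γ
  have hsmall : Tame (𝓝 (0 : ℝ)) (fun _ _ => 1) (fun ε s => ε * kap γ s) := by
    refine ⟨B, 0, hB.le, (eventually_mul_abs_le 1 one_pos).mono fun a ha s => ?_⟩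
    rw [abs_mul, abs_of_pos (kap_pos γ s)]
    simp only [pow_zero, mul_one, abs_one]
    calc |a| * kap γ s ≤ 1 * B := mul_le_mul (by linarith) (hBk s) (kap_pos γ s).le zero_le_one
      _ = B := one_mul B
  have hTD : ∀ i, SmoothTame (𝓝 (0 : ℝ)) (fun _ _ => 1) (fun ε s => tC γ.1 i s + D i ε s) :=
    fun i => ((reg_frame γ i).1.family _).add ((hD.tame i).mono hsmall)
  have hθt : SmoothTame (𝓝 (0 : ℝ)) (fun _ _ => 1) θ :=
    SmoothTame.sum _ fun i _ => ((hTD i).const_mul (e i)).congr' fun ε s => mul_comm _ _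
  have hb₂t : SmoothTame (𝓝 (0 : ℝ)) (fun _ _ => 1) (fun _ => b₂) :=
    (reg_of_hasCompactSupport hb₂ hb₂c continuous_const fun _ => one_ne_zero).family _
  have hbt : SmoothTame (𝓝 (0 : ℝ)) (fun _ s => kap γ s) (fun _ => b) :=
    (reg_of_hasCompactSupport hb hbc hkc (kap_ne γ)).family _
  have hzt : SmoothTame (𝓝 (0 : ℝ)) (fun _ _ => 1) z :=
    ((hb₂t.mul hθt).weight_congr fun _ _ => one_mul _).add ((SmoothTame.const 1).sub hb₂t)
  have hbd : ∀ i, SmoothTame (𝓝 (0 : ℝ)) (fun ε s => ε * kap γ s) (fun ε s => b s * d i ε) :=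
    fun i => (hbt.mul (hdt i)).weight_congr fun ε s => mul_comm _ _
  have hyt : SmoothTame (𝓝 (0 : ℝ)) (fun ε s => ε * kap γ s) y :=
    ((SmoothTame.sum _ fun i _ => ((hbd i).mul (hTD i)).weight_congr
      fun _ _ => mul_one _).const_mul (-2)).sub
      (SmoothTame.sum _ fun i _ => ((hbd i).mul ((hbd i).mono hsmall)).weight_congr
        fun _ _ => mul_one _)
  -- lower bounds
  have hzpos : ∀ᶠ ε in 𝓝 (0 : ℝ), ∀ s, 1 / 4 ≤ z ε s := by
    obtain ⟨M, hM, H⟩ := exists_uniform_bound γ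
      ((SmoothTame.sum Finset.univ fun i _ => (hD.tame i).const_mul (e i)).tame)
    filter_upwards [H, eventually_mul_abs_le M (by norm_num : (0 : ℝ) < 1 / 4)] with ε h1 h2 s
    by_cases hs : b₂ s = 0
    · simp only [z, hs]; norm_num
    · have hs' : s₀ ≤ s := by
        by_contra! hlt
        exact hs (hb₂z s (by rw [abs_of_neg] <;> linarith))
      have h3 := hs₀ s hs'
      have h4 := (abs_le.1 ((h1 s).trans h2)).1
      have h5 : 1 / 4 ≤ θ ε s := by
        simp only [θ, Fin.sum_univ_three] at *
        linarith
      have := hb₂0 s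
      have := hb₂1 s
      simp only [z]
      nlinarith
  -- `(1/4)² - 1/32 = 1/32`.
  have hzy : ∀ᶠ ε in 𝓝 (0 : ℝ), ∀ s, 1 / 32 ≤ z ε s ^ 2 + y ε s := by
    obtain ⟨M, hM, H⟩ := exists_uniform_bound γ hyt.tame
    filter_upwards [H, hzpos, eventually_mul_abs_le M (by norm_num : (0 : ℝ) < 1 / 32)]
      with ε h1 h2 h3 s
    have := (abs_le.1 ((h1 s).trans h3)).1
    nlinarith [h2 s]
  have hsq : SmoothTame (𝓝 (0 : ℝ)) (fun _ _ => 1) (fun ε s => √(z ε s ^ 2 + y ε s)) := by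
    have h1 : SmoothTame (𝓝 (0 : ℝ)) (fun _ _ => (1 : ℝ) ^ 2) (fun ε s => z ε s ^ 2 + y ε s) :=
      (((hzt.mul hzt).weight_congr fun _ _ => one_mul _).add (hyt.mono hsmall)).congr'
        (fun ε s => by ring) |>.weight_congr fun _ _ => (one_pow 2).symm
    refine h1.sqrt (hzy.mono fun ε h s => by linarith [h s])
      ⟨32, 0, by norm_num, hzy.mono fun ε h s => ?_⟩ (Eventually.of_forall fun _ _ => one_ne_zero)
    have := h s
    rw [abs_of_pos (by linarith : 0 < z ε s ^ 2 + y ε s)]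
    simp only [one_pow, abs_one, pow_zero, mul_one]
    linarith
  have hηt : SmoothTame (𝓝 (0 : ℝ)) (fun ε s => ε * kap γ s) η := by
    -- `η = y / (√(z² + y) + z)`, so `η` inherits the weight of `y`.
    have h1 := (hsq.add hzt).inv (hzpos.mono fun ε h s => by
        have := Real.sqrt_nonneg (z ε s ^ 2 + y ε s); linarith [h s]) ⟨4, 0, by norm_num,
        hzpos.mono fun ε h s => by
          have := Real.sqrt_nonneg (z ε s ^ 2 + y ε s)
          have h4 := h s
          rw [abs_of_pos (by linarith : 0 < √(z ε s ^ 2 + y ε s) + z ε s)]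
          simp only [abs_one, pow_zero, mul_one]
          linarith⟩ (Eventually.of_forall fun _ _ => one_ne_zero)
    refine ((hyt.mul h1).congr ?_).weight_congr fun ε s => by simp
    filter_upwards [hzpos, hzy] with ε h2 h3
    funext s
    have h4 : √(z ε s ^ 2 + y ε s) + z ε s ≠ 0 := by
      have := Real.sqrt_nonneg (z ε s ^ 2 + y ε s); linarith [h2 s]
    have h5 := Real.sq_sqrt (show 0 ≤ z ε s ^ 2 + y ε s by linarith [h3 s])
    simp only [η]
    field_simp
    linear_combination -h5
  -- values where the bump vanishes
  have hyz : ∀ ε s, b s = 0 → y ε s = 0 := fun ε s hs => by simp [y, hs]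
  have hηz : ∀ᶠ ε in 𝓝 (0 : ℝ), ∀ s, b s = 0 → η ε s = 0 := by
    filter_upwards [hzpos] with ε h s hs
    simp only [η]
    rw [hyz ε s hs, add_zero, Real.sqrt_sq (by linarith [h s]), sub_self]
  have hz00 : ∀ s, 1 / 4 ≤ z 0 s := hzpos.self_of_nhds
  have hy0 : ∀ s, y 0 s = 0 := fun s => by simp [y, hd0]
  have hη0 : ∀ s, η 0 s = 0 := fun s => by
    simp only [η]
    rw [hy0, add_zero, Real.sqrt_sq (by linarith [hz00 s]), sub_self]
  -- `y` vanishes to first order, hence `√(z² + y)` and `z` have the same derivative at `ε = 0`.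
  have hηd : ∀ s, HasDerivAt (fun ε => η ε s) 0 0 := by
    intro s
    have a1 : ∀ i, HasDerivAt (fun ε => tC γ.1 i s + D i ε s) (x i s) 0 := fun i =>
      (hD.velocity i s).const_add _
    have a2 : HasDerivAt (fun ε => θ ε s) (∑ i, x i s * e i) 0 :=
      HasDerivAt.fun_sum fun i _ => (a1 i).mul_const (e i)
    have a3 : HasDerivAt (fun ε => z ε s) (b₂ s * ∑ i, x i s * e i) 0 :=
      (a2.const_mul (b₂ s)).add_const _
    have a4 : ∀ i, HasDerivAt (fun ε => b s * d i ε) 0 0 := fun i => by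
      simpa using (hdd i).const_mul (b s)
    have a5 : HasDerivAt (fun ε => y ε s) 0 0 := by
      have := ((HasDerivAt.fun_sum (u := Finset.univ) fun i _ =>
        (a4 i).fun_mul (a1 i)).const_mul (-2)).fun_sub
        (HasDerivAt.fun_sum (u := Finset.univ) fun i _ => (a4 i).fun_mul (a4 i))
      refine HasDerivAt.congr_deriv (f := fun ε => y ε s) this ?_
      simp [hd0]
    have hzs := hz00 s
    have a6 := (((a3.fun_pow 2).fun_add a5).sqrt (by
      rw [hy0]; positivity)).fun_sub a3
    refine HasDerivAt.congr_deriv (f := fun ε => η ε s) a6 ?_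
    have hsz : √(z 0 s ^ 2 + y 0 s) = z 0 s := by
      rw [hy0, add_zero, Real.sqrt_sq (by linarith)]
    have : z 0 s ≠ 0 := by linarith
    rw [hsz]
    push_cast
    field_simp
    ring
  -- the correction
  let F : Fin 3 → ℝ → ℝ → ℝ := fun i ε s => b s * d i ε + η ε s * e i
  have hFt : ∀ i, SmoothTame (𝓝 (0 : ℝ)) (fun ε s => ε * kap γ s) (F i) := fun i =>
    (hbd i).add ((hηt.const_mul (e i)).congr' fun ε s => mul_comm _ _)
  have hFz : ∀ᶠ ε in 𝓝 (0 : ℝ), ∀ i s, b s = 0 → F i ε s = 0 := by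
    filter_upwards [hηz] with ε h i s hs
    simp [F, hs, h s hs]
  have hFs : ∀ᶠ ε in 𝓝 (0 : ℝ), ∀ i s, |s₀| + 6 < |s| → F i ε s = 0 := by
    filter_upwards [hFz] with ε h i s hs
    refine h i s (hbz s ?_)
    have := abs_sub_abs_le_abs_sub s (s₀ + 4)
    have h2 := abs_add_le s₀ 4
    have h3 : |(4 : ℝ)| = 4 := abs_of_pos (by norm_num)
    linarith
  refine ⟨fun i ε s => D i ε s + F i ε s, ⟨fun i => (hD.tame i).add (hFt i), ?_, ?_, ?_, ?_, ?_⟩, ?_⟩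
  · intro i t ht
    filter_upwards [hD.deriv_small i (t / 2) (by positivity), deriv_small_of_support γ (hFt i)
      (hFs.mono fun ε h => h i) (half_pos ht), (hD.tame i).1, (hFt i).1] with ε h1 h2 h3 h4 s
    rw [deriv_fun_add (h3.differentiable (by simp) s) (h4.differentiable (by simp) s)]
    have := abs_add_le (deriv (D i ε) s) (deriv (F i ε) s)
    linarith [h1 s, h2 s]
  · filter_upwards [hD.support, hFs] with ε h1 h2
    obtain ⟨R, hR⟩ := h1
    refine ⟨max R (|s₀| + 6), fun i s hs => ?_⟩
    rw [hR i s ((le_max_left _ _).trans_lt hs), h2 i s ((le_max_right _ _).trans_lt hs), add_zero]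
  · intro i s
    have := (hD.velocity i s).fun_add (((hdd i).const_mul (b s)).fun_add ((hηd s).mul_const (e i)))
    simpa [F] using this
  · intro i s
    simp [F, hD.base, hd0, hη0]
  · filter_upwards [hD.unit, hFz, hzpos, hzy] with ε h1 h2 h3 h4 s
    by_cases hs : b s = 0
    · simpa [h2 _ s hs] using h1 s
    · have hb2 : b₂ s = 1 := by
        refine hb₂one s ?_
        by_contra! hlt
        exact hs (hbz s (by linarith))
      have hzθ : z ε s = ∑ i, (tC γ.1 i s + D i ε s) * e i := by simp [z, hb2, θ]
      have h5 := Real.sq_sqrt (show 0 ≤ z ε s ^ 2 + y ε s by linarith [h4 s])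
      have h6 : η ε s ^ 2 + 2 * η ε s * z ε s = y ε s := by
        simp only [η]
        linear_combination h5
      have h7 := h1 s
      have h8 := hde ε
      have h9 : y ε s = -2 * (∑ i, (b s * d i ε) * (tC γ.1 i s + D i ε s)) -
        ∑ i, (b s * d i ε) * (b s * d i ε) := rfl
      rw [hzθ] at h6
      simp only [F, Fin.sum_univ_three] at *
      linear_combination h7 + h6 + h9 + 2 * b s * η ε s * h8 + η ε s ^ 2 * hee
  · filter_upwards [eventually_all.2 fun i => (hD.tame i).eventually_integrable,
      hηt.eventually_integrable] with ε h1 h2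
    refine ⟨(∑ j, (∫ s, D j ε s) * e j) + ∫ s, η ε s, fun i => ?_⟩
    have h3 : Integrable fun s => b s * d i ε := hbi.mul_const _
    have h4 : Integrable fun s => η ε s * e i := h2.mul_const _
    have h5 : ∫ s, (D i ε s + (b s * d i ε + η ε s * e i)) =
        (∫ s, D i ε s) + (β * d i ε + (∫ s, η ε s) * e i) := by
      have h6 : Integrable fun s => b s * d i ε + η ε s * e i := h3.add h4
      rw [integral_add (h1 i) h6, integral_add h3 h4, integral_mul_const,
        integral_mul_const]
    refine h5.trans ?_
    have : β * d i ε = -((∫ s, D i ε s) - (∑ j, (∫ s, D j ε s) * e j) * e i) := by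
      simp only [d]
      field_simp
    rw [this]
    ring

end Correction
end Filament

namespace Filament

variable {γ₀ : ℝ → E3} {p e : E3}

/-! ### Behaviour of the tangent fields at the ends -/

section Ends

variable {g h : ScalarField γ₀}

theorem Good.tendsto_zero {f : ScalarField γ₀} (hf : Good 1 f) (γ : BAL γ₀) :
    Tendsto (f γ) (atBot ⊔ atTop) (𝓝 0) :=
  tendsto_zero_of_reg γ ((hf.reg γ).weight_congr fun s => zpow_one _)

theorem Good.integrable_one {f : ScalarField γ₀} (hf : Good 1 f) (γ : BAL γ₀) :
    Integrable (f γ) :=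
  integrable_of_reg γ (n := 0) ((hf.reg γ).weight_congr fun s => by simp)

theorem tendsto_coordF_wp (hline : AsymptoticToLine p e γ₀) (hg : Good 1 g) (hh : Good 1 h)
    (γ : BAL γ₀) (i : Fin 3) :
    Tendsto (coordF (wp g h) i γ) atTop (𝓝 (1 / 2 * (∫ t, (kap * g : ScalarField γ₀) γ t) * e i)) ∧
    Tendsto (coordF (wp g h) i γ) atBot (𝓝 (-(1 / 2 * (∫ t, (kap * g : ScalarField γ₀) γ t) * e i))) := by
  have hint := hg.kap_mul.integrable γ
  have hn := (hg.mul_zero_right (good_nF i)).tendsto_zero γ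
  have hb := (hh.mul_zero_right (good_bF i)).tendsto_zero γ
  constructor
  · have h1 := (((tendsto_anti_atTop hint).mul (tendsto_tC hline γ i).1).add
      (hn.mono_left le_sup_right)).add (hb.mono_left le_sup_right)
    rw [add_zero, add_zero] at h1
    exact h1
  · have h1 := (((tendsto_anti_atBot hint).mul (tendsto_tC hline γ i).2).add
      (hn.mono_left le_sup_left)).add (hb.mono_left le_sup_left)
    rw [add_zero, add_zero, neg_mul] at h1
    exact h1

theorem hasDerivAt_coordF_wp (hg : Good 1 g) (hh : Good 1 h) (γ : BAL γ₀) (i : Fin 3) (s : ℝ) :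
    HasDerivAt (coordF (wp g h) i γ) (dS (coordF (wp g h) i) γ s) s :=
  ((good_coordF_wp hg hh i).differentiable γ s).hasDerivAt

/-- The symmetric choice of `∂ₛ⁻¹` makes the field tend to `±½ (∫ κ g) e`: the normal components
decay and `T → e`. Opposite limits characterize the balanced antiderivative, so the field is
recovered from the velocity of the tangent alone. -/
theorem coordF_wp_eq_anti (hline : AsymptoticToLine p e γ₀) (hg : Good 1 g) (hh : Good 1 h)
    (γ : BAL γ₀) (i : Fin 3) :
    coordF (wp g h) i γ = anti (dS (coordF (wp g h) i) γ) := by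
  obtain ⟨h1, h2⟩ := tendsto_coordF_wp hline hg hh γ i
  have hG := good_dS_coordF_wp hg hh i
  exact eq_anti_of_hasDerivAt (hG.contDiff γ).continuous (hG.integrable_one γ)
    (hasDerivAt_coordF_wp hg hh γ i) h1 h2

theorem integral_dS_coordF_wp (hline : AsymptoticToLine p e γ₀) (hg : Good 1 g) (hh : Good 1 h)
    (γ : BAL γ₀) (i : Fin 3) :
    ∫ s, dS (coordF (wp g h) i) γ s = (∫ t, (kap * g : ScalarField γ₀) γ t) * e i := by
  obtain ⟨h1, h2⟩ := tendsto_coordF_wp hline hg hh γ i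
  refine (integral_of_hasDerivAt_of_tendsto (hasDerivAt_coordF_wp hg hh γ i)
    ((good_dS_coordF_wp hg hh i).integrable_one γ) h2 h1).trans ?_
  ring

end Ends

/-! ### Curves with prescribed change of the unit tangent -/

section Perturbation

theorem tendsto_of_coord {l : Filter ℝ} {c : ℝ → E3} {v : E3}
    (h : ∀ i, Tendsto (fun s => c s i) l (𝓝 (v i))) : Tendsto c l (𝓝 v) := by
  rw [tendsto_iff_norm_sub_tendsto_zero]
  have h1 : Tendsto (fun s => ∑ i, |c s i - v i|) l (𝓝 0) := by
    have := tendsto_finsetSum Finset.univ fun i _ => ((h i).sub_const (v i)).abs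
    simpa using this
  exact squeeze_zero (fun s => norm_nonneg _) (fun s => norm_le_sum_abs _) h1

/-- The curve whose unit tangent differs from that of `γ` by `u`. -/
noncomputable def perturb (γ : ℝ → E3) (u : Fin 3 → ℝ → ℝ) (s : ℝ) : E3 :=
  γ s + WithLp.toLp 2 fun i => anti (u i) s

theorem perturb_coord (γ : ℝ → E3) (u : Fin 3 → ℝ → ℝ) (i : Fin 3) (s : ℝ) :
    perturb γ u s i = γ s i + anti (u i) s := rfl

variable {γ : BAL γ₀} {u : Fin 3 → ℝ → ℝ}

theorem hasDerivAt_perturb_coord (hu : ∀ i, Continuous (u i)) (hi : ∀ i, Integrable (u i))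
    (i : Fin 3) (s : ℝ) :
    HasDerivAt (fun s => perturb γ.1 u s i) (tC γ.1 i s + u i s) s :=
  (hasDerivAt_curve_coord γ.2.apc i s).fun_add (hasDerivAt_anti (hu i) (hi i) s)

theorem tC_perturb (hu : ∀ i, Continuous (u i)) (hi : ∀ i, Integrable (u i)) (i : Fin 3) :
    tC (perturb γ.1 u) i = fun s => tC γ.1 i s + u i s := by
  have hd : Differentiable ℝ (perturb γ.1 u) := fun s =>
    (hasDerivAt_coord (v := WithLp.toLp 2 fun i => tC γ.1 i s + u i s).2
      fun i => hasDerivAt_perturb_coord hu hi i s).differentiableAt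
  funext s
  rw [tC, tang, deriv_coord hd]
  exact (hasDerivAt_perturb_coord hu hi i s).deriv

theorem contDiff_perturb (hu : ∀ i, ContDiff ℝ ∞ (u i)) (hi : ∀ i, Integrable (u i)) :
    ContDiff ℝ ∞ (perturb γ.1 u) := by
  refine contDiff_coord.2 fun i => ?_
  have hd := hasDerivAt_perturb_coord (γ := γ) (fun i => (hu i).continuous) hi i
  rw [contDiff_infty_iff_deriv]
  refine ⟨fun s => (hd s).differentiableAt, ?_⟩
  rw [show deriv (fun s => perturb γ.1 u s i) = fun s => tC γ.1 i s + u i s from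
    funext fun s => (hd s).deriv]
  exact (contDiff_tC γ.2.apc i).add (hu i)

theorem isAPC_perturb (hu : ∀ i, ContDiff ℝ ∞ (u i)) (hi : ∀ i, Integrable (u i))
    (hunit : ∀ s, ∑ i, (tC γ.1 i s + u i s) * (tC γ.1 i s + u i s) = 1) :
    IsAPC (perturb γ.1 u) := by
  refine ⟨contDiff_perturb hu hi, fun s => ?_⟩
  have h1 : ‖deriv (perturb γ.1 u) s‖ ^ 2 = 1 := by
    rw [norm_sq_eq_sum, ← hunit s]
    refine Finset.sum_congr rfl fun i _ => ?_
    have := congrFun (tC_perturb (γ := γ) (fun i => (hu i).continuous) hi i) s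
    rw [← this]
    rfl
  exact (pow_eq_one_iff_of_nonneg (norm_nonneg _) two_ne_zero).1 h1

/-- Three coordinates, each moved by at most `κ / 6`, change `T'` by at most half of its length `κ`.
-/
theorem curv_le_perturb (hu : ∀ i, ContDiff ℝ ∞ (u i)) (hi : ∀ i, Integrable (u i))
    (hunit : ∀ s, ∑ i, (tC γ.1 i s + u i s) * (tC γ.1 i s + u i s) = 1)
    (hsmall : ∀ i s, |deriv (u i) s| ≤ 1 / 6 * kap γ s) (s : ℝ) :
    curv γ.1 s ≤ 2 * curv (perturb γ.1 u) s := by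
  have hapc := isAPC_perturb hu hi hunit
  have h1 : ‖deriv (tang γ.1) s - deriv (tang (perturb γ.1 u)) s‖ ≤ 1 / 2 * kap γ s := by
    refine (norm_le_sum_abs _).trans ?_
    have h2 : ∀ i, |(deriv (tang γ.1) s - deriv (tang (perturb γ.1 u)) s) i| ≤ 1 / 6 * kap γ s := by
      intro i
      rw [PiLp.sub_apply, deriv_coord ((contDiff_tang γ.2.apc).differentiable (by simp)),
        deriv_coord ((contDiff_tang hapc).differentiable (by simp))]
      change |deriv (tC γ.1 i) s - deriv (tC (perturb γ.1 u) i) s| ≤ _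
      rw [tC_perturb (fun i => (hu i).continuous) hi, deriv_fun_add
        ((contDiff_tC γ.2.apc i).differentiable (by simp) s) ((hu i).differentiable (by simp) s),
        sub_add_cancel_left, abs_neg]
      exact hsmall i s
    simp only [Fin.sum_univ_three]
    linarith [h2 0, h2 1, h2 2]
  have h3 := norm_sub_norm_le (deriv (tang γ.1) s) (deriv (tang (perturb γ.1 u)) s)
  have h4 : kap γ s = ‖deriv (tang γ.1) s‖ := rfl
  rw [curv, curv]
  linarith

/-- The balanced antiderivative moves the two ends by `±(c / 2) e`, that is, along the line and by
opposite amounts. This is precisely a change of the renormalized length. -/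
theorem isBalanced_perturb (hline : AsymptoticToLine p e γ₀)
    (hi : ∀ i, Integrable (u i)) {c : ℝ} (hc : ∀ i, ∫ s, u i s = c * e i) :
    IsBalanced γ₀ (perturb γ.1 u) (renLength γ - c) := by
  obtain ⟨⟨a, ha⟩, ⟨b, hb⟩⟩ := hline
  obtain ⟨h1, h2⟩ := (isBalanced_iff ha hb).1 γ.2.balanced.choose_spec
  change Tendsto (fun s => γ.1 s - (p + (s + (a - renLength γ / 2)) • e)) _ _ at h1
  change Tendsto (fun s => γ.1 s - (p + (s + (b + renLength γ / 2)) • e)) _ _ at h2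
  refine (isBalanced_iff ha hb).2 ⟨?_, ?_⟩
  · have h3 : Tendsto (fun s => (WithLp.toLp 2 fun i => anti (u i) s : E3)) atTop
        (𝓝 ((c / 2) • e)) := tendsto_of_coord fun i => by
      have := tendsto_anti_atTop (hi i)
      rw [hc] at this
      convert this using 2
      simp only [PiLp.smul_apply, smul_eq_mul]
      ring
    have h4 := (h1.add h3).sub_const ((c / 2) • e)
    rw [zero_add, sub_self] at h4
    refine h4.congr fun s => ?_
    simp only [perturb]
    module
  · have h3 : Tendsto (fun s => (WithLp.toLp 2 fun i => anti (u i) s : E3)) atBot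
        (𝓝 (-((c / 2) • e))) := tendsto_of_coord fun i => by
      have := tendsto_anti_atBot (hi i)
      rw [hc] at this
      convert this using 2
      simp only [PiLp.neg_apply, PiLp.smul_apply, smul_eq_mul]
      ring
    have h4 := (h2.add h3).sub_const (-((c / 2) • e))
    rw [zero_add, sub_self] at h4
    refine h4.congr fun s => ?_
    simp only [perturb]
    module

theorem eqOn_deriv {V : Type*} [NormedAddCommGroup V] [NormedSpace ℝ V] {f g : ℝ → V} {O : Set ℝ}
    (hO : IsOpen O) (h : Set.EqOn f g O) : Set.EqOn (deriv f) (deriv g) O := fun s hs =>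
  (Filter.eventuallyEq_of_mem (hO.mem_nhds hs) h).deriv_eq

/-- The asymptotic conditions depend only on the unit tangent near the ends. -/
theorem IsBAL.of_eq_tang {δ : ℝ → E3} (hδ : IsAPC δ) (h0 : ∀ s, curv δ s ≠ 0)
    (hb : ∃ l, IsBalanced γ₀ δ l) {R : ℝ} (hR : ∀ s, R < |s| → tang δ s = tang γ.1 s) :
    IsBAL γ₀ δ := by
  let O : Set ℝ := {s | R < |s|}
  have hO : IsOpen O := isOpen_lt continuous_const continuous_abs
  have hev : ∀ᶠ s in atBot ⊔ atTop, s ∈ O := by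
    refine eventually_sup.2 ⟨?_, ?_⟩
    · filter_upwards [eventually_lt_atBot (-R)] with s hs
      exact lt_of_lt_of_le (by linarith) (neg_le_abs s)
    · filter_upwards [eventually_gt_atTop R] with s hs
      exact lt_of_lt_of_le hs (le_abs_self s)
  have e0 : Set.EqOn (tang δ) (tang γ.1) O := fun s hs => hR s hs
  have e1 := eqOn_deriv hO e0
  have e2 : Set.EqOn (curv δ) (curv γ.1) O := fun s hs => by rw [curv, curv, e1 hs]
  have e3 : Set.EqOn (norml δ) (norml γ.1) O := fun s hs => by rw [norml, norml, e1 hs, e2 hs]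
  have e4 := eqOn_deriv hO e3
  have e5 : Set.EqOn (tors δ) (tors γ.1) O := fun s hs => by
    rw [tors, tors, e4 hs, binorm, binorm, e0 hs, e3 hs]
  have hit : ∀ {f g : ℝ → ℝ}, Set.EqOn f g O → ∀ n, Set.EqOn (iteratedDeriv n f) (iteratedDeriv n g) O := by
    intro f g h n
    induction n with
    | zero => simpa using h
    | succ n ih => rw [iteratedDeriv_succ, iteratedDeriv_succ]; exact eqOn_deriv hO ih
  refine ⟨hδ, h0, hb, fun P => ?_, fun n => ?_, fun n => ?_⟩
  · refine (γ.2.curv_rapid P).congr' (hev.mono fun s hs => ?_)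
    simp only [e2 hs]
  · obtain ⟨P, hP, h⟩ := γ.2.curv_poly n
    refine ⟨P, hP, h.congr' (hev.mono fun s hs => ?_)⟩
    simp only [e2 hs, hit e2 n hs]
  · obtain ⟨P, hP, h⟩ := γ.2.tors_poly n
    refine ⟨P, hP, h.congr' (hev.mono fun s hs => ?_)⟩
    simp only [hit e5 n hs]

end Perturbation

/-! ### Existence of variations -/

section Existence

theorem anti_zero (s : ℝ) : anti (fun _ => 0) s = 0 := by simp [anti]

open Classical in
/-- Every curve has a variation along `wp g h`. -/
theorem exists_isVariation (he : ‖e‖ = 1) (hline : AsymptoticToLine p e γ₀) {g h : ScalarField γ₀}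
    (hg : Good 1 g) (hh : Good 1 h) (γ : BAL γ₀) :
    ∃ Γ : ℝ → BAL γ₀, IsVariation γ (wp g h γ) Γ := by
  let x : Fin 3 → ℝ → ℝ := fun i => dS (coordF (wp g h) i) γ
  have hxG := fun i => good_dS_coordF_wp hg hh i
  have hx : ∀ i, Reg (kap γ) (x i) := fun i =>
    ((hxG i).reg γ).weight_congr fun s => zpow_one _
  have horth : ∀ s, ∑ i, tC γ.1 i s * x i s = 0 := by
    intro s
    have h1 := sum_tC_nC γ.2.apc γ.2.curv_ne_zero s
    have h2 := (frenet_frame γ.2.apc γ.2.curv_ne_zero s).2.1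
    have h3 : ∀ i, x i s = pF g h γ s * nC γ.1 i s + qF g h γ s * bC γ.1 i s := fun i => by
      simp only [x]
      rw [dS_coordF_wp hg hh]
      rfl
    simp only [h3, Fin.sum_univ_three] at *
    linear_combination pF g h γ s * h1 + qF g h γ s * h2
  obtain ⟨D, hD⟩ := exists_tangentDeformation γ hx horth
  obtain ⟨E, hE, hpar⟩ := hD.exists_correction he hline hx (integral_dS_coordF_wp hline hg hh γ)
  let c : ℝ → ℝ → E3 := fun ε => perturb γ.1 fun i => E i ε
  have hint := eventually_all.2 fun i => (hE.tame i).eventually_integrable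
  have hsm := eventually_all.2 fun i => (hE.tame i).1
  have hcurv : ∀ᶠ ε in 𝓝 (0 : ℝ), ∀ s, curv γ.1 s ≤ 2 * curv (c ε) s := by
    filter_upwards [hint, hsm, hE.unit,
      eventually_all.2 fun i => hE.deriv_small i (1 / 6) (by norm_num)] with ε h1 h2 h3 h4
    exact curv_le_perturb h2 h1 h3 h4
  have hBAL : ∀ᶠ ε in 𝓝 (0 : ℝ), IsBAL γ₀ (c ε) := by
    filter_upwards [hint, hsm, hE.unit, hE.support, hpar, hcurv] with ε h1 h2 h3 h4 h5 h6
    obtain ⟨R, hR⟩ := h4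
    obtain ⟨k, hk⟩ := h5
    refine IsBAL.of_eq_tang (γ := γ) (isAPC_perturb h2 h1 h3) (fun s hs => ?_)
      ⟨_, isBalanced_perturb hline h1 hk⟩ (R := R) fun s hs => ?_
    · have := h6 s
      rw [hs, mul_zero] at this
      exact absurd this (not_le.2 (kap_pos γ s))
    · ext i
      have := congrFun (tC_perturb (γ := γ) (fun i => (h2 i).continuous) h1 i) s
      rw [hR i s hs, add_zero] at this
      exact this
  -- The construction yields a balanced curve only for small `ε`; elsewhere the value `γ` is
  -- irrelevant, all clauses being local at `0`.
  let Γ : ℝ → BAL γ₀ := fun ε => if h : IsBAL γ₀ (c ε) then ⟨c ε, h⟩ else γ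
  have hΓ : ∀ᶠ ε in 𝓝 (0 : ℝ), (Γ ε).1 = c ε := by
    filter_upwards [hBAL] with ε hε
    simp [Γ, hε]
  have hc0 : c 0 = γ.1 := by
    funext s
    ext i
    simp only [c]
    rw [perturb_coord, show E i 0 = fun _ => 0 from funext (hE.base i), anti_zero, add_zero]
  have hder : ∀ᶠ ε in 𝓝 (0 : ℝ), ∀ n i s, iteratedDeriv (n + 1) (c ε) s i =
      iteratedDeriv n (tC γ.1 i) s + iteratedDeriv n (E i ε) s := by
    filter_upwards [hint, hsm] with ε h1 h2 n i s
    have e1 := congrFun (iteratedDeriv_coord (contDiff_perturb (γ := γ) h2 h1) (n + 1) i) s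
    have e2 : deriv (fun t => c ε t i) = fun s => tC γ.1 i s + E i ε s := funext fun s =>
      (hasDerivAt_perturb_coord (fun i => (h2 i).continuous) h1 i s).deriv
    have hn : ((n : ℕ) : WithTop ℕ∞) ≤ ∞ := by exact_mod_cast le_top
    refine e1.trans ?_
    rw [iteratedDeriv_succ', e2]
    exact iteratedDeriv_add ((contDiff_tC γ.2.apc i).contDiffAt.of_le hn)
      ((h2 i).contDiffAt.of_le hn)
  refine ⟨Γ, ?_, ?_, ?_, ?_⟩
  · exact Subtype.ext (hΓ.self_of_nhds.trans hc0)
  · intro n s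
    suffices HasDerivAt (fun ε => iteratedDeriv n (c ε) s) (iteratedDeriv n (wp g h γ) s) 0 from
      this.congr_of_eventuallyEq (hΓ.mono fun ε hε => by simp only [hε])
    refine hasDerivAt_coord.2 fun i => ?_
    cases n with
    | zero =>
      simp only [iteratedDeriv_zero]
      -- In order zero the velocity is the balanced antiderivative of `x`, which is the field itself
      -- by `coordF_wp_eq_anti`.
      have h1 : HasDerivAt (fun ε => anti (E i ε) s) (anti (x i) s) 0 :=
        ((hE.hasDerivAt_setIntegral hx i (Set.Iic s)).fun_sub
          (hE.hasDerivAt_setIntegral hx i (Set.Ioi s))).const_mul _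
      have h2 := h1.const_add (γ.1 s i)
      rw [← coordF_wp_eq_anti hline hg hh γ i] at h2
      exact h2
    | succ n =>
      have e1 := congrFun (iteratedDeriv_coord (contDiff_wp hg hh γ) (n + 1) i) s
      have e2 := congrFun (iteratedDeriv_succ' (n := n) (f := fun t => wp g h γ t i)) s
      have h1 := (hasDerivAt_iteratedDeriv_param (contDiff_kap γ).continuous (hE.tame i) (hE.base i)
        (hx i).contDiff (hE.velocity i) n s).const_add (iteratedDeriv n (tC γ.1 i) s)
      refine (h1.congr_of_eventuallyEq (hder.mono fun ε hε => hε n i s)).congr_deriv (e2.symm.trans e1.symm)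
  · intro n hn
    obtain ⟨k, rfl⟩ : ∃ k, n = k + 1 := ⟨n - 1, by omega⟩
    choose C m hC H using fun i => (hE.tame i).2 k
    refine ⟨∑ i, Polynomial.C (C i) * (1 + Polynomial.X ^ 2) ^ m i, ?_⟩
    filter_upwards [hΓ, hder, eventually_all.2 H] with ε h1 h2 h3 s
    have e0 : ∀ i, iteratedDeriv (k + 1) γ.1 s i = iteratedDeriv k (tC γ.1 i) s := fun i => by
      rw [iteratedDeriv_succ']
      exact congrFun (iteratedDeriv_coord (contDiff_tang γ.2.apc) k i) s
    rw [h1, Polynomial.eval_finsetSum]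
    simp only [eval_br_pow]
    refine (norm_le_sum_abs _).trans ?_
    rw [Finset.mul_sum, Finset.sum_mul]
    refine Finset.sum_le_sum fun i _ => ?_
    rw [PiLp.sub_apply, h2, e0, add_sub_cancel_left]
    refine (h3 i s).trans (le_of_eq ?_)
    rw [abs_mul, abs_of_pos (kap_pos γ s)]
    simp only [kap]
    ring
  · refine ⟨Polynomial.C 2, ?_⟩
    filter_upwards [hΓ, hcurv] with ε h1 h2 s
    rw [h1, Polynomial.eval_C]
    exact h2 s

end Existence
end Filament

namespace Filament

variable {γ₀ : ℝ → E3} {p e : E3}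

/-- By `renLength_eq`, `δℓ = -⟨e, ∫ ∂ₛ X⟩`, and the field changes by `(∫ κ g) e` from one end to the
other. -/
theorem hasVar_renLength (he : ‖e‖ = 1) (hline : AsymptoticToLine p e γ₀) {g h : ScalarField γ₀}
    (hg : Good 1 g) (hh : Good 1 h) :
    HasVar (wp g h) (fun γ _ => renLength γ) ((-1 : ℝ) • intS (kap * g)) := by
  intro γ Γ hΓ s
  have h1 : ∀ i, HasDerivAt (fun ε => ∫ t, (tF i (Γ ε) t - tF i γ t))
      (∫ t, dS (coordF (wp g h) i) γ t) 0 := by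
    intro i
    obtain ⟨C, m, hC, H⟩ := (ctl_tF i γ _ Γ hΓ).tame
    refine hasDerivAt_integral_param (F := fun ε t => tF i (Γ ε) t - tF i γ t)
      (b := fun t => C * ((1 + t ^ 2) ^ m * kap γ t ^ (0 + 1)))
      (Eventually.of_forall fun ε =>
        ((contDiff_tC (Γ ε).2.apc i).sub (contDiff_tC γ.2.apc i)).continuous)
      (by simp [hΓ.base]) ((good_dS_coordF_wp hg hh i).contDiff γ).continuous
      ((integrable_br_mul_kap γ m 0).const_mul C) ?_
      fun t => (hasVar_tF_dS hg hh i γ Γ hΓ t).sub_const _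
    filter_upwards [H] with ε hε t
    simp only [hΓ.base, sub_self, sub_zero]
    refine (hε t).trans (le_of_eq ?_)
    rw [abs_mul, abs_of_pos (kap_pos γ t), zero_add, pow_one]
    ring
  have h2 : HasDerivAt (fun ε => renLength γ + -∑ i, e i * ∫ t, (tF i (Γ ε) t - tF i γ t))
      (-∑ i, e i * ∫ t, dS (coordF (wp g h) i) γ t) 0 :=
    ((HasDerivAt.fun_sum fun i _ => (h1 i).const_mul (e i)).fun_neg).const_add _
  refine (h2.congr_of_eventuallyEq ?_).congr_deriv ?_
  · filter_upwards [eventually_all.2 (eventually_integrable_tF_sub hΓ)] with ε hε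
    rw [← renLength_eq he hline hε]
    ring
  · have h3 := sum_sq_eq_one he
    simp only [integral_dS_coordF_wp hline hg hh, Fin.sum_univ_three] at *
    change _ = -1 * ∫ t, (kap * g : ScalarField γ₀) γ t
    linear_combination (-∫ t, (kap * g : ScalarField γ₀) γ t) * h3

/-! ### Variations of expressions; adjoining the unit tangent -/

section Expressions

/-- Scalar fields having an expression as in `IsExpr`, with the elements of `S` as additional
fields of degree `0`. -/
inductive Gen (S : Set (ScalarField γ₀)) : ℤ → ScalarField γ₀ → Prop
  | base {f : ScalarField γ₀} : f ∈ S → Gen S 0 f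
  | kappa : Gen S 1 kap
  | kappaInv : Gen S (-1) kapInv
  | tau : Gen S 0 tau
  | param : Gen S 0 (fun _ s => s)
  | length : Gen S 0 (fun γ _ => renLength γ)
  | one : Gen S 0 1
  | zero (n : ℤ) : Gen S n 0
  | add {n : ℤ} {f g : ScalarField γ₀} : Gen S n f → Gen S n g → Gen S n (f + g)
  | smul {n : ℤ} (c : ℝ) {f : ScalarField γ₀} : Gen S n f → Gen S n (c • f)
  | lower {n : ℤ} {f : ScalarField γ₀} : Gen S n f → Gen S (n - 1) f
  | mul {i j : ℤ} {f g : ScalarField γ₀} : Gen S i f → Gen S j g → Gen S (i + j) (f * g)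
  | deriv {n : ℤ} {f : ScalarField γ₀} : Gen S n f → Gen S n (dS f)
  | anti {f : ScalarField γ₀} : Gen S 2 f → Gen S 0 (antiS f)
  | int {f : ScalarField γ₀} : Gen S 2 f → Gen S 0 (intS f)

variable {S : Set (ScalarField γ₀)} {n m : ℤ} {f g h u w : ScalarField γ₀}

theorem IsExpr.gen (S : Set (ScalarField γ₀)) (hf : IsExpr n f) : Gen S n f := by
  induction hf with
  | kappa => exact .kappa
  | kappaInv => exact .kappaInv
  | tau => exact .tau
  | param => exact .param
  | length => exact .length
  | one => exact .one
  | zero n => exact .zero n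
  | add _ _ h1 h2 => exact h1.add h2
  | smul c _ h1 => exact h1.smul c
  | lower _ h1 => exact h1.lower
  | mul _ _ h1 h2 => exact h1.mul h2
  | deriv _ h1 => exact h1.deriv
  | anti _ h1 => exact h1.anti
  | int _ h1 => exact h1.int

theorem gen_empty_iff : Gen ∅ n f ↔ f ∈ Alg γ₀ n := by
  refine ⟨fun hf => ?_, fun hf => IsExpr.gen ∅ hf⟩
  change IsExpr n f
  induction hf with
  | base h => exact absurd h (Set.notMem_empty _)
  | kappa => exact .kappa
  | kappaInv => exact .kappaInv
  | tau => exact .tau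
  | param => exact .param
  | length => exact .length
  | one => exact .one
  | zero n => exact .zero n
  | add _ _ h1 h2 => exact h1.add h2
  | smul c _ h1 => exact h1.smul c
  | lower _ h1 => exact h1.lower
  | mul _ _ h1 h2 => exact h1.mul h2
  | deriv _ h1 => exact h1.deriv
  | anti _ h1 => exact h1.anti
  | int _ h1 => exact h1.int

namespace Gen

theorem good (he : ‖e‖ = 1) (hline : AsymptoticToLine p e γ₀) (hS : ∀ f ∈ S, Good 0 f)
    (hf : Gen S n f) : Good n f := by
  induction hf with
  | base h => exact hS _ h
  | kappa => exact good_kap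
  | kappaInv => exact good_kapInv
  | tau => exact good_tau
  | param => exact Good.param
  | length => exact good_renLength he hline
  | one => exact Good.one
  | zero n => exact Good.zero n
  | add _ _ h1 h2 => exact h1.add h2
  | smul c _ h1 => exact h1.smul c
  | lower _ h1 => exact h1.lower
  | mul _ _ h1 h2 => exact h1.mul h2
  | deriv _ h1 => exact h1.dS
  | anti _ h1 => exact h1.antiS
  | int _ h1 => exact h1.intS

theorem neg (hf : Gen S n f) : Gen S n (-f) := by simpa using hf.smul (-1)

theorem sub (hf : Gen S n f) (hg : Gen S n g) : Gen S n (f - g) := by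
  simpa [sub_eq_add_neg] using hf.add hg.neg

theorem mul_eq {i j : ℤ} (hf : Gen S i f) (hg : Gen S j g) (hn : i + j = n) : Gen S n (f * g) :=
  hn ▸ hf.mul hg

theorem pF (hg : Gen S 1 g) (hh : Gen S 1 h) : Gen S 1 (pF g h) :=
  (hg.deriv.add (kappa.mul_eq (kappa.mul_eq hg rfl).anti rfl)).sub (tau.mul_eq hh rfl)

theorem qF (hg : Gen S 1 g) (hh : Gen S 1 h) : Gen S 1 (qF g h) :=
  hh.deriv.add (tau.mul_eq hg rfl)

theorem rF (hg : Gen S 1 g) (hh : Gen S 1 h) : Gen S 0 (rF g h) :=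
  kappaInv.mul_eq ((hg.qF hh).deriv.add (tau.mul_eq (hg.pF hh) rfl)) rfl

/-- Fields with an expression have variational derivatives with an expression of the same
degree. -/
theorem exists_hasVar (he : ‖e‖ = 1) (hline : AsymptoticToLine p e γ₀) (hS : ∀ f ∈ S, Good 0 f)
    (hg : Gen S 1 g) (hh : Gen S 1 h)
    (hSv : ∀ f ∈ S, ∃ F, Gen S 0 F ∧ HasVar (wp g h) f F) (hf : Gen S n f) :
    ∃ F, Gen S n F ∧ HasVar (wp g h) f F := by
  have hg' := hg.good he hline hS
  have hh' := hh.good he hline hS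
  have hk : Gen S 1 (dS (Filament.pF g h) - Filament.tau * Filament.qF g h) :=
    (hg.pF hh).deriv.sub (tau.mul_eq (hg.qF hh) rfl)
  induction hf with
  | base h => exact hSv _ h
  | kappa => exact ⟨_, hk, hasVar_kap hg' hh'⟩
  | kappaInv => exact ⟨_, ((kappaInv.mul kappaInv).mul_eq hk rfl).neg, (hasVar_kap hg' hh').inv_kap⟩
  | tau => exact ⟨_, (hg.rF hh).deriv.add ((kappa.mul_eq (hg.qF hh) rfl : Gen S 2 _).lower.lower),
      hasVar_tau hg' hh'⟩
  | param => exact ⟨0, zero 0, HasVar.of_param _⟩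
  | length => exact ⟨_, ((kappa.mul_eq hg rfl).int).smul _, hasVar_renLength he hline hg' hh'⟩
  | one => exact ⟨0, zero 0, HasVar.of_param fun _ => 1⟩
  | zero n => exact ⟨0, zero n, HasVar.of_param fun _ => 0⟩
  | add _ _ h1 h2 =>
    obtain ⟨F, hF, hFv⟩ := h1
    obtain ⟨G, hG, hGv⟩ := h2
    exact ⟨_, hF.add hG, hFv.add hGv⟩
  | smul c _ h1 =>
    obtain ⟨F, hF, hFv⟩ := h1
    exact ⟨_, hF.smul c, hFv.smul c⟩
  | lower _ h1 =>
    obtain ⟨F, hF, hFv⟩ := h1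
    exact ⟨F, hF.lower, hFv⟩
  | mul hf hg h1 h2 =>
    obtain ⟨F, hF, hFv⟩ := h1
    obtain ⟨G, hG, hGv⟩ := h2
    exact ⟨_, (hF.mul hg).add (hf.mul hG), hFv.mul hGv⟩
  | deriv hf h1 =>
    obtain ⟨F, hF, hFv⟩ := h1
    exact ⟨_, hF.deriv, hFv.dS (hf.good he hline hS) (hF.good he hline hS)⟩
  | anti hf h1 =>
    obtain ⟨F, hF, hFv⟩ := h1
    exact ⟨_, hF.anti, hFv.antiS (hf.good he hline hS) (hF.good he hline hS)⟩
  | int hf h1 =>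
    obtain ⟨F, hF, hFv⟩ := h1
    exact ⟨_, hF.int, hFv.intS (hf.good he hline hS) (hF.good he hline hS)⟩

end Gen

theorem good_range_tF : ∀ f ∈ Set.range (tF : Fin 3 → ScalarField γ₀), Good 0 f := by
  rintro _ ⟨i, rfl⟩
  exact good_tF i

/-- Scalar fields having an expression in which the coordinates of the unit tangent may occur. -/
abbrev FrameExpr (n : ℤ) (f : ScalarField γ₀) : Prop := Gen (Set.range tF) n f

theorem frameExpr_tF (i : Fin 3) : FrameExpr 0 (tF i : ScalarField γ₀) := .base ⟨i, rfl⟩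

/-- As an expression `T'` has only degree `0`, the degree of `T`, so the formal degree of `N` is
below the analytic one in `good_nF`. This suffices: `g N` with `g` of degree `1` still has degree
`0`. -/
theorem frameExpr_nF (i : Fin 3) : FrameExpr (-1) (nF i : ScalarField γ₀) := by
  rw [nF_eq]
  exact Gen.kappaInv.mul_eq (frameExpr_tF i).deriv rfl

theorem frameExpr_bF (i : Fin 3) : FrameExpr (-1) (bF i : ScalarField γ₀) := by
  have h : ∀ i j : Fin 3, FrameExpr (-1) (tF i * nF j : ScalarField γ₀) := fun i j =>
    (frameExpr_tF i).mul_eq (frameExpr_nF j) rfl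
  fin_cases i
  · exact bF_zero (γ₀ := γ₀) ▸ (h 1 2).sub (h 2 1)
  · exact bF_one (γ₀ := γ₀) ▸ (h 2 0).sub (h 0 2)
  · exact bF_two (γ₀ := γ₀) ▸ (h 0 1).sub (h 1 0)

theorem frameExpr_coordF_wp (hg : FrameExpr 1 g) (hh : FrameExpr 1 h) (i : Fin 3) :
    FrameExpr 0 (coordF (wp g h) i) :=
  (((Gen.kappa.mul_eq hg rfl).anti.mul_eq (frameExpr_tF i) rfl).add
    (hg.mul_eq (frameExpr_nF i) rfl)).add (hh.mul_eq (frameExpr_bF i) rfl)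

end Expressions

end Filament

namespace Filament

variable {γ₀ : ℝ → E3} {p e : E3}

/-! ### Derivations and their rigidity -/

section Derivations

/-- Operators on the fields with an expression that commute with `∂ₛ`, `∂ₛ⁻¹` and `∫` and satisfy
the Leibniz rule. -/
structure IsDerivation (D : ScalarField γ₀ → ScalarField γ₀) : Prop where
  map : ∀ {n : ℤ} {f : ScalarField γ₀}, FrameExpr n f → FrameExpr n (D f)
  add : ∀ {n : ℤ} {f g : ScalarField γ₀}, FrameExpr n f → FrameExpr n g → D (f + g) = D f + D g
  smul : ∀ (c : ℝ) {n : ℤ} {f : ScalarField γ₀}, FrameExpr n f → D (c • f) = c • D f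
  mul : ∀ {i j : ℤ} {f g : ScalarField γ₀}, FrameExpr i f → FrameExpr j g →
    D (f * g) = D f * g + f * D g
  dS : ∀ {n : ℤ} {f : ScalarField γ₀}, FrameExpr n f → D (dS f) = dS (D f)
  antiS : ∀ {f : ScalarField γ₀}, FrameExpr 2 f → D (antiS f) = antiS (D f)
  intS : ∀ {f : ScalarField γ₀}, FrameExpr 2 f → D (intS f) = intS (D f)

theorem FrameExpr.good (he : ‖e‖ = 1) (hline : AsymptoticToLine p e γ₀) {n : ℤ}
    {f : ScalarField γ₀} (hf : FrameExpr n f) : Good n f :=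
  Gen.good he hline good_range_tF hf

namespace IsDerivation

variable {D E : ScalarField γ₀ → ScalarField γ₀} {n m : ℤ} {f g : ScalarField γ₀}

theorem smul_op (hD : IsDerivation D) (c : ℝ) : IsDerivation fun f => c • D f where
  map hf := (hD.map hf).smul c
  add hf hg := by rw [hD.add hf hg, smul_add]
  smul a n f hf := by rw [hD.smul a hf, smul_comm]
  mul hf hg := by rw [hD.mul hf hg, smul_add, smul_mul_assoc, mul_smul_comm]
  dS hf := by rw [hD.dS hf, dS_smul]
  antiS hf := by rw [hD.antiS hf, antiS_smul]
  intS hf := by rw [hD.intS hf, intS_smul]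

theorem sub_op (he : ‖e‖ = 1) (hline : AsymptoticToLine p e γ₀) (hD : IsDerivation D)
    (hE : IsDerivation E) : IsDerivation fun f => D f - E f where
  map hf := (hD.map hf).sub (hE.map hf)
  add hf hg := by rw [hD.add hf hg, hE.add hf hg]; abel
  smul a n f hf := by rw [hD.smul a hf, hE.smul a hf, smul_sub]
  mul hf hg := by rw [hD.mul hf hg, hE.mul hf hg]; ring
  dS hf := by
    rw [hD.dS hf, hE.dS hf, dS_sub ((hD.map hf).good he hline) ((hE.map hf).good he hline)]
  antiS hf := by
    rw [hD.antiS hf, hE.antiS hf, antiS_sub ((hD.map hf).good he hline) ((hE.map hf).good he hline)]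
  intS hf := by
    rw [hD.intS hf, hE.intS hf, intS_sub ((hD.map hf).good he hline) ((hE.map hf).good he hline)]

theorem neg (hD : IsDerivation D) (hf : FrameExpr n f) : D (-f) = -D f := by
  simpa using hD.smul (-1) hf

theorem sub (hD : IsDerivation D) (hf : FrameExpr n f) (hg : FrameExpr n g) :
    D (f - g) = D f - D g := by
  rw [sub_eq_add_neg, hD.add hf hg.neg, hD.neg hg, sub_eq_add_neg]

theorem zero (hD : IsDerivation D) : D 0 = 0 := by
  simpa using hD.smul 0 (Gen.zero 0)

theorem commutator (he : ‖e‖ = 1) (hline : AsymptoticToLine p e γ₀) (hD : IsDerivation D)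
    (hE : IsDerivation E) : IsDerivation fun f => D (E f) - E (D f) where
  map hf := (hD.map (hE.map hf)).sub (hE.map (hD.map hf))
  add hf hg := by
    rw [hE.add hf hg, hD.add hf hg, hD.add (hE.map hf) (hE.map hg),
      hE.add (hD.map hf) (hD.map hg)]
    abel
  smul a n f hf := by
    rw [hE.smul a hf, hD.smul a hf, hD.smul a (hE.map hf), hE.smul a (hD.map hf), smul_sub]
  mul hf hg := by
    rw [hE.mul hf hg, hD.mul hf hg, hD.add ((hE.map hf).mul hg) (hf.mul (hE.map hg)),
      hE.add ((hD.map hf).mul hg) (hf.mul (hD.map hg)), hD.mul (hE.map hf) hg,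
      hD.mul hf (hE.map hg), hE.mul (hD.map hf) hg, hE.mul hf (hD.map hg)]
    ring
  dS hf := by
    rw [hE.dS hf, hD.dS hf, hD.dS (hE.map hf), hE.dS (hD.map hf),
      dS_sub ((hD.map (hE.map hf)).good he hline) ((hE.map (hD.map hf)).good he hline)]
  antiS hf := by
    rw [hE.antiS hf, hD.antiS hf, hD.antiS (hE.map hf), hE.antiS (hD.map hf),
      antiS_sub ((hD.map (hE.map hf)).good he hline) ((hE.map (hD.map hf)).good he hline)]
  intS hf := by
    rw [hE.intS hf, hD.intS hf, hD.intS (hE.map hf), hE.intS (hD.map hf),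
      intS_sub ((hD.map (hE.map hf)).good he hline) ((hE.map (hD.map hf)).good he hline)]

theorem dS_zero : Filament.dS (0 : ScalarField γ₀) = 0 := by
  simpa using dS_smul 0 (0 : ScalarField γ₀)

theorem antiS_zero : Filament.antiS (0 : ScalarField γ₀) = 0 := by
  simpa using antiS_smul 0 (0 : ScalarField γ₀)

theorem intS_zero : Filament.intS (0 : ScalarField γ₀) = 0 := by
  simpa using intS_smul 0 (0 : ScalarField γ₀)

/-- A derivation is determined by its values on the parameter, the renormalized length and the
coordinates of the unit tangent. -/
theorem eq_zero (hD : IsDerivation D) (h1 : D (fun _ s => s) = 0)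
    (h2 : D (fun γ _ => renLength γ) = 0) (h3 : ∀ i, D (tF i) = 0) (hf : FrameExpr n f) :
    D f = 0 := by
  have hone : D 1 = 0 := by
    have := hD.mul Gen.one Gen.one
    rw [mul_one, one_mul, mul_one] at this
    exact left_eq_add.1 this
  have hmul : ∀ {i j : ℤ} {f g : ScalarField γ₀}, FrameExpr i f → FrameExpr j g → D f = 0 →
      D g = 0 → D (f * g) = 0 := fun hf hg h h' => by
    rw [hD.mul hf hg, h, h', zero_mul, mul_zero, add_zero]
  have hdS : ∀ {n : ℤ} {f : ScalarField γ₀}, FrameExpr n f → D f = 0 →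
      D (Filament.dS f) = 0 := fun hf h => by rw [hD.dS hf, h, dS_zero]
  have hT : ∀ i, FrameExpr 0 (tF i : ScalarField γ₀) := frameExpr_tF
  -- `κ² = Σ (Tᵢ')²` gives `2 κ D κ = 0`, and `κ` never vanishes. The other generators are likewise
  -- reduced to the tangent.
  have hkap : D kap = 0 := by
    have e1 : D (kap * kap) = 0 := by
      have e2 : ∀ i : Fin 3, FrameExpr 0 (Filament.dS (tF i) * Filament.dS (tF i) : ScalarField γ₀) :=
        fun i => (hT i).deriv.mul_eq (hT i).deriv rfl
      have e3 : ∀ i : Fin 3, D (Filament.dS (tF i) * Filament.dS (tF i)) = 0 := fun i =>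
        hmul (hT i).deriv (hT i).deriv (hdS (hT i) (h3 i)) (hdS (hT i) (h3 i))
      rw [kap_mul_kap, Fin.sum_univ_three, hD.add ((e2 0).add (e2 1)) (e2 2),
        hD.add (e2 0) (e2 1), e3, e3, e3, add_zero, add_zero]
    rw [hD.mul Gen.kappa Gen.kappa] at e1
    funext γ s
    have e4 := congrFun (congrFun e1 γ) s
    have e5 := kap_ne γ s
    have e6 : kap γ s * D kap γ s = 0 := by
      simp only [Pi.add_apply, Pi.mul_apply, Pi.zero_apply] at e4
      linarith
    exact (mul_eq_zero.1 e6).resolve_left e5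
  have hinv : D kapInv = 0 := by
    have e1 := hD.mul Gen.kappa Gen.kappaInv
    rw [kap_mul_kapInv, hone, hkap, zero_mul, zero_add] at e1
    have e2 := kap_mul_kapInv (γ₀ := γ₀)
    linear_combination (-kapInv) * e1 - D kapInv * e2
  have hN : ∀ i, D (nF i) = 0 := fun i => by
    rw [nF_eq]
    exact hmul Gen.kappaInv (hT i).deriv hinv (hdS (hT i) (h3 i))
  have hTN : ∀ i j, FrameExpr (-1) (tF i * nF j : ScalarField γ₀) := fun i j =>
    (hT i).mul_eq (frameExpr_nF j) rfl
  have hTN0 : ∀ i j, D (tF i * nF j) = 0 := fun i j =>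
    hmul (hT i) (frameExpr_nF j) (h3 i) (hN j)
  have hB : ∀ i, D (bF i) = 0 := by
    have e1 : ∀ i j k l, D (tF i * nF j - tF k * nF l) = 0 := fun i j k l => by
      rw [hD.sub (hTN i j) (hTN k l), hTN0, hTN0, sub_zero]
    intro i
    fin_cases i
    · exact bF_zero (γ₀ := γ₀) ▸ e1 1 2 2 1
    · exact bF_one (γ₀ := γ₀) ▸ e1 2 0 0 2
    · exact bF_two (γ₀ := γ₀) ▸ e1 0 1 1 0
  have htau : D tau = 0 := by
    have e2 : ∀ i : Fin 3, FrameExpr (-2) (Filament.dS (nF i) * bF i : ScalarField γ₀) :=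
      fun i => (frameExpr_nF i).deriv.mul_eq (frameExpr_bF i) rfl
    have e3 : ∀ i : Fin 3, D (Filament.dS (nF i) * bF i) = 0 := fun i =>
      hmul (frameExpr_nF i).deriv (frameExpr_bF i) (hdS (frameExpr_nF i) (hN i)) (hB i)
    rw [tau_eq, Fin.sum_univ_three, hD.add ((e2 0).add (e2 1)) (e2 2),
      hD.add (e2 0) (e2 1), e3, e3, e3, add_zero, add_zero]
  induction hf with
  | base h =>
    obtain ⟨i, rfl⟩ := h
    exact h3 i
  | kappa => exact hkap
  | kappaInv => exact hinv
  | tau => exact htau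
  | param => exact h1
  | length => exact h2
  | one => exact hone
  | zero n => exact hD.zero
  | add hf hg h h' => rw [hD.add hf hg, h, h', add_zero]
  | smul c hf h => rw [hD.smul c hf, h, smul_zero]
  | lower _ h => exact h
  | mul hf hg h h' => exact hmul hf hg h h'
  | deriv hf h => exact hdS hf h
  | anti hf h => rw [hD.antiS hf, h, antiS_zero]
  | int hf h => rw [hD.intS hf, h, intS_zero]

theorem eq_of_eq (he : ‖e‖ = 1) (hline : AsymptoticToLine p e γ₀) (hD : IsDerivation D)
    (hE : IsDerivation E) (h1 : D (fun _ s => s) = E (fun _ s => s))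
    (h2 : D (fun γ _ => renLength γ) = E (fun γ _ => renLength γ))
    (h3 : ∀ i, D (tF i) = E (tF i)) (hf : FrameExpr n f) : D f = E f :=
  sub_eq_zero.1 ((hD.sub_op he hline hE).eq_zero (sub_eq_zero.2 h1) (sub_eq_zero.2 h2)
    (fun i => sub_eq_zero.2 (h3 i)) hf)

end IsDerivation

end Derivations

/-! ### Variational derivatives along the fields of `℘(𝒳)` -/

section Fields

variable {X Y Z : TangentField γ₀} {n m : ℤ} {f : ScalarField γ₀}

theorem mem_wpX_iff : X ∈ wpX γ₀ ↔ ∃ g h, IsExpr 1 g ∧ IsExpr 1 h ∧ X = wp g h :=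
  ⟨fun ⟨g, hg, h, hh, e⟩ => ⟨g, h, hg, hh, e⟩, fun ⟨g, h, hg, hh, e⟩ => ⟨g, hg, h, hh, e⟩⟩

theorem IsExpr.frameExpr (hf : IsExpr n f) : FrameExpr n f := hf.gen _

theorem exists_isVariation_of_mem (he : ‖e‖ = 1) (hline : AsymptoticToLine p e γ₀)
    (hX : X ∈ wpX γ₀) (γ : BAL γ₀) : ∃ Γ : ℝ → BAL γ₀, IsVariation γ (X γ) Γ := by
  obtain ⟨g, h, hg, hh, rfl⟩ := mem_wpX_iff.1 hX
  exact exists_isVariation he hline (hg.frameExpr.good he hline) (hh.frameExpr.good he hline) γ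

theorem frameExpr_coordF (hX : X ∈ wpX γ₀) (i : Fin 3) : FrameExpr 0 (coordF X i) := by
  obtain ⟨g, h, hg, hh, rfl⟩ := mem_wpX_iff.1 hX
  exact frameExpr_coordF_wp hg.frameExpr hh.frameExpr i

theorem var_eq_of_hasVar (he : ‖e‖ = 1) (hline : AsymptoticToLine p e γ₀) (hX : X ∈ wpX γ₀)
    {V : Type} [NormedAddCommGroup V] [NormedSpace ℝ V] {F G : FieldAlong γ₀ V}
    (h : HasVar X F G) : var X F = G :=
  h.var_eq (exists_isVariation_of_mem he hline hX)

theorem hasVar_var_aux (he : ‖e‖ = 1) (hline : AsymptoticToLine p e γ₀) (hX : X ∈ wpX γ₀)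
    (hf : FrameExpr n f) : FrameExpr n (var X f) ∧ HasVar X f (var X f) := by
  obtain ⟨F, hF, hFv⟩ : ∃ F, FrameExpr n F ∧ HasVar X f F := by
    obtain ⟨g, h, hg, hh, rfl⟩ := mem_wpX_iff.1 hX
    have hg' := hg.frameExpr
    have hh' := hh.frameExpr
    refine Gen.exists_hasVar he hline good_range_tF hg' hh' ?_ hf
    rintro _ ⟨i, rfl⟩
    refine ⟨_, (frameExpr_coordF hX i).deriv,
      hasVar_tF_dS (hg'.good he hline) (hh'.good he hline) i⟩
  rw [var_eq_of_hasVar he hline hX hFv]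
  exact ⟨hF, hFv⟩

theorem frameExpr_var (he : ‖e‖ = 1) (hline : AsymptoticToLine p e γ₀) (hX : X ∈ wpX γ₀)
    (hf : FrameExpr n f) : FrameExpr n (var X f) := (hasVar_var_aux he hline hX hf).1

theorem hasVar_var (he : ‖e‖ = 1) (hline : AsymptoticToLine p e γ₀) (hX : X ∈ wpX γ₀)
    (hf : FrameExpr n f) : HasVar X f (var X f) := (hasVar_var_aux he hline hX hf).2

/-- The variation formulas for `κ`, `κ⁻¹`, `τ` and `ℓ` do not involve the frame, so the induction
over expressions also works with nothing adjoined and stays inside `𝒜ₙ`. -/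
theorem var_mem_alg (he : ‖e‖ = 1) (hline : AsymptoticToLine p e γ₀) (hX : X ∈ wpX γ₀)
    (hf : f ∈ Alg γ₀ n) : var X f ∈ Alg γ₀ n := by
  obtain ⟨g, h, hg, hh, rfl⟩ := mem_wpX_iff.1 hX
  obtain ⟨F, hF, hFv⟩ := Gen.exists_hasVar (S := ∅) he hline (fun _ h => absurd h (Set.notMem_empty _))
    (hg.gen _) (hh.gen _) (fun _ h => absurd h (Set.notMem_empty _)) (IsExpr.gen ∅ hf)
  rw [var_eq_of_hasVar he hline hX hFv]
  exact gen_empty_iff.1 hF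

theorem isDerivation_var (he : ‖e‖ = 1) (hline : AsymptoticToLine p e γ₀) (hX : X ∈ wpX γ₀) :
    IsDerivation (var X) where
  map hf := frameExpr_var he hline hX hf
  add hf hg := var_eq_of_hasVar he hline hX
    ((hasVar_var he hline hX hf).add (hasVar_var he hline hX hg))
  smul c _ _ hf := var_eq_of_hasVar he hline hX ((hasVar_var he hline hX hf).smul c)
  mul hf hg := var_eq_of_hasVar he hline hX
    ((hasVar_var he hline hX hf).mul (hasVar_var he hline hX hg))
  dS hf := var_eq_of_hasVar he hline hX ((hasVar_var he hline hX hf).dS (hf.good he hline)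
    ((frameExpr_var he hline hX hf).good he hline))
  antiS hf := var_eq_of_hasVar he hline hX ((hasVar_var he hline hX hf).antiS (hf.good he hline)
    ((frameExpr_var he hline hX hf).good he hline))
  intS hf := var_eq_of_hasVar he hline hX ((hasVar_var he hline hX hf).intS (hf.good he hline)
    ((frameExpr_var he hline hX hf).good he hline))

theorem var_param (he : ‖e‖ = 1) (hline : AsymptoticToLine p e γ₀) (hX : X ∈ wpX γ₀) :
    var X (fun _ s => s : ScalarField γ₀) = 0 :=
  var_eq_of_hasVar he hline hX (HasVar.of_param _)

theorem var_tF (he : ‖e‖ = 1) (hline : AsymptoticToLine p e γ₀) (hX : X ∈ wpX γ₀) (i : Fin 3) :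
    var X (tF i) = dS (coordF X i) := by
  refine var_eq_of_hasVar he hline hX ?_
  obtain ⟨g, h, hg, hh, rfl⟩ := mem_wpX_iff.1 hX
  exact hasVar_tF_dS (hg.frameExpr.good he hline) (hh.frameExpr.good he hline) i

theorem var_renLength (he : ‖e‖ = 1) (hline : AsymptoticToLine p e γ₀) {g h : ScalarField γ₀}
    (hg : IsExpr 1 g) (hh : IsExpr 1 h) :
    var (wp g h) (fun γ _ => renLength γ : ScalarField γ₀) = (-1 : ℝ) • intS (kap * g) :=
  var_eq_of_hasVar he hline (mem_wpX_iff.2 ⟨g, h, hg, hh, rfl⟩)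
    (hasVar_renLength he hline (hg.frameExpr.good he hline) (hh.frameExpr.good he hline))

theorem tangentField_ext (h : ∀ i, coordF X i = coordF Y i) : X = Y := by
  funext γ s
  ext i
  exact congrFun (congrFun (h i) γ) s

theorem hasVar_var_tangent (he : ‖e‖ = 1) (hline : AsymptoticToLine p e γ₀) (hX : X ∈ wpX γ₀)
    (hY : Y ∈ wpX γ₀) :
    HasVar X Y (var X Y) ∧ ∀ i, coordF (var X Y) i = var X (coordF Y i) := by
  have h1 : HasVar X Y fun γ s => WithLp.toLp 2 fun i => var X (coordF Y i) γ s :=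
    hasVar_iff_coordF.2 fun i => hasVar_var he hline hX (frameExpr_coordF hY i)
  rw [var_eq_of_hasVar he hline hX h1]
  exact ⟨h1, fun i => rfl⟩

theorem coordF_comm (he : ‖e‖ = 1) (hline : AsymptoticToLine p e γ₀) (hX : X ∈ wpX γ₀)
    (hY : Y ∈ wpX γ₀) (i : Fin 3) :
    coordF (comm X Y) i = var X (coordF Y i) - var Y (coordF X i) := by
  rw [← (hasVar_var_tangent he hline hX hY).2, ← (hasVar_var_tangent he hline hY hX).2]
  rfl

end Fields

/-! ### Total derivatives of decaying fields -/

section DecayingFields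

variable {f g h : ScalarField γ₀}

theorem Good.tendsto_zero_two (hf : Good 2 f) (γ : BAL γ₀) :
    Tendsto (f γ) (atBot ⊔ atTop) (𝓝 0) :=
  Good.tendsto_zero (by simpa using hf.lower) γ

/-- A field of degree `2` tends to `0` at both ends, so it is its own balanced primitive. This
disposes of the total derivative that appears in the bracket. -/
theorem antiS_dS (hf : Good 2 f) : antiS (dS f) = f := funext fun γ =>
  (eq_anti_of_hasDerivAt (hf.dS.contDiff γ).continuous (hf.dS.integrable γ)
    (fun s => (hf.differentiable γ s).hasDerivAt) ((hf.tendsto_zero_two γ).mono_left le_sup_right)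
    (by simpa using (hf.tendsto_zero_two γ).mono_left le_sup_left)).symm

theorem intS_dS (hf : Good 2 f) : intS (dS f) = 0 := funext fun γ => funext fun s =>
  (integral_of_hasDerivAt_of_tendsto (fun s => (hf.differentiable γ s).hasDerivAt)
    (hf.dS.integrable γ) ((hf.tendsto_zero_two γ).mono_left le_sup_left)
    ((hf.tendsto_zero_two γ).mono_left le_sup_right)).trans (sub_zero 0)

end DecayingFields

/-! ### Closure under the bracket and the action of a bracket -/

section Bracket

variable {g h u w : ScalarField γ₀}

/-- The `N`-component of `var X (wp u w) - var Y (wp g h)` for `X = wp g h`, `Y = wp u w`. -/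
noncomputable def commN (g h u w : ScalarField γ₀) : ScalarField γ₀ :=
  (var (wp g h) u + antiS (kap * u) * pF g h - w * rF g h) -
    (var (wp u w) g + antiS (kap * g) * pF u w - h * rF u w)

/-- The `B`-component of `var X (wp u w) - var Y (wp g h)` for `X = wp g h`, `Y = wp u w`. -/
noncomputable def commB (g h u w : ScalarField γ₀) : ScalarField γ₀ :=
  (var (wp g h) w + antiS (kap * u) * qF g h + u * rF g h) -
    (var (wp u w) h + antiS (kap * g) * qF u w + g * rF u w)

theorem isExpr_commN (he : ‖e‖ = 1) (hline : AsymptoticToLine p e γ₀) (hg : IsExpr 1 g)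
    (hh : IsExpr 1 h) (hu : IsExpr 1 u) (hw : IsExpr 1 w) : IsExpr 1 (commN g h u w) := by
  have hX := mem_wpX_iff.2 ⟨g, h, hg, hh, rfl⟩
  have hY := mem_wpX_iff.2 ⟨u, w, hu, hw, rfl⟩
  have h1 := IsExpr.gen ∅ (var_mem_alg he hline hX hu)
  have h2 := IsExpr.gen ∅ (var_mem_alg he hline hY hg)
  replace hg := hg.gen ∅
  replace hh := hh.gen ∅
  replace hu := hu.gen ∅
  replace hw := hw.gen ∅
  refine gen_empty_iff.1 (Gen.sub ((h1.add ?_).sub ?_) ((h2.add ?_).sub ?_))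
  · exact (Gen.kappa.mul_eq hu rfl).anti.mul_eq (hg.pF hh) rfl
  · exact hw.mul_eq (hg.rF hh) rfl
  · exact (Gen.kappa.mul_eq hg rfl).anti.mul_eq (hu.pF hw) rfl
  · exact hh.mul_eq (hu.rF hw) rfl

theorem isExpr_commB (he : ‖e‖ = 1) (hline : AsymptoticToLine p e γ₀) (hg : IsExpr 1 g)
    (hh : IsExpr 1 h) (hu : IsExpr 1 u) (hw : IsExpr 1 w) : IsExpr 1 (commB g h u w) := by
  have hX := mem_wpX_iff.2 ⟨g, h, hg, hh, rfl⟩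
  have hY := mem_wpX_iff.2 ⟨u, w, hu, hw, rfl⟩
  have h1 := IsExpr.gen ∅ (var_mem_alg he hline hX hw)
  have h2 := IsExpr.gen ∅ (var_mem_alg he hline hY hh)
  replace hg := hg.gen ∅
  replace hh := hh.gen ∅
  replace hu := hu.gen ∅
  replace hw := hw.gen ∅
  refine gen_empty_iff.1 (Gen.sub ((h1.add ?_).add ?_) ((h2.add ?_).add ?_))
  · exact (Gen.kappa.mul_eq hu rfl).anti.mul_eq (hg.qF hh) rfl
  · exact hu.mul_eq (hg.rF hh) rfl
  · exact (Gen.kappa.mul_eq hg rfl).anti.mul_eq (hu.qF hw) rfl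
  · exact hg.mul_eq (hu.rF hw) rfl

/-- The tangential defect of the commutator. -/
noncomputable def commT (g h u w : ScalarField γ₀) : ScalarField γ₀ :=
  (u * pF g h + w * qF g h) - (g * pF u w + h * qF u w)

theorem good_commT (hg : Good 1 g) (hh : Good 1 h) (hu : Good 1 u) (hw : Good 1 w) :
    Good 2 (commT g h u w) :=
  ((hu.mul (good_pF hg hh)).add (hw.mul (good_qF hg hh))).sub
    ((hg.mul (good_pF hu hw)).add (hh.mul (good_qF hu hw)))

theorem var_kap_mul (he : ‖e‖ = 1) (hline : AsymptoticToLine p e γ₀) (hg : IsExpr 1 g)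
    (hh : IsExpr 1 h) (hu : IsExpr 1 u) :
    var (wp g h) (kap * u) = (dS (pF g h) - tau * qF g h) * u + kap * var (wp g h) u := by
  have hX := mem_wpX_iff.2 ⟨g, h, hg, hh, rfl⟩
  have hD := isDerivation_var he hline hX
  rw [hD.mul Gen.kappa hu.frameExpr, var_eq_of_hasVar he hline hX
    (hasVar_kap (hg.frameExpr.good he hline) (hh.frameExpr.good he hline))]

/-- The compatibility that keeps the bracket in `℘(𝒳)`: `κ` times its normal component must be the
derivative of its tangential component, which is `∂ₛ⁻¹` of the first two terms minus `commT`. The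
derivatives of `pF` in the variations of `κ` cancel against those in `dS (commT g h u w)`; the rest
follows from the definitions of `pF`, `qF`, `rF`. -/
theorem kap_mul_commN (he : ‖e‖ = 1) (hline : AsymptoticToLine p e γ₀) (hg : IsExpr 1 g)
    (hh : IsExpr 1 h) (hu : IsExpr 1 u) (hw : IsExpr 1 w) :
    kap * commN g h u w =
      var (wp g h) (kap * u) - var (wp u w) (kap * g) - dS (commT g h u w) := by
  have hg' := hg.frameExpr.good he hline
  have hh' := hh.frameExpr.good he hline
  have hu' := hu.frameExpr.good he hline
  have hw' := hw.frameExpr.good he hline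
  have hp := good_pF hg' hh'
  have hq := good_qF hg' hh'
  have hP := good_pF hu' hw'
  have hQ := good_qF hu' hw'
  have hd : dS (commT g h u w) = (dS u * pF g h + u * dS (pF g h) + (dS w * qF g h + w * dS (qF g h))) -
      (dS g * pF u w + g * dS (pF u w) + (dS h * qF u w + h * dS (qF u w))) := by
    rw [commT, dS_sub ((hu'.mul hp).add (hw'.mul hq)) ((hg'.mul hP).add (hh'.mul hQ)),
      dS_add (hu'.mul hp) (hw'.mul hq), dS_add (hg'.mul hP) (hh'.mul hQ), dS_mul hu' hp,
      dS_mul hw' hq, dS_mul hg' hP, dS_mul hh' hQ]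
  have h1 : pF g h = dS g + kap * antiS (kap * g) - tau * h := rfl
  have h2 : qF g h = dS h + tau * g := rfl
  have h3 : pF u w = dS u + kap * antiS (kap * u) - tau * w := rfl
  have h4 : qF u w = dS w + tau * u := rfl
  have h5 := kap_mul_kapInv (γ₀ := γ₀)
  rw [var_kap_mul he hline hg hh hu, var_kap_mul he hline hu hw hg, hd, commN, rF, rF]
  generalize pF g h = a at *
  generalize qF g h = b at *
  generalize pF u w = c at *
  generalize qF u w = d at *
  linear_combination (h * (dS d + tau * c) - w * (dS b + tau * a)) * h5 + c * h1 + d * h2 -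
    a * h3 - b * h4

theorem comm_wp (he : ‖e‖ = 1) (hline : AsymptoticToLine p e γ₀) (hg : IsExpr 1 g)
    (hh : IsExpr 1 h) (hu : IsExpr 1 u) (hw : IsExpr 1 w) :
    comm (wp g h) (wp u w) = wp (commN g h u w) (commB g h u w) := by
  have hX := mem_wpX_iff.2 ⟨g, h, hg, hh, rfl⟩
  have hY := mem_wpX_iff.2 ⟨u, w, hu, hw, rfl⟩
  have hT : antiS (kap * commN g h u w) =
      antiS (var (wp g h) (kap * u)) - antiS (var (wp u w) (kap * g)) - commT g h u w := by
    have hku := frameExpr_var he hline hX (Gen.kappa.mul_eq hu.frameExpr rfl : FrameExpr 2 _)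
    have hkg := frameExpr_var he hline hY (Gen.kappa.mul_eq hg.frameExpr rfl : FrameExpr 2 _)
    have hc := good_commT (hg.frameExpr.good he hline) (hh.frameExpr.good he hline)
      (hu.frameExpr.good he hline) (hw.frameExpr.good he hline)
    rw [kap_mul_commN he hline hg hh hu hw, antiS_sub (FrameExpr.good he hline (hku.sub hkg)) hc.dS,
      antiS_sub (hku.good he hline) (hkg.good he hline), antiS_dS hc]
  -- Leibniz rule with the variations of `T`, `N`, `B`. It is stated for arbitrary coefficients
  -- because it is used twice, the second time with the two fields exchanged.
  have key : ∀ {g h u w : ScalarField γ₀}, IsExpr 1 g → IsExpr 1 h → IsExpr 1 u → IsExpr 1 w →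
      ∀ i, var (wp g h) (coordF (wp u w) i) =
        (antiS (var (wp g h) (kap * u)) - u * pF g h - w * qF g h) * tF i +
        (var (wp g h) u + antiS (kap * u) * pF g h - w * rF g h) * nF i +
        (var (wp g h) w + antiS (kap * u) * qF g h + u * rF g h) * bF i := by
    intro g h u w hg hh hu hw i
    have hX := mem_wpX_iff.2 ⟨g, h, hg, hh, rfl⟩
    have hD := isDerivation_var he hline hX
    have hg' := hg.frameExpr.good he hline
    have hh' := hh.frameExpr.good he hline
    have hu' := hu.frameExpr
    have hw' := hw.frameExpr
    have hku : FrameExpr 2 (kap * u) := Gen.kappa.mul_eq hu' rfl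
    have h1 := hku.anti.mul_eq (frameExpr_tF i) rfl
    have h2 := hu'.mul_eq (frameExpr_nF i) rfl
    have h3 := hw'.mul_eq (frameExpr_bF i) rfl
    rw [coordF_wp, hD.add (h1.add h2) h3, hD.add h1 h2, hD.mul hku.anti (frameExpr_tF i),
      hD.mul hu' (frameExpr_nF i), hD.mul hw' (frameExpr_bF i), hD.antiS hku,
      var_eq_of_hasVar he hline hX (hasVar_tF hg' hh' i),
      var_eq_of_hasVar he hline hX (hasVar_nF hg' hh' i),
      var_eq_of_hasVar he hline hX (hasVar_bF hg' hh' i)]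
    ring
  refine tangentField_ext fun i => ?_
  rw [coordF_comm he hline hX hY, key hg hh hu hw, key hu hw hg hh, coordF_wp, hT, commN, commB,
    commT]
  ring

theorem comm_mem (he : ‖e‖ = 1) (hline : AsymptoticToLine p e γ₀) {X Y : TangentField γ₀}
    (hX : X ∈ wpX γ₀) (hY : Y ∈ wpX γ₀) : comm X Y ∈ wpX γ₀ := by
  obtain ⟨g, h, hg, hh, rfl⟩ := mem_wpX_iff.1 hX
  obtain ⟨u, w, hu, hw, rfl⟩ := mem_wpX_iff.1 hY
  exact mem_wpX_iff.2 ⟨_, _, isExpr_commN he hline hg hh hu hw, isExpr_commB he hline hg hh hu hw,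
    comm_wp he hline hg hh hu hw⟩

/-- Both sides are derivations, so it suffices to compare them on `s`, `ℓ` and `T`. On `T` this is
the definition of the bracket differentiated in `s`. On `ℓ` it is `kap_mul_commN` under the
integral, where the total derivative drops out. -/
theorem var_comm (he : ‖e‖ = 1) (hline : AsymptoticToLine p e γ₀) {X Y : TangentField γ₀}
    (hX : X ∈ wpX γ₀) (hY : Y ∈ wpX γ₀) {n : ℤ} {f : ScalarField γ₀} (hf : FrameExpr n f) :
    var (comm X Y) f = var X (var Y f) - var Y (var X f) := by
  have hZ := comm_mem he hline hX hY
  have hDX := isDerivation_var he hline hX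
  have hDY := isDerivation_var he hline hY
  refine ((isDerivation_var he hline hZ).eq_of_eq he hline (hDX.commutator he hline hDY)
    ?_ ?_ (fun i => ?_) hf)
  · rw [var_param he hline hX, var_param he hline hY, var_param he hline hZ, hDX.zero, hDY.zero,
      sub_zero]
  · obtain ⟨g, h, hg, hh, rfl⟩ := mem_wpX_iff.1 hX
    obtain ⟨u, w, hu, hw, rfl⟩ := mem_wpX_iff.1 hY
    have hku : FrameExpr 2 (kap * u) := Gen.kappa.mul_eq hu.frameExpr rfl
    have hkg : FrameExpr 2 (kap * g) := Gen.kappa.mul_eq hg.frameExpr rfl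
    have hc := good_commT (hg.frameExpr.good he hline) (hh.frameExpr.good he hline)
      (hu.frameExpr.good he hline) (hw.frameExpr.good he hline)
    rw [comm_wp he hline hg hh hu hw, var_renLength he hline hg hh, var_renLength he hline hu hw,
      var_renLength he hline (isExpr_commN he hline hg hh hu hw)
        (isExpr_commB he hline hg hh hu hw), hDX.smul _ hku.int, hDY.smul _ hkg.int,
      hDX.intS hku, hDY.intS hkg, kap_mul_commN he hline hg hh hu hw,
      intS_sub (FrameExpr.good he hline ((hDX.map hku).sub (hDY.map hkg))) hc.dS,
      intS_sub ((hDX.map hku).good he hline) ((hDY.map hkg).good he hline), intS_dS hc, sub_zero,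
      smul_sub]
  · rw [var_tF he hline hX, var_tF he hline hY, var_tF he hline hZ,
      hDX.dS (frameExpr_coordF hY i), hDY.dS (frameExpr_coordF hX i),
      coordF_comm he hline hX hY, dS_sub ((hDX.map (frameExpr_coordF hY i)).good he hline)
        ((hDY.map (frameExpr_coordF hX i)).good he hline)]

end Bracket

/-! ### Linearity, the Jacobi identity and the module structure -/

section Linearity

variable {g h u w : ScalarField γ₀}

theorem wp_add (hg : Good 1 g) (hu : Good 1 u) (h w : ScalarField γ₀) :
    wp g h + wp u w = wp (g + u) (h + w) := by
  refine tangentField_ext fun i => ?_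
  have : coordF (wp g h + wp u w) i = coordF (wp g h) i + coordF (wp u w) i := rfl
  rw [this, coordF_wp, coordF_wp, coordF_wp, mul_add kap, antiS_add hg.kap_mul hu.kap_mul]
  ring

theorem wp_smul (c : ℝ) (g h : ScalarField γ₀) : c • wp g h = wp (c • g) (c • h) := by
  refine tangentField_ext fun i => ?_
  have : coordF (c • wp g h) i = c • coordF (wp g h) i := rfl
  rw [this, coordF_wp, coordF_wp, mul_smul_comm, antiS_smul, smul_add, smul_add, smul_mul_assoc,
    smul_mul_assoc, smul_mul_assoc]

/-- The real vector space of the tangent fields `wp g h`. -/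
def wpSubmodule (he : ‖e‖ = 1) (hline : AsymptoticToLine p e γ₀) :
    Submodule ℝ (TangentField γ₀) where
  carrier := wpX γ₀
  add_mem' := by
    intro X Y hX hY
    obtain ⟨g, h, hg, hh, rfl⟩ := mem_wpX_iff.1 hX
    obtain ⟨u, w, hu, hw, rfl⟩ := mem_wpX_iff.1 hY
    exact mem_wpX_iff.2 ⟨_, _, hg.add hu, hh.add hw,
      wp_add (hg.frameExpr.good he hline) (hu.frameExpr.good he hline) h w⟩
  zero_mem' := mem_wpX_iff.2 ⟨0, 0, .zero 1, .zero 1, by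
    have := wp_smul (γ₀ := γ₀) 0 0 0
    rwa [zero_smul, zero_smul] at this⟩
  smul_mem' := by
    intro c X hX
    obtain ⟨g, h, hg, hh, rfl⟩ := mem_wpX_iff.1 hX
    exact mem_wpX_iff.2 ⟨_, _, hg.smul c, hh.smul c, wp_smul c g h⟩

variable {X Y : TangentField γ₀} {n : ℤ} {f : ScalarField γ₀}

/-- Linearity in the field is not formal, since variations along different fields are unrelated. It
holds because both sides are derivations with the same values on `s`, `ℓ` and `T`. -/
theorem var_smul_left (he : ‖e‖ = 1) (hline : AsymptoticToLine p e γ₀) (c : ℝ) (hX : X ∈ wpX γ₀)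
    (hf : FrameExpr n f) : var (c • X) f = c • var X f := by
  have hcX : c • X ∈ wpX γ₀ := (wpSubmodule he hline).smul_mem c hX
  refine (isDerivation_var he hline hcX).eq_of_eq he hline
    ((isDerivation_var he hline hX).smul_op c) ?_ ?_ (fun i => ?_) hf
  · rw [var_param he hline hX, var_param he hline hcX, smul_zero]
  · obtain ⟨g, h, hg, hh, rfl⟩ := mem_wpX_iff.1 hX
    rw [wp_smul, var_renLength he hline (hg.smul c) (hh.smul c), var_renLength he hline hg hh,
      mul_smul_comm, intS_smul, smul_comm]
  · rw [var_tF he hline hX, var_tF he hline hcX]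
    exact dS_smul c _

theorem var_sub_left (he : ‖e‖ = 1) (hline : AsymptoticToLine p e γ₀) (hX : X ∈ wpX γ₀)
    (hY : Y ∈ wpX γ₀) (hf : FrameExpr n f) : var (X - Y) f = var X f - var Y f := by
  have hXY : X - Y ∈ wpX γ₀ := (wpSubmodule he hline).sub_mem hX hY
  refine (isDerivation_var he hline hXY).eq_of_eq he hline
    ((isDerivation_var he hline hX).sub_op he hline (isDerivation_var he hline hY))
    ?_ ?_ (fun i => ?_) hf
  · rw [var_param he hline hX, var_param he hline hY, var_param he hline hXY, sub_zero]
  · obtain ⟨g, h, hg, hh, rfl⟩ := mem_wpX_iff.1 hX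
    obtain ⟨u, w, hu, hw, rfl⟩ := mem_wpX_iff.1 hY
    have hg' := hg.frameExpr.good he hline
    have hu' := hu.frameExpr.good he hline
    have e1 : wp g h - wp u w = wp (g + (-1 : ℝ) • u) (h + (-1 : ℝ) • w) := by
      rw [← wp_add hg' (hu'.smul _), ← wp_smul, neg_one_smul, sub_eq_add_neg]
    rw [e1, var_renLength he hline (hg.add (hu.smul _)) (hh.add (hw.smul _)),
      var_renLength he hline hg hh, var_renLength he hline hu hw, neg_one_smul, neg_one_smul,
      ← sub_eq_add_neg, mul_sub, intS_sub hg'.kap_mul hu'.kap_mul, neg_one_smul, neg_one_smul]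
    abel
  · rw [var_tF he hline hX, var_tF he hline hY, var_tF he hline hXY]
    exact dS_sub ((frameExpr_coordF hX i).good he hline) ((frameExpr_coordF hY i).good he hline)

theorem var_add_left (he : ‖e‖ = 1) (hline : AsymptoticToLine p e γ₀) (hX : X ∈ wpX γ₀)
    (hY : Y ∈ wpX γ₀) (hf : FrameExpr n f) : var (X + Y) f = var X f + var Y f := by
  have h := var_sub_left he hline ((wpSubmodule he hline).add_mem hX hY) hY hf
  rw [add_sub_cancel_right] at h
  rw [h, sub_add_cancel]

variable {Z : TangentField γ₀}

theorem comm_add_left (he : ‖e‖ = 1) (hline : AsymptoticToLine p e γ₀) (hX : X ∈ wpX γ₀)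
    (hY : Y ∈ wpX γ₀) (hZ : Z ∈ wpX γ₀) : comm (X + Y) Z = comm X Z + comm Y Z := by
  refine tangentField_ext fun i => ?_
  have e1 : coordF (comm X Z + comm Y Z) i = coordF (comm X Z) i + coordF (comm Y Z) i := rfl
  have e2 : coordF (X + Y) i = coordF X i + coordF Y i := rfl
  rw [e1, coordF_comm he hline ((wpSubmodule he hline).add_mem hX hY) hZ, coordF_comm he hline hX hZ,
    coordF_comm he hline hY hZ, var_add_left he hline hX hY (frameExpr_coordF hZ i), e2,
    (isDerivation_var he hline hZ).add (frameExpr_coordF hX i) (frameExpr_coordF hY i)]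
  abel

theorem comm_smul_left (he : ‖e‖ = 1) (hline : AsymptoticToLine p e γ₀) (c : ℝ) (hX : X ∈ wpX γ₀)
    (hZ : Z ∈ wpX γ₀) : comm (c • X) Z = c • comm X Z := by
  refine tangentField_ext fun i => ?_
  have e1 : coordF (c • comm X Z) i = c • coordF (comm X Z) i := rfl
  have e2 : coordF (c • X) i = c • coordF X i := rfl
  rw [e1, coordF_comm he hline ((wpSubmodule he hline).smul_mem c hX) hZ, coordF_comm he hline hX hZ,
    var_smul_left he hline c hX (frameExpr_coordF hZ i), e2,
    (isDerivation_var he hline hZ).smul c (frameExpr_coordF hX i), smul_sub]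

theorem comm_swap (X Y : TangentField γ₀) : comm X Y = -comm Y X := (neg_sub _ _).symm

theorem comm_add_right (he : ‖e‖ = 1) (hline : AsymptoticToLine p e γ₀) (hX : X ∈ wpX γ₀)
    (hY : Y ∈ wpX γ₀) (hZ : Z ∈ wpX γ₀) : comm X (Y + Z) = comm X Y + comm X Z := by
  rw [comm_swap, comm_add_left he hline hY hZ hX, comm_swap X Y, comm_swap X Z, neg_add]

theorem comm_smul_right (he : ‖e‖ = 1) (hline : AsymptoticToLine p e γ₀) (c : ℝ)
    (hX : X ∈ wpX γ₀) (hY : Y ∈ wpX γ₀) : comm X (c • Y) = c • comm X Y := by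
  rw [comm_swap, comm_smul_left he hline c hY hX, comm_swap X Y, smul_neg]

theorem coordF_comm_comm (he : ‖e‖ = 1) (hline : AsymptoticToLine p e γ₀) (hX : X ∈ wpX γ₀)
    (hY : Y ∈ wpX γ₀) (hZ : Z ∈ wpX γ₀) (i : Fin 3) :
    coordF (comm X (comm Y Z)) i =
      var X (var Y (coordF Z i)) - var X (var Z (coordF Y i)) -
        (var Y (var Z (coordF X i)) - var Z (var Y (coordF X i))) := by
  rw [coordF_comm he hline hX (comm_mem he hline hY hZ), coordF_comm he hline hY hZ,
    var_comm he hline hY hZ (frameExpr_coordF hX i), (isDerivation_var he hline hX).sub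
      (frameExpr_var he hline hY (frameExpr_coordF hZ i))
      (frameExpr_var he hline hZ (frameExpr_coordF hY i))]

/-- Each double bracket has four iterated variations of coordinate functions, the inner bracket
acting by `var_comm`. The twelve terms cancel in pairs. -/
theorem comm_jacobi (he : ‖e‖ = 1) (hline : AsymptoticToLine p e γ₀) (hX : X ∈ wpX γ₀)
    (hY : Y ∈ wpX γ₀) (hZ : Z ∈ wpX γ₀) :
    comm X (comm Y Z) + comm Y (comm Z X) + comm Z (comm X Y) = 0 := by
  refine tangentField_ext fun i => ?_
  have e1 : coordF (comm X (comm Y Z) + comm Y (comm Z X) + comm Z (comm X Y)) i =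
    coordF (comm X (comm Y Z)) i + coordF (comm Y (comm Z X)) i + coordF (comm Z (comm X Y)) i := rfl
  have e2 : coordF (0 : TangentField γ₀) i = 0 := rfl
  rw [e1, e2, coordF_comm_comm he hline hX hY hZ, coordF_comm_comm he hline hY hZ hX,
    coordF_comm_comm he hline hZ hX hY]
  abel

/-- The commutator as a bilinear map. -/
noncomputable def bracket (he : ‖e‖ = 1) (hline : AsymptoticToLine p e γ₀) :
    wpSubmodule he hline →ₗ[ℝ] wpSubmodule he hline →ₗ[ℝ] wpSubmodule he hline :=
  LinearMap.mk₂ ℝ (fun X Y => ⟨comm X.1 Y.1, comm_mem he hline X.2 Y.2⟩)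
    (fun X Y Z => Subtype.ext (comm_add_left he hline X.2 Y.2 Z.2))
    (fun c X Y => Subtype.ext (comm_smul_left he hline c X.2 Y.2))
    (fun X Y Z => Subtype.ext (comm_add_right he hline X.2 Y.2 Z.2))
    (fun c X Y => Subtype.ext (comm_smul_right he hline c X.2 Y.2))

/-- The action of the tangent fields on the scalar fields of degree `n` by variational
derivatives. -/
noncomputable def action (he : ‖e‖ = 1) (hline : AsymptoticToLine p e γ₀) (n : ℤ) :
    wpSubmodule he hline →ₗ[ℝ] Module.End ℝ (Alg γ₀ n) :=
  LinearMap.mk₂ ℝ (fun X f => ⟨var X.1 f.1, var_mem_alg he hline X.2 f.2⟩)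
    (fun X Y f => Subtype.ext (var_add_left he hline X.2 Y.2 (IsExpr.frameExpr f.2)))
    (fun c X f => Subtype.ext (var_smul_left he hline c X.2 (IsExpr.frameExpr f.2)))
    (fun X f g => Subtype.ext ((isDerivation_var he hline X.2).add (IsExpr.frameExpr f.2)
      (IsExpr.frameExpr g.2)))
    (fun c X f => Subtype.ext ((isDerivation_var he hline X.2).smul c (IsExpr.frameExpr f.2)))

end Linearity

end Filament

open Filament
theorem theorem3 (γ₀ : ℝ → E3) (p e : E3) (he : ‖e‖ = 1)
    (hγ₀ : IsAPC γ₀) (hline : AsymptoticToLine p e γ₀) :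
    -- `℘(𝒳)` is a real vector space
    ∃ P : Submodule ℝ (TangentField γ₀), (P : Set (TangentField γ₀)) = wpX γ₀ ∧
      -- variations with variational vector field in `℘(𝒳)` exist, and derivatives along them
      -- exist and do not depend on the variation
      (∀ X ∈ P, ∀ γ : BAL γ₀, ∃ Γ : ℝ → BAL γ₀, IsVariation γ (X γ) Γ) ∧
      (∀ X ∈ P, ∀ n : ℤ, ∀ f ∈ Alg γ₀ n, HasVar X f (var X f)) ∧
      (∀ X ∈ P, ∀ Y ∈ P, HasVar X Y (var X Y)) ∧
      -- `℘(𝒳)` is a Lie algebra under the commutator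
      ∃ br : P →ₗ[ℝ] P →ₗ[ℝ] P,
        (∀ X Y : P, (br X Y : TangentField γ₀) = comm (X : TangentField γ₀) Y) ∧
        (∀ X : P, br X X = 0) ∧
        (∀ X Y Z : P, br X (br Y Z) + br Y (br Z X) + br Z (br X Y) = 0) ∧
        -- every `𝒜ₙ` is a module over it
        ∀ n : ℤ, ∃ ρ : P →ₗ[ℝ] Module.End ℝ (Alg γ₀ n),
          (∀ (X : P) (f : Alg γ₀ n),
            (ρ X f : ScalarField γ₀) = var (X : TangentField γ₀) (f : ScalarField γ₀)) ∧
          ∀ X Y : P, ρ X * ρ Y - ρ Y * ρ X - ρ (br X Y) = 0 := by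
  refine ⟨wpSubmodule he hline, rfl, fun X hX γ => exists_isVariation_of_mem he hline hX γ,
    fun X hX n f hf => hasVar_var he hline hX (IsExpr.frameExpr hf),
    fun X hX Y hY => (hasVar_var_tangent he hline hX hY).1, bracket he hline, fun X Y => rfl,
    fun X => Subtype.ext (sub_self _),
    fun X Y Z => Subtype.ext (comm_jacobi he hline X.2 Y.2 Z.2), fun n =>
    ⟨action he hline n, fun X f => rfl, fun X Y => LinearMap.ext fun f => Subtype.ext ?_⟩⟩
  have h := var_comm he hline X.2 Y.2 (IsExpr.frameExpr f.2)
  change var X.1 (var Y.1 f.1) - var Y.1 (var X.1 f.1) - var (comm X.1 Y.1) f.1 = 0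
  rw [h, sub_self]
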